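/- **Setting.** Let $f:U'\to U$ be a quadratic-like map: $U',U\subset\mathbb C$ are simply connected regions, $\overline{U'}$ is compact and contained in $U$, and $f$ is a holomorphic double branched covering with critical point $0$. Assume that $0$ never leaves $U'$ (connected Julia set) and that all fixed points of $f$ are repelling. Fix a topological conjugacy of $f$, near its filled Julia set $K(f)$, to a polynomial $P_c:z\mapsto z^2+c$ near $K(P_c)$; external rays and equipotentials of $f$ near $K(f)$ are the images of those of $P_c$ (defined by the Böttcher function of $P_c$). Let $E$ be an equipotential so close to $K(f)$ that $E$ and $f(E)$ are closed curves in the domain where this conjugacy applies. Let $\alpha$ be the dividing fixed point of $f$ (at least two external rays land at it), let $p$ be the number of rays landing at $\alpha$, and assume that the orbit of $0$ does not land at $\alpha$. **Puzzle.** The pieces of depth $0$ are the closures of the components into which the rays landing at $\alpha$ (together with $\alpha$) cut the domain bounded by $E$; the pieces of depth $k+1$ are the closures of the components of the $f$-preimages of the interiors of the pieces of depth $k$. Let $Z_i$ be the pieces of depth $1$ that contain the preimage $\alpha'\ne\alpha$ of $\alpha$ but not $0$. **Pull-backs.** For a closed set $W$ and a point $z$ with $f^l z\in\operatorname{int}W$,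 put $W_0=W$ and let $W_{-k}$ be the closure of the component of $f^{-1}(\operatorname{int}W_{-k+1})$ containing $f^{l-k}z$; $W_{-l}\ni z$ is the pull-back of $W$ along $z,\dots,f^lz$. If $z\in\operatorname{int}W$ returns to $\operatorname{int}W$, and $l>0$ is its first return time, then the corresponding pull-back $P$ is called a piece of the first return map to $W$, and that map is $f^l$ on $P$. **Principal nest.** Suppose that $f^{tp}0\in\operatorname{int}Z_i$ for some $t>0$ and some $i$, and take the least such $t$. Let $V^0$ be the pull-back of that $Z_i$ along $0,\dots,f^{tp}0$. As long as $0$ returns to $\operatorname{int}V^{n}$, let $V^{n+1}\ni 0$ be the pull-back of $V^{n}$ corresponding to the first return of $0$. The nest may be finite or infinite. For $n\ge1$ such that $V^{n-1}$ exists, let $g_n:\bigcup_i V^n_i\to V^{n-1}$ be the first return map to $V^{n-1}$, where $V^n_i$ are its pieces. **Corollary 3.6.** (1) For every $n\ge1$ such that $V^{n-1}$ exists, the (closed) pieces $V^n_i$ are pairwise disjoint, and all annuli $V^{n-1}\setminus V^n_i$ are non-degenerate; that is, $V^n_i\subset\operatorname{int}V^{n-1}$, and $\operatorname{int}V^{n-1}\setminus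 V^n_i$ is a doubly connected region. (2) Assume moreover that $f$ is normalized so that $f=H\circ\Phi$ on $U'$, where $\Phi(z)=z^2$ and $H:\Phi(U')\to U$ is univalent and onto. Then for every $n\ge2$ such that $V^{n-1}$ exists and for every piece $V^n_i$, there are a region $\Omega_{n,i}\supset\Phi(V^n_i)$ and a univalent map $h_{n,i}$ of $\Omega_{n,i}$ onto $\operatorname{int}V^{n-2}$ such that $g_n=h_{n,i}\circ\Phi$ on $V^n_i$. -/

import Mathlib

open Set Filter Topology

noncomputable section

/-! ### Regions of the plane -/

/-- A topological disk: a simply connected region of the plane. -/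
def IsTopologicalDisk (U : Set ℂ) : Prop :=
  IsOpen U ∧ IsSimplyConnected U

/-- A doubly connected region: an open connected subset of the plane whose complement in the
Riemann sphere has exactly two connected components `K₀`, `K₁`. -/
def IsDoublyConnected (A : Set ℂ) : Prop :=
  IsOpen A ∧ IsConnected A ∧ ∃ K₀ K₁ : Set (OnePoint ℂ),
    IsClosed K₀ ∧ IsClosed K₁ ∧ IsConnected K₀ ∧ IsConnected K₁ ∧ Disjoint K₀ K₁ ∧
      K₀ ∪ K₁ = (((↑) : ℂ → OnePoint ℂ) '' A)ᶜ

/-- The annulus `V ∖ P` between two (closed) pieces is non-degenerate: `P` is strictly contained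
in `V`, and the region between `P` and the boundary of `V` is doubly connected. -/
def IsNondegenerateAnnulus (V P : Set ℂ) : Prop :=
  closure P ⊆ interior V ∧ IsDoublyConnected (interior V \ P)

/-- `h` is a univalent (holomorphic and injective) map of the region `Ω` with range `W`. -/
def IsUnivalentOnto (h : ℂ → ℂ) (Ω W : Set ℂ) : Prop :=
  IsOpen Ω ∧ IsConnected Ω ∧ DifferentiableOn ℂ h Ω ∧ InjOn h Ω ∧ h '' Ω = W

/-! ### Quadratic polynomials: filled Julia set, Böttcher function, rays, equipotentials -/

/-- The filled Julia set of `z ↦ z² + c`: the points that do not escape to infinity. -/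
def quadFilledJulia (c : ℂ) : Set ℂ :=
  {z | ¬ Tendsto (fun n : ℕ => (fun w : ℂ => w ^ 2 + c)^[n] z) atTop (Bornology.cobounded ℂ)}

/-- `B` is the Böttcher function of `z ↦ z² + c` (connected Julia set): the conformal map of the
whole basin of infinity onto `{|w| > 1}`, tangent to the identity at infinity, that conjugates the
polynomial to `w ↦ w²`. These properties determine `B` on the basin. -/
structure IsBoettcher (c : ℂ) (B : ℂ → ℂ) : Prop where
  differentiableOn : DifferentiableOn ℂ B (quadFilledJulia c)ᶜ
  bijOn : BijOn B (quadFilledJulia c)ᶜ {w | 1 < ‖w‖}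
  map_sq : ∀ z ∉ quadFilledJulia c, B (z ^ 2 + c) = B z ^ 2
  tangent : Tendsto (fun z => B z / z) (Bornology.cobounded ℂ) (𝓝 1)

/-- The point `r e^{2πiθ}`. -/
def polarPoint (r θ : ℝ) : ℂ := (r : ℂ) * Complex.exp (2 * Real.pi * θ * Complex.I)

/-- The external ray of angle `θ` (in turns) of `z ↦ z² + c`. -/
def externalRay (c : ℂ) (θ : ℝ) : Set ℂ :=
  {z | z ∉ quadFilledJulia c ∧ ∃ B, IsBoettcher c B ∧ ∃ r : ℝ, 1 < r ∧ B z = polarPoint r θ}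

/-- The external ray of angle `θ` lands at `a`: its point of potential `log r` tends to `a` as
`r` decreases to `1`. -/
def RayLandsAt (c : ℂ) (θ : ℝ) (a : ℂ) : Prop :=
  ∃ B, IsBoettcher c B ∧ ∃ γ : ℝ → ℂ,
    (∀ r, 1 < r → γ r ∉ quadFilledJulia c ∧ B (γ r) = polarPoint r θ) ∧
      Tendsto γ (𝓝[>] 1) (𝓝 a)

/-- The angles, in `[0, 1)`, of the external rays landing at `a`. -/
def landingAngles (c a : ℂ) : Set ℝ := {θ | θ ∈ Ico (0 : ℝ) 1 ∧ RayLandsAt c θ a}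

/-- The open domain bounded by the equipotential `{|B| = r}`. -/
def equipotentialDisk (c : ℂ) (r : ℝ) : Set ℂ :=
  quadFilledJulia c ∪ {z | z ∉ quadFilledJulia c ∧ ∃ B, IsBoettcher c B ∧ ‖B z‖ < r}

/-! ### Quadratic-like maps -/

/-- A quadratic-like map `f : U' → U`: a holomorphic double branched covering between topological
disks `U' ⋐ U`, with critical point `0`. Only the values of `f` on `U'` matter. -/
structure QuadraticLike where
  /-- the map -/
  f : ℂ → ℂ
  /-- the domain -/
  U' : Set ℂ
  /-- the range -/
  U : Set ℂ
  disk_dom : IsTopologicalDisk U'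
  disk_range : IsTopologicalDisk U
  isCompact_closure : IsCompact (closure U')
  closure_subset : closure U' ⊆ U
  differentiableOn : DifferentiableOn ℂ f U'
  mapsTo : MapsTo f U' U
  proper : ∀ K ⊆ U, IsCompact K → IsCompact (U' ∩ f ⁻¹' K)
  zero_mem : (0 : ℂ) ∈ U'
  fiber_critical : {z | z ∈ U' ∧ f z = f 0} = {0}
  fiber_regular : ∀ w ∈ U, w ≠ f 0 → {z | z ∈ U' ∧ f z = w}.ncard = 2

namespace QuadraticLike

/-- The filled Julia set: the points that never leave `U'`. -/
def filledJulia (F : QuadraticLike) : Set ℂ := {z | ∀ n : ℕ, F.f^[n] z ∈ F.U'}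

/-- `f = H ∘ Φ` on `U'`, where `Φ(z) = z²` and `H` is univalent with range `U`. -/
def IsSquareNormalized (F : QuadraticLike) : Prop :=
  ∃ H : ℂ → ℂ, IsUnivalentOnto H ((fun z : ℂ => z ^ 2) '' F.U') F.U ∧
    ∀ z ∈ F.U', F.f z = H (z ^ 2)

/-- The pull-back of `W` along `z, f z, …, f^l z`: taken step by step, it is the closure of the
component containing the orbit point of the preimage of the interior of the preceding set. -/
def pullback (F : QuadraticLike) (W : Set ℂ) : ℕ → ℂ → Set ℂ
  | 0, _ => W
  | l + 1, z => closure
      (connectedComponentIn (F.U' ∩ F.f ⁻¹' interior (F.pullback W l (F.f z))) z)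

/-- `l > 0` is the first return time of the point `z ∈ int W` to `int W`. -/
def IsFirstReturn (F : QuadraticLike) (W : Set ℂ) (z : ℂ) (l : ℕ) : Prop :=
  z ∈ interior W ∧ 0 < l ∧ (∀ k < l, F.f^[k] z ∈ F.U') ∧ F.f^[l] z ∈ interior W ∧
    ∀ k, 0 < k → k < l → F.f^[k] z ∉ interior W

/-- `P` is one of the pieces on which the first return map to `W` is defined, and on `P` this map
is `f^l`: `P` is the pull-back of `W` corresponding to the first return of some point. -/
def IsReturnPiece (F : QuadraticLike) (W P : Set ℂ) (l : ℕ) : Prop :=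
  ∃ z, F.IsFirstReturn W z l ∧ P = F.pullback W l z

/-- The pieces on which the first return map to `W` is defined. -/
def returnPieces (F : QuadraticLike) (W : Set ℂ) : Set (Set ℂ) :=
  {P | ∃ l, F.IsReturnPiece W P l}

/-- The choices through which external rays and equipotentials of a quadratic-like map are
defined: a conjugacy `chart` of `f`, near its filled Julia set, to a polynomial `z ↦ z² + c` near
its filled Julia set, and an equipotential `E` so close to the filled Julia set that both `E`
and `f E` are closed curves in the domain of the conjugacy. -/
structure ExternalStructure (F : QuadraticLike) where
  /-- the parameter of the quadratic polynomial -/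
  c : ℂ
  /-- the conjugating homeomorphism -/
  chart : OpenPartialHomeomorph ℂ ℂ
  subset_source : F.filledJulia ⊆ chart.source
  subset_target : quadFilledJulia c ⊆ chart.target
  image_filledJulia : chart '' F.filledJulia = quadFilledJulia c
  conj : ∀ z ∈ F.U', z ∈ chart.source → F.f z ∈ chart.source →
    chart (F.f z) = chart z ^ 2 + c
  /-- `E` corresponds to `{|B| = level}` -/
  level : ℝ
  one_lt_level : 1 < level
  closure_subset_target : closure (equipotentialDisk c (level ^ 2)) ⊆ chart.target
  mem_dom : ∀ w ∈ closure (equipotentialDisk c level),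
    chart.symm w ∈ F.U' ∧ F.f (chart.symm w) ∈ chart.source

namespace ExternalStructure

variable {F : QuadraticLike}

/-- The domain bounded by the equipotential `E`. -/
def disk (X : F.ExternalStructure) : Set ℂ := X.chart.symm '' equipotentialDisk X.c X.level

/-- The angles of the external rays of `f` that land at `a`. -/
def angles (X : F.ExternalStructure) (a : ℂ) : Set ℝ := landingAngles X.c (X.chart a)

/-- The point `a` together with the parts inside `E` of the external rays landing at it. -/
def rays (X : F.ExternalStructure) (a : ℂ) : Set ℂ :=
  insert a (X.chart.symm ''
    (equipotentialDisk X.c X.level ∩ ⋃ θ ∈ X.angles a, externalRay X.c θ))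

/-- `α` is the dividing fixed point: at least two external rays land at it. -/
def IsDividingFixedPoint (X : F.ExternalStructure) (α : ℂ) : Prop :=
  α ∈ F.U' ∧ F.f α = α ∧ (X.angles α).Nontrivial

/-- The Yoccoz puzzle pieces of each depth. The (closed) pieces of depth `0` are cut out of the
domain bounded by `E` by the rays landing at `α`; the pieces of depth `n + 1` are the components
of the preimages of the pieces of depth `n`. -/
def puzzlePieces (X : F.ExternalStructure) (α : ℂ) : ℕ → Set (Set ℂ)
  | 0 => {Y | ∃ z ∈ X.disk \ X.rays α, Y = closure (connectedComponentIn (X.disk \ X.rays α) z)}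
  | n + 1 => {Y | ∃ Y₀ ∈ X.puzzlePieces α n, ∃ z ∈ F.U' ∩ F.f ⁻¹' interior Y₀,
      Y = closure (connectedComponentIn (F.U' ∩ F.f ⁻¹' interior Y₀) z)}

/-- The non-critical pieces `Z_i` of depth `1` attached to the other preimage `α'` of `α`. -/
def zPieces (X : F.ExternalStructure) (α : ℂ) : Set (Set ℂ) :=
  {Z | Z ∈ X.puzzlePieces α 1 ∧ (0 : ℂ) ∉ Z ∧
    ∃ α' ∈ F.U', F.f α' = α ∧ α' ≠ α ∧ α' ∈ Z}

/-- The number `p` of external rays landing at `α`. -/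
def rayNumber (X : F.ExternalStructure) (α : ℂ) : ℕ := (X.angles α).ncard

/-- `t` is the first positive moment at which `f^{tp} 0` is in one of the pieces `Z_i`. -/
def IsEscapeTime (X : F.ExternalStructure) (α : ℂ) (t : ℕ) : Prop :=
  IsLeast {t : ℕ | 0 < t ∧ ∃ Z ∈ X.zPieces α, F.f^[t * X.rayNumber α] 0 ∈ interior Z} t

/-- `X.IsNestPiece α n V` says that the principal nest reaches level `n` and that `V` is its piece
`V^n`. The piece `V^0` is the pull-back, along the orbit of `0`, of the piece `Z_i` through which
`0` escapes, and `V^{n+1}` is the pull-back of `V^n` corresponding to the first return of `0`. -/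
inductive IsNestPiece (X : F.ExternalStructure) (α : ℂ) : ℕ → Set ℂ → Prop
  | zero (t : ℕ) (Z : Set ℂ) (ht : X.IsEscapeTime α t) (hZ : Z ∈ X.zPieces α)
      (h0 : F.f^[t * X.rayNumber α] 0 ∈ interior Z) :
      IsNestPiece X α 0 (F.pullback Z (t * X.rayNumber α) 0)
  | succ (n : ℕ) (V : Set ℂ) (l : ℕ) (hV : IsNestPiece X α n V) (hl : F.IsFirstReturn V 0 l) :
      IsNestPiece X α (n + 1) (F.pullback V l 0)

end ExternalStructure

end QuadraticLike

end

/-! Call a piece `V` nice (`NoReturn`) if the orbit of a boundary point never comes back to `V`. A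
pull-back of a nice `V` is connected and cannot cross the boundary of `V`, so it lies in `interior
V` as soon as it meets `V`. This gives the inclusions of part (1), makes the return time constant on
each closed return piece, and reduces disjointness to pull-backs of equal length. These are handled
one step at a time. For a full compact `W`, either the critical value is in `interior W` and the
preimage of `interior W` has one component, or it is outside `W` and the double covering splits over
`W` into two disjoint closed sheets (`exists_split`). Hence distinct components have disjoint
closures, and fullness passes to pull-backs (`closedFull_component`). Removing a full connected
compact set from a full bounded region leaves a doubly connected region (`isDoublyConnected_diff`).
Continuous logarithms of `z - a` play the role of winding numbers throughout.

For part (2), let `V`, `W` be consecutive nest pieces and let `z` return to `W` at time `m + 1`.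
Pull `V` back along the orbit from `f z` to `f^(m+1) z`. If an intermediate pull-back contained `0`,
it would lie inside the first-return pull-back of `V` at `0`, which is `W`, and `z` would have
visited `W` too early. So `f^m` is univalent from this pull-back onto `interior V`, and `Ω` is the
preimage of the pull-back under `H`, where `f = H ∘ Φ`.

Niceness passes from `Z_i` to `V^0` and along the nest, so it remains to treat `Z_i`. Boundary
points of `Z_i` map to the boundary of a piece of depth zero, that is, to `E` or to the rays landing
at `α`. Points on `E` never re-enter the domain bounded by `E`, and the rays are forward invariant.
Finally `Z_i` misses these rays: it lies in the sheet of `α'`, which excludes `α`, while a point of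
a ray would bring `α` into the same sheet. The critical orbit avoids all boundaries because it stays
in the filled Julia set, where the rays contribute only `α`. -/

/-! ### Plane topology -/

/-- A preconnected set that meets `t` but not its boundary lies in the interior of `t`. -/
theorem IsPreconnected.subset_interior_of_disjoint_frontier {X : Type*} [TopologicalSpace X]
    {s t : Set X} (hs : IsPreconnected s) (hst : (s ∩ t).Nonempty)
    (hd : ∀ x ∈ s, x ∉ frontier t) : s ⊆ interior t := by
  have key : ∀ x ∈ s, x ∈ closure t → x ∈ interior t := fun x hx hc => by
    by_contra h
    exact hd x hx ⟨hc, h⟩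
  obtain ⟨x, hx, hxt⟩ := hst
  exact hs.subset_of_closure_inter_subset isOpen_interior ⟨x, hx, key x hx (subset_closure hxt)⟩
    fun y hy => key y hy.2 (closure_mono interior_subset hy.1)

/-- In a connected non-compact space a compact open set is empty. -/
theorem eq_empty_of_isCompact_of_isOpen {K : Set ℂ} (hK : IsCompact K) (hO : IsOpen K) :
    K = ∅ := by
  rcases isClopen_iff.1 (⟨hK.isClosed, hO⟩ : IsClopen K) with h | h
  · exact h
  · exact absurd (h ▸ hK) (noncompact_univ ℂ)

/-! ### Continuous logarithms in place of winding numbers. -/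

/-- `g` has a continuous logarithm on `S`. -/
def HasLog (g : ℂ → ℂ) (S : Set ℂ) : Prop :=
  ∃ L : ℂ → ℂ, ContinuousOn L S ∧ ∀ z ∈ S, Complex.exp (L z) = g z

namespace HasLog

theorem mul {g h : ℂ → ℂ} {S : Set ℂ} (hg : HasLog g S) (hh : HasLog h S) :
    HasLog (fun z => g z * h z) S := by
  obtain ⟨L, hL, hL'⟩ := hg
  obtain ⟨M, hM, hM'⟩ := hh
  exact ⟨fun z => L z + M z, hL.add hM, fun z hz => by rw [Complex.exp_add, hL' z hz, hM' z hz]⟩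

theorem inv {g : ℂ → ℂ} {S : Set ℂ} (hg : HasLog g S) : HasLog (fun z => (g z)⁻¹) S := by
  obtain ⟨L, hL, hL'⟩ := hg
  exact ⟨fun z => -L z, hL.neg, fun z hz => by rw [Complex.exp_neg, hL' z hz]⟩

theorem congr {g h : ℂ → ℂ} {S : Set ℂ} (hg : HasLog g S) (e : ∀ z ∈ S, g z = h z) :
    HasLog h S := by
  obtain ⟨L, hL, hL'⟩ := hg
  exact ⟨L, hL, fun z hz => by rw [hL' z hz, e z hz]⟩

/-- The quotient `(z - b) / (z - a)` has a logarithm on sets that are far away from `a`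
compared with the distance from `a` to `b`. -/
theorem of_close {a b : ℂ} {S : Set ℂ} (h : ∀ z ∈ S, ‖b - a‖ < ‖z - a‖) :
    HasLog (fun z => (z - b) * (z - a)⁻¹) S := by
  have hne : ∀ z ∈ S, z - a ≠ 0 := fun z hz h0 => by
    have := h z hz
    rw [h0, norm_zero] at this
    exact absurd this (not_lt.2 (norm_nonneg _))
  -- The quotient is within distance less than 1 of 1, so the principal logarithm is continuous
  -- there.
  have hmem : ∀ z ∈ S, (z - b) * (z - a)⁻¹ ∈ Complex.slitPlane := fun z hz => by
    have e : (z - b) * (z - a)⁻¹ = 1 + (a - b) * (z - a)⁻¹ := by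
      have := hne z hz
      field_simp
      ring
    rw [e]
    apply Complex.mem_slitPlane_of_norm_lt_one
    rw [norm_mul, norm_inv, ← div_eq_mul_inv, div_lt_one (norm_pos_iff.2 (hne z hz)), norm_sub_rev]
    exact h z hz
  refine ⟨fun z => Complex.log ((z - b) * (z - a)⁻¹), ?_, fun z hz =>
    Complex.exp_log (Complex.slitPlane_ne_zero (hmem z hz))⟩
  refine ContinuousOn.clog ?_ hmem
  exact (continuousOn_id.sub continuousOn_const).mul
    ((continuousOn_id.sub continuousOn_const).inv₀ hne)

end HasLog

theorem isSimplyConnected_univ_complex : IsSimplyConnected (univ : Set ℂ) :=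
  haveI : ContractibleSpace (univ : Set ℂ) := convex_univ.contractibleSpace univ_nonempty
  (inferInstance : SimplyConnectedSpace (univ : Set ℂ))

/-- The identity of a circle does not extend to a zero-free function on the disk: a zero-free
continuous function on the closure of a bounded open set `A ∋ a` cannot agree with `z - a` on the
boundary. -/
theorem no_zero_free_extension {A : Set ℂ} {a : ℂ} (hA : IsOpen A) (hb : Bornology.IsBounded A)
    (ha : a ∈ A) {ψ : ℂ → ℂ} (hψ : ContinuousOn ψ (closure A)) (h0 : ∀ z ∈ closure A, ψ z ≠ 0)
    (hf : ∀ z ∈ frontier A, ψ z = z - a) : False := by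
  classical
  -- The glued function is continuous and zero-free on the whole plane, hence has a global logarithm
  -- `ℓ`, yet it equals `z - a` outside `A`.
  set φ : ℂ → ℂ := fun z => if z ∈ A then ψ z else z - a with hφ
  have e1 : EqOn φ ψ (closure A) := fun z hz => by
    by_cases h : z ∈ A
    · simp [hφ, h]
    · have : z ∈ frontier A := by rw [hA.frontier_eq]; exact ⟨hz, h⟩
      simp [hφ, h, hf z this]
  have e2 : EqOn φ (fun z => z - a) Aᶜ := fun z hz => by
    have : z ∉ A := hz
    simp [hφ, this]
  have hc : ContinuousOn φ univ := by
    have := ContinuousOn.union_of_isClosed (hψ.congr e1)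
      (((continuous_id.sub continuous_const).continuousOn (s := Aᶜ)).congr e2)
      isClosed_closure hA.isClosed_compl
    refine this.mono fun z _ => ?_
    by_cases h : z ∈ A
    · exact Or.inl (subset_closure h)
    · exact Or.inr h
  have hne : (0 : ℂ) ∉ φ '' univ := by
    rintro ⟨z, -, hz⟩
    by_cases h : z ∈ A
    · exact h0 z (subset_closure h) (by rw [← e1 (subset_closure h), hz])
    · rw [e2 h] at hz
      exact h ((sub_eq_zero.1 hz) ▸ ha)
  obtain ⟨ℓ, hℓ, hℓφ⟩ := Complex.exists_continuousOn_eqOn_exp_comp isSimplyConnected_univ_complex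
    isOpen_univ hc hne
  obtain ⟨R, hR⟩ := hb.subset_ball a
  have hℓ' : Continuous ℓ := continuousOn_univ.1 hℓ
  have hRpos : 0 < R := by
    have := hR ha
    simpa using this
  -- On a circle around `A`, subtract the angle from `ℓ`. The exponential of the difference is the
  -- constant `R`, so the difference is constant; but `ℓ` has the same value at both ends of the
  -- turn while the angle has grown by `2π`.
  set g : ℝ → ℂ := fun t => ℓ (a + R * Complex.exp (t * Complex.I)) - t * Complex.I with hg
  have hgc : Continuous g := by fun_prop
  have hge : ∀ t, Complex.exp (g t) = R := fun t => by
    have hn : a + R * Complex.exp (t * Complex.I) ∉ A := fun h => by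
      have := hR h
      simp [Complex.norm_exp_ofReal_mul_I, abs_of_pos hRpos] at this
    have h1 := hℓφ (mem_univ (a + R * Complex.exp (t * Complex.I)))
    rw [Function.comp_apply, e2 hn] at h1
    rw [hg, Complex.exp_sub, h1]
    have := Complex.exp_ne_zero (t * Complex.I)
    field_simp
    ring
  have hconst := IsSeparatedMap.const_of_comp (T2Space.isSeparatedMap _)
    Complex.isCoveringMap_exp.isLocalHomeomorph.isLocallyInjective hgc
    (fun t t' => Subtype.ext (by simp only [hge])) 0 (2 * Real.pi)
  simp only [hg] at hconst
  have e3 : Complex.exp (((2 * Real.pi : ℝ) : ℂ) * Complex.I) = 1 := by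
    push_cast; exact Complex.exp_two_pi_mul_I
  rw [e3] at hconst
  simp only [Complex.ofReal_zero, zero_mul, Complex.exp_zero, sub_zero] at hconst
  have h2 := sub_eq_self.1 hconst.symm
  exact Complex.two_pi_I_ne_zero (by push_cast at h2; exact h2)

/-! ### Full sets and their complements. -/

/-- A set is full if no bounded open set outside of it has its boundary in it, that is, if its
complement has no bounded component. -/
def ClosedFull (W : Set ℂ) : Prop :=
  ∀ Q : Set ℂ, IsOpen Q → Bornology.IsBounded Q → Disjoint Q W → frontier Q ⊆ W → Q = ∅

/-- An open set is full if its complement has no compact part. -/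
def OpenFull (G : Set ℂ) : Prop :=
  ∀ K : Set ℂ, IsCompact K → Disjoint K G → IsOpen (G ∪ K) → K = ∅

/-- On a full compact set, `z - v` has a logarithm for every `v` outside. -/
theorem ClosedFull.hasLog {W : Set ℂ} (hW : ClosedFull W) (hc : IsCompact W) {v : ℂ}
    (hv : v ∉ W) : HasLog (fun z => z - v) W := by
  by_contra hlog
  -- nearby points are equivalent
  have step : ∀ u ∉ W, ∃ ε > 0, ∀ u', ‖u' - u‖ < ε → u' ∉ W ∧
      (HasLog (fun z => z - u) W ↔ HasLog (fun z => z - u') W) := by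
    intro u hu
    obtain ⟨δ, hδ, hball⟩ := Metric.isOpen_iff.1 hc.isClosed.isOpen_compl u hu
    have far : ∀ z ∈ W, δ ≤ ‖z - u‖ := fun z hz => by
      by_contra h
      exact hball (by simpa [dist_eq_norm] using lt_of_not_ge h) hz
    refine ⟨δ / 2, by positivity, fun u' hu' => ?_⟩
    have far' : ∀ z ∈ W, δ / 2 ≤ ‖z - u'‖ := fun z hz => by
      have h1 := far z hz
      have h2 : ‖z - u‖ ≤ ‖z - u'‖ + ‖u' - u‖ := by
        have := norm_add_le (z - u') (u' - u)
        simpa using this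
      linarith
    have hne : ∀ z ∈ W, z - u ≠ 0 := fun z hz h0 => by
      have := far z hz
      rw [h0, norm_zero] at this; linarith
    have hne' : ∀ z ∈ W, z - u' ≠ 0 := fun z hz h0 => by
      have := far' z hz
      rw [h0, norm_zero] at this; linarith
    refine ⟨fun h => by simpa using hne' u' h, fun h => ?_, fun h => ?_⟩
    · have := h.mul (HasLog.of_close (a := u) (b := u') (S := W) fun z hz => by
        have := far z hz; linarith)
      refine this.congr fun z hz => ?_
      have := hne z hz
      field_simp
    · have := h.mul (HasLog.of_close (a := u') (b := u) (S := W) fun z hz => by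
        have := far' z hz
        rw [norm_sub_rev]; linarith)
      refine this.congr fun z hz => ?_
      have := hne' z hz
      field_simp
  -- The exceptional points form an open set with boundary in `W`, by local constancy, and a bounded
  -- one, by the estimate at infinity; fullness makes it empty.
  set Q : Set ℂ := {u | u ∉ W ∧ ¬ HasLog (fun z => z - u) W} with hQ
  have hQo : IsOpen Q := by
    rw [Metric.isOpen_iff]
    rintro u ⟨hu, hu'⟩
    obtain ⟨ε, hε, h⟩ := step u hu
    refine ⟨ε, hε, fun u' hu'' => ?_⟩
    have := h u' (by simpa [dist_eq_norm] using hu'')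
    exact ⟨this.1, fun h' => hu' (this.2.2 h')⟩
  have hQb : Bornology.IsBounded Q := by
    obtain ⟨R, hR⟩ := hc.isBounded.subset_closedBall 0
    refine (Metric.isBounded_closedBall (x := (0 : ℂ)) (r := R)).subset ?_
    rintro u ⟨hu, hu'⟩
    by_contra hn
    have hn' : R < ‖u‖ := by simpa using hn
    -- When `W` is empty the radius `R` may be negative, and then `R < ‖u‖` does not exclude `u =
    -- 0`.
    have hu0 : u ≠ 0 ∨ W = ∅ := by
      rcases W.eq_empty_or_nonempty with h | ⟨z, hz⟩
      · exact Or.inr h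
      · left
        intro h
        have := hR hz
        simp only [mem_closedBall_zero_iff] at this
        rw [h, norm_zero] at hn'
        linarith [norm_nonneg z]
    rcases hu0 with hu0 | hW0
    · apply hu'
      -- Far from `W` one writes `z - u = -u (1 - z/u)` with `|z/u| < 1`.
      have h1 : HasLog (fun z => -u) W := ⟨fun _ => Complex.log (-u), continuousOn_const,
        fun z _ => Complex.exp_log (neg_ne_zero.2 hu0)⟩
      have hmem : ∀ z ∈ W, 1 + -(z / u) ∈ Complex.slitPlane := fun z hz => by
        apply Complex.mem_slitPlane_of_norm_lt_one
        have := hR hz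
        simp only [mem_closedBall_zero_iff] at this
        rw [norm_neg, norm_div, div_lt_one (norm_pos_iff.2 hu0)]
        linarith
      have h2 : HasLog (fun z => 1 + -(z / u)) W := by
        refine ⟨fun z => Complex.log (1 + -(z / u)), ?_, fun z hz =>
          Complex.exp_log (Complex.slitPlane_ne_zero (hmem z hz))⟩
        refine ContinuousOn.clog ?_ hmem
        fun_prop
      refine (h1.mul h2).congr fun z _ => ?_
      field_simp
      ring
    · apply hu'
      exact ⟨fun _ => 0, continuousOn_const, fun z hz => by simp [hW0] at hz⟩
  have hQf : frontier Q ⊆ W := by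
    intro u hu
    by_contra huW
    obtain ⟨ε, hε, h⟩ := step u huW
    rw [hQo.frontier_eq] at hu
    obtain ⟨u', hu'Q, hd⟩ := Metric.mem_closure_iff.1 hu.1 ε hε
    have := h u' (by rw [← dist_eq_norm, dist_comm]; exact hd)
    exact hu.2 ⟨huW, fun h' => hu'Q.2 (this.2.1 h')⟩
  have := hW Q hQo hQb (disjoint_left.2 fun u hu => hu.1) hQf
  have hvQ : v ∈ Q := ⟨hv, hlog⟩
  rw [this] at hvQ
  exact hvQ

/-- Two points of a connected open set cannot be told apart by winding numbers around a closed
set outside. -/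
theorem hasLog_ratio {O S : Set ℂ} (hO : IsPreconnected O) (hS : IsClosed S)
    (hd : Disjoint O S) {a b : ℂ} (ha : a ∈ O) (hb : b ∈ O) :
    HasLog (fun z => (z - a) * (z - b)⁻¹) S := by
  have near : ∀ u ∈ O, ∃ ε > 0, ∀ u', ‖u' - u‖ < ε →
      HasLog (fun z => (z - u') * (z - u)⁻¹) S := by
    intro u hu
    obtain ⟨δ, hδ, hball⟩ := Metric.isOpen_iff.1 hS.isOpen_compl u (disjoint_left.1 hd hu)
    refine ⟨δ, hδ, fun u' hu' => HasLog.of_close fun z hz => hu'.trans_le ?_⟩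
    by_contra h
    exact hball (by simpa [dist_eq_norm] using lt_of_not_ge h) hz
  have hne : ∀ u ∈ O, ∀ z ∈ S, z - u ≠ 0 := fun u hu z hz h =>
    disjoint_left.1 hd hu (by rwa [sub_eq_zero.1 h] at hz)
  have comp : ∀ u ∈ O, ∀ v ∈ O, ∀ w ∈ O, HasLog (fun z => (z - u) * (z - v)⁻¹) S →
      HasLog (fun z => (z - v) * (z - w)⁻¹) S → HasLog (fun z => (z - u) * (z - w)⁻¹) S := by
    intro u hu v hv w hw h1 h2
    refine (h1.mul h2).congr fun z hz => ?_
    have := hne v hv z hz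
    have := hne w hw z hz
    field_simp
  have symm' : ∀ u ∈ O, ∀ v ∈ O, HasLog (fun z => (z - u) * (z - v)⁻¹) S →
      HasLog (fun z => (z - v) * (z - u)⁻¹) S := by
    intro u hu v hv h
    refine h.inv.congr fun z hz => ?_
    have := hne v hv z hz
    have := hne u hu z hz
    field_simp
  -- The relation is transitive and holds in both directions between nearby points, so it holds
  -- throughout a preconnected set.
  refine hO.induction₂' (fun u v => HasLog (fun z => (z - u) * (z - v)⁻¹) S) ?_ ?_ ha hb
  · intro u hu
    obtain ⟨ε, hε, h⟩ := near u hu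
    filter_upwards [mem_nhdsWithin_of_mem_nhds (Metric.ball_mem_nhds u hε), self_mem_nhdsWithin]
      with v hv hvO
    have := h v (by simpa [dist_eq_norm] using hv)
    exact ⟨symm' v hvO u hu this, this⟩
  · intro u v w hu hv hw h1 h2
    exact comp u hu v hv w hw h1 h2

/-- Tietze extension. It is applied to logarithms given on a boundary: the exponential of the
extension stays zero-free inside, as `no_zero_free_extension` requires. -/
theorem exists_extension_of_continuousOn {L : ℂ → ℂ} {C : Set ℂ} (hC : IsClosed C)
    (hL : ContinuousOn L C) : ∃ M : ℂ → ℂ, Continuous M ∧ EqOn M L C := by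
  obtain ⟨M, hM⟩ := ContinuousMap.exists_restrict_eq hC ⟨_, continuousOn_iff_continuous_domRestrict.1 hL⟩
  refine ⟨M, M.continuous, fun z hz => ?_⟩
  have := DFunLike.congr_fun hM ⟨z, hz⟩
  exact this

theorem HasLog.union {g : ℂ → ℂ} {S T : Set ℂ} (hS : IsClosed S) (hT : IsClosed T)
    (hd : Disjoint S T) (h1 : HasLog g S) (h2 : HasLog g T) : HasLog g (S ∪ T) := by
  classical
  obtain ⟨L, hL, hL'⟩ := h1
  obtain ⟨M, hM, hM'⟩ := h2
  have e1 : EqOn (fun z => if z ∈ S then L z else M z) L S := fun z hz => by simp [hz]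
  have e2 : EqOn (fun z => if z ∈ S then L z else M z) M T := fun z hz => by
    simp [disjoint_right.1 hd hz]
  refine ⟨fun z => if z ∈ S then L z else M z,
    (hL.congr e1).union_of_isClosed (hM.congr e2) hS hT, ?_⟩
  rintro z (hz | hz)
  · rw [e1 hz, hL' z hz]
  · rw [e2 hz, hM' z hz]

/-- Removing a full compact set from a bounded connected open set leaves a connected set. -/
theorem ClosedFull.isPreconnected_diff {O P : Set ℂ} (hO : IsOpen O)
    (hOb : Bornology.IsBounded O) (hOc : IsPreconnected O) (hP : IsCompact P)
    (hPf : ClosedFull P) (hPO : P ⊆ O) : IsPreconnected (O \ P) := by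
  have hOP : IsOpen (O \ P) := hO.sdiff hP.isClosed
  rw [isPreconnected_iff_subset_of_disjoint]
  intro A' B' hA' hB' hcov hdisj
  by_contra hcon
  rw [not_or, not_subset, not_subset] at hcon
  obtain ⟨⟨b, hb, hbA⟩, ⟨a, ha, haB⟩⟩ := hcon
  set A := (O \ P) ∩ A'
  have hA : IsOpen A := hOP.inter hA'
  have haA : a ∈ A := ⟨ha, (hcov ha).resolve_right haB⟩
  have hbB : b ∈ B' := (hcov hb).resolve_left hbA
  have hAb : Bornology.IsBounded A := hOb.subset fun z hz => hz.1.1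
  have hbcl : b ∉ closure A := fun h => by
    obtain ⟨z, hz1, hz2⟩ := mem_closure_iff.1 h (B' ∩ (O \ P)) (hB'.inter hOP) ⟨hbB, hb⟩
    have : z ∈ (O \ P) ∩ (A' ∩ B') := ⟨hz1.2, hz2.2, hz1.1⟩
    rw [hdisj] at this; exact this
  -- `A` is one side of a supposed separation, so inside `O` it can only be bounded by `P`.
  have hfr : frontier A ⊆ P ∪ frontier O := by
    intro z hz
    rw [hA.frontier_eq] at hz
    by_contra hn
    rw [mem_union, not_or] at hn
    have hzO : z ∈ O := by
      by_contra h
      refine hn.2 ?_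
      rw [hO.frontier_eq]
      exact ⟨closure_mono (fun w hw => hw.1.1) hz.1, h⟩
    rcases hcov ⟨hzO, hn.1⟩ with h | h
    · exact hz.2 ⟨⟨hzO, hn.1⟩, h⟩
    · obtain ⟨w, hw1, hw2⟩ := mem_closure_iff.1 hz.1 B' hB' h
      have : w ∈ (O \ P) ∩ (A' ∩ B') := ⟨hw2.1, hw2.2, hw1⟩
      rw [hdisj] at this; exact this
  have hdis : Disjoint O (frontier O) := by
    rw [hO.frontier_eq]; exact disjoint_sdiff_right
  -- On `P` both factors have logarithms by fullness; on the boundary of `O` only the ratio needs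
  -- one, and there `a` and `b` are joined inside `O`.
  have hlog : HasLog (fun z => (z - a) * (z - b)⁻¹) (P ∪ frontier O) := by
    refine HasLog.union hP.isClosed isClosed_frontier (hdis.mono_left hPO) ?_ ?_
    · exact (hPf.hasLog hP ha.2).mul (hPf.hasLog hP hb.2).inv
    · exact hasLog_ratio hOc isClosed_frontier hdis ha.1 hb.1
  obtain ⟨L, hL, hL'⟩ := hlog
  obtain ⟨M, hM, hML⟩ := exists_extension_of_continuousOn (hP.isClosed.union isClosed_frontier) hL
  -- Since `b` lies outside the closure of `A`, the extended ratio times `z - b` has no zero on that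
  -- closure, although it equals `z - a` on the boundary.
  refine no_zero_free_extension hA hAb haA (ψ := fun z => Complex.exp (M z) * (z - b))
    (Continuous.continuousOn (by fun_prop)) (fun z hz => ?_) fun z hz => ?_
  · refine mul_ne_zero (Complex.exp_ne_zero _) fun h => hbcl ?_
    rwa [sub_eq_zero.1 h] at hz
  · have hzb : z - b ≠ 0 := fun h => hbcl (by
      rw [← sub_eq_zero.1 h]; exact frontier_subset_closure hz)
    rw [hML (hfr hz), hL' z (hfr hz)]
    field_simp

/-- The interior of a full closed set is full. -/
theorem ClosedFull.openFull_interior {W : Set ℂ} (hW : ClosedFull W) (hc : IsClosed W) :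
    OpenFull (interior W) := by
  intro K hK hd ho
  -- The part of `K` outside `W` is open with boundary in `W`, so it is empty. Then `interior W ∪ K`
  -- is an open subset of `W`, and `K` falls into the interior it was disjoint from.
  have hQo : IsOpen (K \ W) := by
    have : K \ W = (interior W ∪ K) \ W := by
      ext z
      constructor
      · rintro ⟨h1, h2⟩; exact ⟨Or.inr h1, h2⟩
      · rintro ⟨h1 | h1, h2⟩
        · exact absurd (interior_subset h1) h2
        · exact ⟨h1, h2⟩
    rw [this]
    exact ho.sdiff hc
  have h0 := hW (K \ W) hQo (hK.isBounded.subset sdiff_subset) disjoint_sdiff_left (by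
    intro z hz
    rw [hQo.frontier_eq] at hz
    by_contra h
    exact hz.2 ⟨closure_minimal sdiff_subset hK.isClosed hz.1, h⟩)
  have hKW : K ⊆ W := sdiff_eq_empty.1 h0
  have : interior W ∪ K ⊆ interior W :=
    interior_maximal (union_subset interior_subset hKW) ho
  exact disjoint_self.1 (hd.mono_right (subset_union_right.trans this))

/-- A simply connected region is full. -/
theorem IsTopologicalDisk.openFull {U : Set ℂ} (hU : IsTopologicalDisk U) : OpenFull U := by
  intro K hK hd ho
  by_contra hne
  obtain ⟨a, ha⟩ := nonempty_iff_ne_empty.2 hne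
  obtain ⟨L, hL, hLa⟩ := Complex.exists_continuousOn_eqOn_exp_comp hU.2 hU.1
    (g := fun z => z - a) (Continuous.continuousOn (by fun_prop)) (by
      rintro ⟨z, hz, hza⟩
      exact disjoint_left.1 hd ha (sub_eq_zero.1 hza ▸ hz))
  -- A compact neighbourhood of `K` in `U ∪ K` has an interior with boundary in `U`, where `z - a`
  -- has a logarithm.
  obtain ⟨M, hM, hKM, hMU⟩ := exists_compact_between hK ho subset_union_right
  have hfr : frontier (interior M) ⊆ U := by
    intro z hz
    rw [isOpen_interior.frontier_eq] at hz
    have hzM : z ∈ M := hM.isClosed.closure_subset (closure_mono interior_subset hz.1)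
    exact (hMU hzM).resolve_right fun h => hz.2 (hKM h)
  obtain ⟨N, hN, hNL⟩ := exists_extension_of_continuousOn isClosed_frontier (hL.mono hfr)
  refine no_zero_free_extension isOpen_interior (hM.isBounded.subset interior_subset) (hKM ha)
    (ψ := fun z => Complex.exp (N z)) (Continuous.continuousOn (by fun_prop))
    (fun z _ => Complex.exp_ne_zero _) fun z hz => ?_
  rw [hNL hz]
  exact hLa (hfr hz)

/-- The complement in the sphere of a bounded full open set is connected. -/
theorem OpenFull.isConnected_compl {G : Set ℂ} (hG : OpenFull G) (ho : IsOpen G) :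
    IsConnected (((↑) : ℂ → OnePoint ℂ) '' G)ᶜ := by
  have hcl : IsClosed (((↑) : ℂ → OnePoint ℂ) '' G)ᶜ :=
    (OnePoint.isOpen_image_coe.2 ho).isClosed_compl
  have hinf : (OnePoint.infty : OnePoint ℂ) ∈ (((↑) : ℂ → OnePoint ℂ) '' G)ᶜ := by simp
  refine ⟨⟨_, hinf⟩, ?_⟩
  -- a closed part without `∞` is empty
  have key : ∀ K₁ K₂ : Set (OnePoint ℂ), IsClosed K₁ → IsClosed K₂ →
      (((↑) : ℂ → OnePoint ℂ) '' G)ᶜ ⊆ K₁ ∪ K₂ →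
      (((↑) : ℂ → OnePoint ℂ) '' G)ᶜ ∩ (K₁ ∩ K₂) = ∅ → OnePoint.infty ∈ K₁ →
      (((↑) : ℂ → OnePoint ℂ) '' G)ᶜ ⊆ K₁ := by
    intro K₁ K₂ h1 h2 hcov hdisj hi
    -- The part away from `∞` is a compact subset of the plane. Its union with `G` is open, being
    -- the plane minus the other closed part, so fullness applies.
    set T : Set (OnePoint ℂ) := (((↑) : ℂ → OnePoint ℂ) '' G)ᶜ ∩ K₂ with hT
    have hTi : OnePoint.infty ∉ T := fun h => by
      have : OnePoint.infty ∈ (((↑) : ℂ → OnePoint ℂ) '' G)ᶜ ∩ (K₁ ∩ K₂) := ⟨h.1, hi, h.2⟩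
      rw [hdisj] at this; exact this
    set K : Set ℂ := ((↑) : ℂ → OnePoint ℂ) ⁻¹' T with hK
    have himg : ((↑) : ℂ → OnePoint ℂ) '' K = T := by
      rw [hK, image_preimage_eq_iff]
      intro x hx
      induction x using OnePoint.rec with
      | infty => exact absurd hx hTi
      | coe z => exact mem_range_self z
    have hKc : IsCompact K := by
      have : IsClosed (((↑) : ℂ → OnePoint ℂ) '' K) := by rw [himg]; exact hcl.inter h2
      exact (OnePoint.isClosed_image_coe.1 this).2
    have h0 := hG K hKc (disjoint_left.2 fun z hz hzG => hz.1 (mem_image_of_mem _ hzG)) (by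
      have : G ∪ K = ((↑) : ℂ → OnePoint ℂ) ⁻¹'
          (((((↑) : ℂ → OnePoint ℂ) '' G)ᶜ ∩ K₁)ᶜ) := by
        ext z
        simp only [mem_union, mem_preimage, mem_compl_iff, mem_inter_iff, hK, hT,
          OnePoint.coe_injective.mem_set_image, not_and]
        constructor
        · rintro (h | h) h'
          · exact absurd h h'
          · intro h1
            have : (z : OnePoint ℂ) ∈ (((↑) : ℂ → OnePoint ℂ) '' G)ᶜ ∩ (K₁ ∩ K₂) :=
              ⟨by simpa [OnePoint.coe_injective.mem_set_image] using h', h1, h.2⟩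
            rw [hdisj] at this; exact this
        · intro h
          by_cases hz : z ∈ G
          · exact Or.inl hz
          · have hz' : (z : OnePoint ℂ) ∈ (((↑) : ℂ → OnePoint ℂ) '' G)ᶜ := by
              simpa [OnePoint.coe_injective.mem_set_image] using hz
            exact Or.inr ⟨hz, (hcov hz').resolve_left (h hz)⟩
      rw [this]
      exact (hcl.inter h1).isOpen_compl.preimage OnePoint.continuous_coe)
    intro x hx
    refine (hcov hx).resolve_right fun h => ?_
    have : x ∈ T := ⟨hx, h⟩
    rw [← himg, h0, image_empty] at this
    exact this
  rw [isPreconnected_iff_subset_of_disjoint_closed]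
  intro K₁ K₂ h1 h2 hcov hdisj
  rcases hcov hinf with hi | hi
  · exact Or.inl (key K₁ K₂ h1 h2 hcov hdisj hi)
  · exact Or.inr (key K₂ K₁ h2 h1 (union_comm K₁ K₂ ▸ hcov) (inter_comm K₁ K₂ ▸ hdisj) hi)

/-- A nonempty open set bounded by one point would contain the rest of the plane, which is connected
and unbounded. -/
theorem closedFull_singleton (a : ℂ) : ClosedFull {a} := by
  intro Q hQ hb hd hf
  by_contra hne
  obtain ⟨q, hq⟩ := nonempty_iff_ne_empty.2 hne
  have hc : IsPreconnected ({a}ᶜ : Set ℂ) :=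
    (isConnected_compl_singleton_of_one_lt_rank (by simp) a).isPreconnected
  have hsub : ({a}ᶜ : Set ℂ) ⊆ interior Q := by
    refine hc.subset_interior_of_disjoint_frontier ⟨q, ?_, hq⟩ fun x hx hxf => hx (hf hxf)
    exact fun h => disjoint_left.1 hd hq h
  have : Bornology.IsBounded (univ : Set ℂ) := by
    rw [← compl_union_self {a}]
    exact (hb.subset (hsub.trans interior_subset)).union Bornology.isBounded_singleton
  exact NormedSpace.unbounded_univ ℝ ℂ this

/-- A full compact connected set inside a bounded full connected region cuts out a doubly
connected region. -/
theorem isDoublyConnected_diff {O P : Set ℂ} (hO : IsOpen O) (hOb : Bornology.IsBounded O)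
    (hOc : IsConnected O) (hOf : OpenFull O) (hP : IsCompact P) (hPc : IsConnected P)
    (hPf : ClosedFull P) (hPO : P ⊆ O) : IsDoublyConnected (O \ P) := by
  refine ⟨hO.sdiff hP.isClosed, ⟨?_, hPf.isPreconnected_diff hO hOb hOc.isPreconnected hP hPO⟩,
    ((↑) : ℂ → OnePoint ℂ) '' P, (((↑) : ℂ → OnePoint ℂ) '' O)ᶜ,
    OnePoint.isClosed_image_coe.2 ⟨hP.isClosed, hP⟩,
    (OnePoint.isOpen_image_coe.2 hO).isClosed_compl,
    hPc.image _ OnePoint.continuous_coe.continuousOn, hOf.isConnected_compl hO,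
    (disjoint_compl_right).mono_left (image_mono hPO), ?_⟩
  · by_contra h
    have hOP : O ⊆ P := sdiff_eq_empty.1 (not_nonempty_iff_eq_empty.1 h)
    have : O = P := hOP.antisymm hPO
    have := eq_empty_of_isCompact_of_isOpen (this ▸ hP) hO
    exact hOc.nonempty.ne_empty this
  · rw [image_sdiff OnePoint.coe_injective, compl_sdiff, union_comm]

namespace QuadraticLike

variable (F : QuadraticLike)

/-! ### The branched double covering -/

theorem isOpen_dom : IsOpen F.U' := F.disk_dom.1

theorem isPreconnected_dom : IsPreconnected F.U' := F.disk_dom.2.isPathConnected.isConnected.isPreconnected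

theorem isBounded_dom : Bornology.IsBounded F.U' := F.isCompact_closure.isBounded.subset subset_closure

theorem continuousOn : ContinuousOn F.f F.U' := F.differentiableOn.continuousOn

theorem eq_zero_of_map_eq {z : ℂ} (hz : z ∈ F.U') (h : F.f z = F.f 0) : z = 0 := by
  have : z ∈ {z | z ∈ F.U' ∧ F.f z = F.f 0} := ⟨hz, h⟩
  rwa [F.fiber_critical] at this

theorem dom_nontrivial {x : ℂ} (hx : x ∈ F.U') {N : Set ℂ} (hN : N ∈ 𝓝 x) (a : ℂ) :
    ∃ z ∈ F.U' ∩ N, z ≠ a := by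
  by_contra! h
  have hmem : F.U' ∩ N ∈ 𝓝 x := inter_mem (F.isOpen_dom.mem_nhds hx) hN
  have hinf : (F.U' ∩ N).Infinite := infinite_of_mem_nhds x hmem
  exact hinf ((finite_singleton a).subset fun z hz => h z hz)

theorem isOpen_image {s : Set ℂ} (hs : s ⊆ F.U') (ho : IsOpen s) : IsOpen (F.f '' s) := by
  rcases (F.differentiableOn.analyticOnNhd F.isOpen_dom).is_constant_or_isOpen
    F.isPreconnected_dom with ⟨w, hw⟩ | h
  · exfalso
    obtain ⟨z, hz, hz0⟩ := F.dom_nontrivial F.zero_mem univ_mem 0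
    exact hz0 (F.eq_zero_of_map_eq hz.1 ((hw z hz.1).trans (hw 0 F.zero_mem).symm))
  · exact h s hs ho

/-- No value other than the critical one has three preimages. -/
theorem not_three {x y z : ℂ} (hx : x ∈ F.U') (hy : y ∈ F.U') (hz : z ∈ F.U') (hxy : x ≠ y)
    (hxz : x ≠ z) (hyz : y ≠ z) (h1 : F.f y = F.f x) (h2 : F.f z = F.f x) : False := by
  have hne : F.f x ≠ F.f 0 := fun h => by
    rw [h] at h1
    exact hxy ((F.eq_zero_of_map_eq hx h).trans (F.eq_zero_of_map_eq hy h1).symm)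
  have hcard := F.fiber_regular (F.f x) (F.mapsTo hx) hne
  have hfin : {z | z ∈ F.U' ∧ F.f z = F.f x}.Finite := finite_of_ncard_ne_zero (by rw [hcard]; simp)
  have hsub : ({x, y, z} : Set ℂ) ⊆ {z | z ∈ F.U' ∧ F.f z = F.f x} := by
    rintro w (rfl | rfl | rfl)
    · exact ⟨hx, rfl⟩
    · exact ⟨hy, h1⟩
    · exact ⟨hz, h2⟩
  have h3 : ({x, y, z} : Set ℂ).ncard = 3 := by
    rw [Set.ncard_eq_toFinset_card']
    simp [hxy, hxz, hyz]
  have := ncard_le_ncard hsub hfin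
  omega

theorem exists_other {x : ℂ} (hx : x ∈ F.U') (hx0 : x ≠ 0) :
    ∃ y ∈ F.U', y ≠ x ∧ F.f y = F.f x := by
  have hne : F.f x ≠ F.f 0 := fun h => hx0 (F.eq_zero_of_map_eq hx h)
  have hcard := F.fiber_regular (F.f x) (F.mapsTo hx) hne
  obtain ⟨y, hy, hyx⟩ := exists_ne_of_one_lt_ncard (hcard ▸ one_lt_two) x
  exact ⟨y, hy.1, hyx, hy.2⟩

/-- The map is locally injective away from the critical point. -/
theorem exists_injOn_nhds {x : ℂ} (hx : x ∈ F.U') (hx0 : x ≠ 0) :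
    ∃ N : Set ℂ, IsOpen N ∧ x ∈ N ∧ N ⊆ F.U' ∧ InjOn F.f N := by
  -- Points near `x` share their value with a point near `y`. Two of them with the same value would
  -- therefore give a fibre of three points.
  obtain ⟨y, hy, hyx, hfy⟩ := F.exists_other hx hx0
  obtain ⟨A, B, hA, hB, hxA, hyB, hAB⟩ := t2_separation hyx.symm
  have hBo := F.isOpen_image (s := B ∩ F.U') inter_subset_right (hB.inter F.isOpen_dom)
  have hN : IsOpen (F.U' ∩ F.f ⁻¹' (F.f '' (B ∩ F.U'))) :=
    F.continuousOn.isOpen_inter_preimage F.isOpen_dom hBo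
  refine ⟨A ∩ (F.U' ∩ F.f ⁻¹' (F.f '' (B ∩ F.U'))), hA.inter hN, ⟨hxA, hx, y, ⟨hyB, hy⟩, hfy⟩,
    fun z hz => hz.2.1, ?_⟩
  rintro z ⟨hzA, hzU, y', ⟨hy'B, hy'U⟩, hfy'⟩ z' ⟨hz'A, hz'U, -⟩ hzz'
  by_contra hne
  exact F.not_three hzU hz'U hy'U hne (fun h => disjoint_left.1 hAB hzA (h ▸ hy'B))
    (fun h => disjoint_left.1 hAB hz'A (h ▸ hy'B)) hzz'.symm hfy'

/-- Properness: points of `U'` where `f` is close to `w` are close to the fibre of `w`. -/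
theorem fiber_small {w : ℂ} (hw : w ∈ F.U) {N : Set ℂ} (hN : IsOpen N)
    (h : ∀ z ∈ F.U', F.f z = w → z ∈ N) : ∀ᶠ v in 𝓝 w, ∀ z ∈ F.U', F.f z = v → z ∈ N := by
  obtain ⟨K, hK, hwK, hKU⟩ := exists_compact_subset F.disk_range.1 hw
  have hC : IsCompact ((F.U' ∩ F.f ⁻¹' K) \ N) := (F.proper K hKU hK).diff hN
  have hfC : IsCompact (F.f '' ((F.U' ∩ F.f ⁻¹' K) \ N)) :=
    hC.image_of_continuousOn (F.continuousOn.mono fun z hz => hz.1.1)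
  have hwC : w ∉ F.f '' ((F.U' ∩ F.f ⁻¹' K) \ N) := by
    rintro ⟨z, hz, hzw⟩
    exact hz.2 (h z hz.1.1 hzw)
  filter_upwards [mem_interior_iff_mem_nhds.1 hwK, hfC.isClosed.isOpen_compl.mem_nhds hwC]
    with v hv hvC z hz hzv
  by_contra hzN
  exact hvC ⟨z, ⟨⟨hz, by rw [mem_preimage, hzv]; exact hv⟩, hzN⟩, hzv⟩

/-- Some branch of `(f - f 0) ^ (1 / n)` is defined on `U'`. -/
theorem exists_root : ∃ (n : ℕ) (χ : ℂ → ℂ), n ≠ 0 ∧ DifferentiableOn ℂ χ F.U' ∧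
    deriv χ 0 ≠ 0 ∧ χ 0 = 0 ∧ ∀ z ∈ F.U', χ z ^ n = F.f z - F.f 0 := by
  classical
  have hU := F.isOpen_dom.mem_nhds F.zero_mem
  have han : AnalyticAt ℂ (fun z => F.f z - F.f 0) 0 :=
    (F.differentiableOn.analyticAt hU).sub analyticAt_const
  have hnt : ¬ ∀ᶠ z in 𝓝 (0 : ℂ), F.f z - F.f 0 = 0 := fun h => by
    obtain ⟨z, hz, hz0⟩ := F.dom_nontrivial F.zero_mem h 0
    exact hz0 (F.eq_zero_of_map_eq hz.1 (sub_eq_zero.1 hz.2))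
  obtain ⟨n, g, hg, hg0, hfg⟩ := (han.exists_eventuallyEq_pow_smul_nonzero_iff).2 hnt
  have hn : n ≠ 0 := by
    rintro rfl
    have := hfg.self_of_nhds
    simp at this
    exact hg0 this.symm
  -- This is `(f - f 0) / z ^ n` with the singularity removed. It is zero-free because `0` is the
  -- only zero of `f - f 0`, so it has a logarithm `L` on `U'`, and `z exp (L / n)` is the root.
  set G : ℂ → ℂ := fun z => if z = 0 then g 0 else (F.f z - F.f 0) / z ^ n with hG
  have hGg : G =ᶠ[𝓝 0] g := by
    filter_upwards [hfg] with z hz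
    by_cases h : z = 0
    · simp [hG, h]
    · simp only [hG, h, if_false]
      rw [hz]
      have : z ^ n ≠ 0 := pow_ne_zero _ h
      simp only [sub_zero, smul_eq_mul]
      field_simp
  have hGd : ∀ z ∈ F.U', DifferentiableAt ℂ G z := by
    intro z hz
    by_cases h : z = 0
    · rw [h]; exact (hg.congr hGg.symm).differentiableAt
    · have hd : DifferentiableAt ℂ (fun z => (F.f z - F.f 0) / z ^ n) z :=
        (((F.differentiableOn.differentiableAt (F.isOpen_dom.mem_nhds hz)).sub_const _)).div
          (differentiableAt_pow n) (pow_ne_zero _ h)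
      refine hd.congr_of_eventuallyEq ?_
      filter_upwards [isOpen_compl_singleton.mem_nhds (show z ∈ ({0}ᶜ : Set ℂ) from h)] with y hy
      have : y ≠ 0 := hy
      simp [hG, this]
  have hGne : ∀ z ∈ F.U', G z ≠ 0 := by
    intro z hz
    by_cases h : z = 0
    · simp [hG, h, hg0]
    · simp only [hG, h, if_false]
      exact div_ne_zero (fun h' => h (F.eq_zero_of_map_eq hz (sub_eq_zero.1 h'))) (pow_ne_zero _ h)
  obtain ⟨L, hL, hLG⟩ := Complex.exists_continuousOn_eqOn_exp_comp F.disk_dom.2 F.isOpen_dom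
    (g := G) (fun z hz => (hGd z hz).continuousAt.continuousWithinAt) (by
      rintro ⟨z, hz, h⟩; exact hGne z hz h)
  have hLd : ∀ z ∈ F.U', DifferentiableAt ℂ L z := by
    intro z hz
    have h1 : HasDerivAt (Complex.exp ∘ L) (deriv G z) z := by
      refine (hGd z hz).hasDerivAt.congr_of_eventuallyEq ?_
      filter_upwards [F.isOpen_dom.mem_nhds hz] with y hy using hLG hy
    exact (HasDerivAt.of_comp_left (hL.continuousAt (F.isOpen_dom.mem_nhds hz))
      (Complex.hasDerivAt_exp (L z)) h1 (Complex.exp_ne_zero _)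
      EventuallyEq.rfl).differentiableAt
  refine ⟨n, fun z => z * Complex.exp (L z / n), hn, fun z hz => ?_, ?_, by simp, fun z hz => ?_⟩
  · exact (differentiableAt_id.mul ((hLd z hz).div_const _).cexp).differentiableWithinAt
  · have := (hasDerivAt_id (0 : ℂ)).mul (((hLd 0 F.zero_mem).div_const (n : ℂ)).cexp).hasDerivAt
    simp only [id, zero_mul, add_zero, one_mul] at this
    have h2 := this.deriv
    have h3 : deriv (fun z => z * Complex.exp (L z / n)) 0 = Complex.exp (L 0 / n) := h2
    rw [h3]
    exact Complex.exp_ne_zero _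
  · have hn' : (n : ℂ) ≠ 0 := by exact_mod_cast hn
    have h1 : Complex.exp (L z / n) ^ n = G z := by
      rw [← Complex.exp_nat_mul, mul_div_cancel₀ _ hn']
      exact hLG hz
    rw [mul_pow, h1]
    by_cases h : z = 0
    · simp [h, hn]
    · have := pow_ne_zero n h
      simp only [hG, h, if_false]
      field_simp

/-- The square root of `f - f 0` is an injective function on `U'`. -/
theorem exists_sqrt : ∃ ψ : ℂ → ℂ, ContinuousOn ψ F.U' ∧ InjOn ψ F.U' ∧
    ∀ z ∈ F.U', ψ z ^ 2 = F.f z - F.f 0 := by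
  obtain ⟨n, χ, hn, hχ, hχ', hχ0, hroot⟩ := F.exists_root
  have hU := F.isOpen_dom.mem_nhds F.zero_mem
  have hstrict : HasStrictDerivAt χ (deriv χ 0) 0 :=
    (hχ.analyticAt hU).hasStrictDerivAt
  obtain ⟨N, hNo, h0N, hNU, hNinj⟩ : ∃ N : Set ℂ, IsOpen N ∧ 0 ∈ N ∧ N ⊆ F.U' ∧ InjOn χ N := by
    obtain ⟨N, hN, hNo, h0⟩ := eventually_nhds_iff.1
      ((hstrict.eventually_left_inverse hχ').and (mem_of_superset hU fun z hz => hz))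
    exact ⟨N, hNo, h0, fun z hz => (hN z hz).2, fun x hx y hy hxy => by
      rw [← (hN x hx).1, hxy, (hN y hy).1]⟩
  -- For `n = 1` the map would be injective near `0`, whereas by properness both preimages of a
  -- value near `f 0` are near `0`.
  have hn1 : n ≠ 1 := by
    rintro rfl
    have hfib := F.fiber_small (F.mapsTo F.zero_mem) hNo
      (fun z hz h => by rw [F.eq_zero_of_map_eq hz h]; exact h0N)
    obtain ⟨z, ⟨hzU, hz⟩, hz0⟩ := F.dom_nontrivial F.zero_mem
      ((F.continuousOn.continuousAt hU).eventually hfib) 0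
    obtain ⟨y, hy, hyz, hfy⟩ := F.exists_other hzU hz0
    refine hyz (hNinj (hz y hy hfy) (hz z hzU rfl) ?_)
    have h1 := hroot y hy
    have h2 := hroot z hzU
    simp only [pow_one] at h1 h2
    rw [h1, h2, hfy]
  -- For `n ≥ 3` the points where the local coordinate `χ` takes the values `(r / 2) ω ^ j`, `j = 0,
  -- 1, 2`, form three points of one fibre.
  have hn2 : n = 2 := by
    by_contra hne
    have h3 : 3 ≤ n := by omega
    have himg : χ '' N ∈ 𝓝 (0 : ℂ) := by
      have := image_mem_map (m := χ) (hNo.mem_nhds h0N)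
      rwa [hstrict.map_nhds_eq hχ', hχ0] at this
    obtain ⟨r, hr, hball⟩ := Metric.mem_nhds_iff.1 himg
    have hprim := Complex.isPrimitiveRoot_exp n hn
    set ω := Complex.exp (2 * Real.pi * Complex.I / n)
    have hω : ‖ω‖ = 1 := hprim.norm'_eq_one hn
    have hpt : ∀ j : ℕ, ∃ z ∈ N, χ z = (r / 2 : ℝ) * ω ^ j := fun j => by
      apply hball
      rw [mem_ball_zero_iff, norm_mul, norm_pow, hω, one_pow, mul_one, Complex.norm_real,
        Real.norm_of_nonneg (by positivity)]
      linarith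
    have hr0 : ((r / 2 : ℝ) : ℂ) ≠ 0 := by
      exact_mod_cast (by positivity : r / 2 ≠ 0)
    choose p hpN hp using hpt
    have hfp : ∀ j, F.f (p j) = F.f (p 0) := fun j => by
      have h1 := hroot _ (hNU (hpN j))
      have h2 := hroot _ (hNU (hpN 0))
      rw [hp, mul_pow, ← pow_mul, mul_comm j n, pow_mul, hprim.pow_eq_one, one_pow] at h1
      rw [hp, mul_pow, ← pow_mul, zero_mul, pow_zero] at h2
      linear_combination h2 - h1
    have hdist : ∀ i j, i < n → j < n → i ≠ j → p i ≠ p j := fun i j hi hj hij h => by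
      have := hp i
      rw [h, hp j] at this
      exact hij (hprim.pow_inj hi hj (mul_left_cancel₀ hr0 this).symm)
    exact F.not_three (hNU (hpN 0)) (hNU (hpN 1)) (hNU (hpN 2))
      (hdist 0 1 (by omega) (by omega) (by omega)) (hdist 0 2 (by omega) (by omega) (by omega))
      (hdist 1 2 (by omega) (by omega) (by omega)) (hfp 1) (hfp 2)
  subst hn2
  refine ⟨χ, hχ.continuousOn, ?_, hroot⟩
  have hχc := hχ.continuousOn
  have hfib : ∀ x ∈ F.U', ∀ y ∈ F.U', χ y = χ x → F.f y = F.f x := fun x hx y hy h => by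
    have h1 := hroot x hx
    have h2 := hroot y hy
    rw [h] at h2
    linear_combination h1 - h2
  set D : Set ℂ := F.U' \ {0}
  have hDo : IsOpen D := F.isOpen_dom.sdiff isClosed_singleton
  have hDc : IsPreconnected D := (closedFull_singleton 0).isPreconnected_diff F.isOpen_dom
    F.isBounded_dom F.isPreconnected_dom isCompact_singleton (singleton_subset_iff.2 F.zero_mem)
  -- Failure of injectivity is an open and closed condition in the connected punctured domain, and
  -- it does not occur near `0`.
  set S : Set ℂ := {z | z ∈ D ∧ ∃ z' ∈ F.U', z' ≠ z ∧ χ z' = χ z} with hS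
  have hSo : IsOpen S := by
    rw [isOpen_iff_mem_nhds]
    rintro z ⟨hzD, z', hz', hne, hzz'⟩
    have hχz : χ z ≠ 0 := fun h => hzD.2 (F.eq_zero_of_map_eq hzD.1 (by
      have := hroot z hzD.1
      rw [h] at this
      linear_combination -this))
    obtain ⟨A, B, hA, hB, hzA, hzB, hAB⟩ := t2_separation hne
    -- near `z'` the function is far from `-χ z`
    have hnear : ∀ᶠ y in 𝓝 z', ‖χ y - χ z‖ < ‖χ z‖ / 2 := by
      have : Tendsto (fun y => ‖χ y - χ z‖) (𝓝 z') (𝓝 ‖χ z' - χ z‖) :=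
        ((hχc.continuousAt (F.isOpen_dom.mem_nhds hz')).sub_const _).norm
      refine this.eventually_lt_const ?_
      rw [hzz', sub_self, norm_zero]
      have := norm_pos_iff.2 hχz
      linarith
    have hnear2 : ∀ᶠ y in 𝓝 z, ‖χ y - χ z‖ < ‖χ z‖ / 2 := by
      have : Tendsto (fun y => ‖χ y - χ z‖) (𝓝 z) (𝓝 ‖χ z - χ z‖) :=
        ((hχc.continuousAt (F.isOpen_dom.mem_nhds hzD.1)).sub_const _).norm
      refine this.eventually_lt_const ?_
      rw [sub_self, norm_zero]
      have := norm_pos_iff.2 hχz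
      linarith
    obtain ⟨M, hM, hMo, hzM⟩ := eventually_nhds_iff.1 hnear
    have himg : F.f '' (F.U' ∩ (A ∩ M)) ∈ 𝓝 (F.f z) := by
      rw [← hfib z hzD.1 z' hz' hzz']
      exact (F.isOpen_image inter_subset_left (F.isOpen_dom.inter (hA.inter hMo))).mem_nhds
        (mem_image_of_mem _ ⟨hz', hzA, hzM⟩)
    filter_upwards [hDo.mem_nhds hzD, hB.mem_nhds hzB, hnear2,
      (F.continuousOn.continuousAt (F.isOpen_dom.mem_nhds hzD.1)).eventually himg]
      with x hxD hxB hx2 hx3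
    obtain ⟨x', ⟨hx'U, hx'A, hx'M⟩, hfx'⟩ := hx3
    refine ⟨hxD, x', hx'U, fun h => disjoint_left.1 hAB hx'A (h ▸ hxB), ?_⟩
    -- The values at two points of a fibre are equal or opposite. Both are close to `χ z ≠ 0`, so
    -- they are equal.
    have hsq : χ x' ^ 2 = χ x ^ 2 := by rw [hroot x' hx'U, hroot x hxD.1, hfx']
    rcases sq_eq_sq_iff_eq_or_eq_neg.1 hsq with h | h
    · exact h
    · exfalso
      have h1 := hM x' hx'M
      have h4 : ‖(χ x - χ z) + (χ x' - χ z)‖ = 2 * ‖χ z‖ := by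
        have : (χ x - χ z) + (χ x' - χ z) = -(2 * χ z) := by rw [h]; ring
        rw [this, norm_neg, norm_mul, Complex.norm_two]
      have h5 := norm_add_le (χ x - χ z) (χ x' - χ z)
      have := norm_pos_iff.2 hχz
      linarith
  -- If `z` is not in `S`, the partners of points near `z` cannot be near `z`, by local injectivity
  -- of `f`, nor away from it: there they stay in a compact set on which `χ` omits the value `χ z`.
  have hScl : closure S ∩ D ⊆ S := by
    rintro z ⟨hzc, hzD⟩
    by_contra hzS
    obtain ⟨M, hMo, hzM, hMU, hMinj⟩ := F.exists_injOn_nhds hzD.1 hzD.2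
    obtain ⟨K, hK, hwK, hKU⟩ := exists_compact_subset F.disk_range.1 (F.mapsTo hzD.1)
    have hC : IsCompact ((F.U' ∩ F.f ⁻¹' K) \ M) := (F.proper K hKU hK).diff hMo
    have hχC : IsCompact (χ '' ((F.U' ∩ F.f ⁻¹' K) \ M)) :=
      hC.image_of_continuousOn (hχc.mono fun z hz => hz.1.1)
    have hzC : χ z ∉ χ '' ((F.U' ∩ F.f ⁻¹' K) \ M) := by
      rintro ⟨y, hy, hyz⟩
      exact hzS ⟨hzD, y, hy.1.1, fun h => hy.2 (h ▸ hzM), hyz⟩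
    have hev : ∀ᶠ x in 𝓝 z, x ∈ M ∧ F.f x ∈ K ∧ χ x ∉ χ '' ((F.U' ∩ F.f ⁻¹' K) \ M) := by
      have hz := F.isOpen_dom.mem_nhds hzD.1
      filter_upwards [hMo.mem_nhds hzM,
        (F.continuousOn.continuousAt hz).eventually (mem_interior_iff_mem_nhds.1 hwK),
        (hχc.continuousAt hz).eventually (hχC.isClosed.isOpen_compl.mem_nhds hzC)] with x h1 h2 h3
      exact ⟨h1, h2, h3⟩
    obtain ⟨x, ⟨hxD, x', hx', hne, hxx'⟩, hxM, hxK, hxC⟩ :=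
      ((mem_closure_iff_frequently.1 hzc).and_eventually hev).exists
    have hff := hfib x hxD.1 x' hx' hxx'
    by_cases hx'M : x' ∈ M
    · exact hne (hMinj hx'M hxM hff)
    · exact hxC ⟨x', ⟨⟨hx', by rw [mem_preimage, hff]; exact hxK⟩, hx'M⟩, hxx'⟩
  have hSempty : S = ∅ := by
    by_contra hne
    obtain ⟨s, hs⟩ := nonempty_iff_ne_empty.2 hne
    have hDS : D ⊆ S := hDc.subset_of_closure_inter_subset hSo ⟨s, hs.1, hs⟩ hScl
    have hfibs := F.fiber_small (F.mapsTo F.zero_mem) hNo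
      (fun z hz h => by rw [F.eq_zero_of_map_eq hz h]; exact h0N)
    obtain ⟨z, ⟨hzU, hz⟩, hz0⟩ := F.dom_nontrivial F.zero_mem
      ((F.continuousOn.continuousAt hU).eventually hfibs) 0
    obtain ⟨-, y, hy, hyz, hχy⟩ := hDS ⟨hzU, hz0⟩
    exact hyz (hNinj (hz y hy (hfib z hzU y hy hχy)) (hz z hzU rfl) hχy)
  intro x hx y hy hxy
  by_contra hne
  by_cases hx0 : x = 0
  · exact hne (hx0.trans (F.eq_zero_of_map_eq hy (by rw [hfib x hx y hy hxy.symm, hx0])).symm)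
  · have : x ∈ S := ⟨⟨hx, hx0⟩, y, hy, Ne.symm hne, hxy.symm⟩
    rw [hSempty] at this
    exact this

/-- Over a full compact set that misses the critical value, the double covering splits. -/
theorem exists_split {W : Set ℂ} (hW : IsCompact W) (hWU : W ⊆ F.U) (hf : ClosedFull W)
    (h0 : F.f 0 ∉ W) : ∃ A₁ A₂ : Set ℂ, IsClosed A₁ ∧ IsClosed A₂ ∧ Disjoint A₁ A₂ ∧
      A₁ ∪ A₂ = F.U' ∩ F.f ⁻¹' W ∧ InjOn F.f A₁ ∧ InjOn F.f A₂ := by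
  obtain ⟨ψ, hψ, hinj, hsq⟩ := F.exists_sqrt
  obtain ⟨L, hL, hLW⟩ := hf.hasLog hW h0
  set T := F.U' ∩ F.f ⁻¹' W with hT
  have hTc : IsCompact T := F.proper W hWU hW
  -- The logarithm over `W` gives a second square root of `f - f 0`, which depends on `f z` only.
  -- The sheets are `ψ = e` and `ψ = -e`; on each of them `f` determines `ψ`, hence the point.
  set e : ℂ → ℂ := fun z => Complex.exp (L (F.f z) / 2) with he
  have hec : ContinuousOn e T := by
    have : ContinuousOn (fun z => L (F.f z)) T :=
      hL.comp (F.continuousOn.mono inter_subset_left) fun z hz => hz.2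
    exact (this.div_const 2).cexp
  have hesq : ∀ z ∈ T, e z ^ 2 = F.f z - F.f 0 := fun z hz => by
    have h1 : Complex.exp (L (F.f z)) = F.f z - F.f 0 := hLW _ hz.2
    rw [← h1, ← Complex.exp_nat_mul]
    congr 1
    push_cast
    ring
  have hψT := hψ.mono (inter_subset_left : T ⊆ F.U')
  have hcl : ∀ g : ℂ → ℂ, ContinuousOn g T → IsClosed {z | z ∈ T ∧ ψ z = g z} := fun g hg => by
    have := (hψT.sub hg).preimage_isClosed_of_isClosed hTc.isClosed (isClosed_singleton (x := (0 : ℂ)))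
    convert this using 1
    ext z
    simp [sub_eq_zero, hT]
  refine ⟨{z | z ∈ T ∧ ψ z = e z}, {z | z ∈ T ∧ ψ z = -e z}, hcl _ hec, hcl _ hec.neg, ?_, ?_,
    ?_, ?_⟩
  · rw [disjoint_left]
    rintro z ⟨hz, h1⟩ ⟨-, h2⟩
    have : e z = 0 := by linear_combination (h2 - h1) / 2
    exact Complex.exp_ne_zero _ this
  · ext z
    constructor
    · rintro (h | h) <;> exact h.1
    · intro hz
      rcases sq_eq_sq_iff_eq_or_eq_neg.1 ((hsq z hz.1).trans (hesq z hz).symm) with h | h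
      · exact Or.inl ⟨hz, h⟩
      · exact Or.inr ⟨hz, h⟩
  · rintro x ⟨hx, hxe⟩ y ⟨hy, hye⟩ hxy
    refine hinj hx.1 hy.1 ?_
    rw [hxe, hye, he]
    simp only [hxy]
  · rintro x ⟨hx, hxe⟩ y ⟨hy, hye⟩ hxy
    refine hinj hx.1 hy.1 ?_
    rw [hxe, hye, he]
    simp only [hxy]

end QuadraticLike

namespace QuadraticLike

variable {F : QuadraticLike}

/-! ### Components of preimages -/

section Component

variable {W : Set ℂ} {z : ℂ}

theorem isOpen_preimage_interior : IsOpen (F.U' ∩ F.f ⁻¹' interior W) :=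
  F.continuousOn.isOpen_inter_preimage F.isOpen_dom isOpen_interior

theorem isOpen_component : IsOpen (connectedComponentIn (F.U' ∩ F.f ⁻¹' interior W) z) :=
  isOpen_preimage_interior.connectedComponentIn

/-- Properness makes the full preimage of `W` compact, so taking closures does not lead to the
boundary of `U'`. -/
theorem closure_component_subset (hW : IsCompact W) (hWU : W ⊆ F.U) :
    closure (connectedComponentIn (F.U' ∩ F.f ⁻¹' interior W) z) ⊆ F.U' ∩ F.f ⁻¹' W :=
  closure_minimal ((connectedComponentIn_subset _ _).trans
    (inter_subset_inter_right _ (preimage_mono interior_subset))) (F.proper W hWU hW).isClosed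

/-- The preimage is open, so its components are open and relatively closed in it. -/
theorem mem_component_of_mem_closure {x : ℂ}
    (hx : x ∈ closure (connectedComponentIn (F.U' ∩ F.f ⁻¹' interior W) z)) (hxU : x ∈ F.U')
    (hfx : F.f x ∈ interior W) : x ∈ connectedComponentIn (F.U' ∩ F.f ⁻¹' interior W) z := by
  obtain ⟨y, hy, hy'⟩ := mem_closure_iff.1 hx _ (isOpen_component (F := F) (W := W) (z := x))
    (mem_connectedComponentIn ⟨hxU, hfx⟩)
  rw [connectedComponentIn_eq hy', ← connectedComponentIn_eq hy]
  exact mem_connectedComponentIn ⟨hxU, hfx⟩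

/-- By the open mapping theorem an interior point of the closure has its image in `interior W`, so
it already belongs to the component. Thus no information is lost when pull-backs are closed up at
every step. -/
theorem interior_closure_component (hW : IsCompact W) (hWU : W ⊆ F.U) :
    interior (closure (connectedComponentIn (F.U' ∩ F.f ⁻¹' interior W) z)) =
      connectedComponentIn (F.U' ∩ F.f ⁻¹' interior W) z := by
  refine Subset.antisymm (fun x hx => ?_) (interior_maximal subset_closure isOpen_component)
  have hcl := closure_component_subset (F := F) (z := z) hW hWU
  have hfo := F.isOpen_image (interior_subset.trans (hcl.trans inter_subset_left)) isOpen_interior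
  have hfi : F.f '' interior (closure (connectedComponentIn (F.U' ∩ F.f ⁻¹' interior W) z)) ⊆
      interior W := interior_maximal (by
        rintro _ ⟨y, hy, rfl⟩
        exact (hcl (interior_subset hy)).2) hfo
  exact mem_component_of_mem_closure (interior_subset hx) (hcl (interior_subset hx)).1
    (hfi (mem_image_of_mem _ hx))

theorem map_mem_frontier (hW : IsCompact W) (hWU : W ⊆ F.U) {x : ℂ}
    (hx : x ∈ frontier (closure (connectedComponentIn (F.U' ∩ F.f ⁻¹' interior W) z))) :
    F.f x ∈ frontier W := by
  rw [isClosed_closure.frontier_eq, interior_closure_component hW hWU] at hx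
  have h := closure_component_subset hW hWU hx.1
  rw [hW.isClosed.frontier_eq]
  exact ⟨h.2, fun h' => hx.2 (mem_component_of_mem_closure hx.1 h.1 h')⟩

/-- The image is open, and by properness relatively closed in the connected set `interior W`. -/
theorem image_component (hW : IsCompact W) (hWU : W ⊆ F.U) (hc : IsConnected (interior W))
    (hz : z ∈ F.U') (hfz : F.f z ∈ interior W) :
    F.f '' connectedComponentIn (F.U' ∩ F.f ⁻¹' interior W) z = interior W := by
  set C := connectedComponentIn (F.U' ∩ F.f ⁻¹' interior W) z with hC
  have hCs : C ⊆ F.U' ∩ F.f ⁻¹' interior W := connectedComponentIn_subset _ _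
  refine Subset.antisymm (image_subset_iff.2 fun x hx => (hCs hx).2) ?_
  have hcl := closure_component_subset (F := F) (z := z) hW hWU
  have hclc : IsCompact (closure C) :=
    (F.proper W hWU hW).of_isClosed_subset isClosed_closure hcl
  have hfc : IsClosed (F.f '' closure C) :=
    (hclc.image_of_continuousOn (F.continuousOn.mono fun x hx => (hcl hx).1)).isClosed
  refine hc.isPreconnected.subset_of_closure_inter_subset
    (F.isOpen_image (fun x hx => (hCs hx).1) isOpen_component)
    ⟨F.f z, hfz, mem_image_of_mem _ (mem_connectedComponentIn ⟨hz, hfz⟩)⟩ ?_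
  rintro w ⟨hw, hwW⟩
  obtain ⟨x, hx, rfl⟩ := closure_minimal (image_mono subset_closure) hfc hw
  exact mem_image_of_mem _ (mem_component_of_mem_closure hx (hcl hx).1 hwW)

end Component

variable (F) in
/-- The properties of puzzle pieces that pull-backs inherit. -/
structure IsGoodPiece (W : Set ℂ) : Prop where
  isCompact : IsCompact W
  subset : W ⊆ F.U
  full : ClosedFull W
  isConnected_interior : IsConnected (interior W)
  closure_interior : closure (interior W) = W
  -- The whole critical orbit is needed: pulling back once turns the condition at time `k` into the
  -- one at time `k + 1`.
  critical : ∀ k : ℕ, F.f^[k] 0 ∉ frontier W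

namespace IsGoodPiece

variable {W : Set ℂ} (hW : F.IsGoodPiece W)

include hW in
theorem isConnected : IsConnected W := hW.closure_interior ▸ hW.isConnected_interior.closure

include hW in
theorem critical_value : F.f 0 ∈ interior W ∨ F.f 0 ∉ W := by
  by_contra! h
  refine hW.critical 1 ?_
  rw [hW.isCompact.isClosed.frontier_eq]
  exact ⟨h.2, h.1⟩

include hW in
-- Every component maps onto `interior W`, hence contains a preimage of the critical value, and `0`
-- is the only one. So in this case there is only one component.
theorem zero_mem_component {z : ℂ} (hz : z ∈ F.U') (hfz : F.f z ∈ interior W)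
    (h0 : F.f 0 ∈ interior W) : 0 ∈ connectedComponentIn (F.U' ∩ F.f ⁻¹' interior W) z := by
  rw [← image_component hW.isCompact hW.subset hW.isConnected_interior hz hfz] at h0
  obtain ⟨x, hx, hx0⟩ := h0
  have := F.eq_zero_of_map_eq ((connectedComponentIn_subset _ _) hx).1 hx0
  rwa [this] at hx

include hW in
theorem closure_component_subset_or {A₁ A₂ : Set ℂ} (h1 : IsClosed A₁) (h2 : IsClosed A₂)
    (hd : Disjoint A₁ A₂) (hA : A₁ ∪ A₂ = F.U' ∩ F.f ⁻¹' W) (z : ℂ) :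
    closure (connectedComponentIn (F.U' ∩ F.f ⁻¹' interior W) z) ⊆ A₁ ∨
      closure (connectedComponentIn (F.U' ∩ F.f ⁻¹' interior W) z) ⊆ A₂ := by
  have hc : IsPreconnected (closure (connectedComponentIn (F.U' ∩ F.f ⁻¹' interior W) z)) :=
    isPreconnected_connectedComponentIn.closure
  refine (isPreconnected_iff_subset_of_disjoint_closed.1 hc) A₁ A₂ h1 h2 ?_ ?_
  · rw [hA]; exact closure_component_subset hW.isCompact hW.subset
  · rw [hd.inter_eq, inter_empty]

include hW in
/-- Distinct components of the preimage of a good piece have disjoint closures. -/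
theorem component_eq_of_closure_meet {z₁ z₂ x : ℂ} (hz₁ : z₁ ∈ F.U') (hfz₁ : F.f z₁ ∈ interior W)
    (hz₂ : z₂ ∈ F.U') (hfz₂ : F.f z₂ ∈ interior W)
    (hx₁ : x ∈ closure (connectedComponentIn (F.U' ∩ F.f ⁻¹' interior W) z₁))
    (hx₂ : x ∈ closure (connectedComponentIn (F.U' ∩ F.f ⁻¹' interior W) z₂)) :
    connectedComponentIn (F.U' ∩ F.f ⁻¹' interior W) z₁ =
      connectedComponentIn (F.U' ∩ F.f ⁻¹' interior W) z₂ := by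
  -- In the second case a component maps onto `interior W` inside a sheet where `f` is injective, so
  -- each sheet has room for one component only, and the closed sheets are disjoint.
  rcases hW.critical_value with h0 | h0
  · rw [connectedComponentIn_eq (hW.zero_mem_component hz₁ hfz₁ h0),
      connectedComponentIn_eq (hW.zero_mem_component hz₂ hfz₂ h0)]
  · obtain ⟨A₁, A₂, h1, h2, hd, hA, hi1, hi2⟩ :=
      F.exists_split hW.isCompact hW.subset hW.full h0
    have key : ∀ A, InjOn F.f A →
        closure (connectedComponentIn (F.U' ∩ F.f ⁻¹' interior W) z₁) ⊆ A →
        closure (connectedComponentIn (F.U' ∩ F.f ⁻¹' interior W) z₂) ⊆ A →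
        connectedComponentIn (F.U' ∩ F.f ⁻¹' interior W) z₁ =
          connectedComponentIn (F.U' ∩ F.f ⁻¹' interior W) z₂ := by
      intro A hi hA1 hA2
      have hz := hfz₁
      rw [← image_component hW.isCompact hW.subset hW.isConnected_interior hz₂ hfz₂] at hz
      obtain ⟨y, hy, hyz⟩ := hz
      have : y = z₁ := hi (hA2 (subset_closure hy))
        (hA1 (subset_closure (mem_connectedComponentIn ⟨hz₁, hfz₁⟩))) hyz
      rw [this] at hy
      exact (connectedComponentIn_eq hy).symm
    rcases hW.closure_component_subset_or h1 h2 hd hA z₁ with k1 | k1 <;>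
      rcases hW.closure_component_subset_or h1 h2 hd hA z₂ with k2 | k2
    · exact key A₁ hi1 k1 k2
    · exact absurd (k2 hx₂) (disjoint_left.1 hd (k1 hx₁))
    · exact absurd (k1 hx₁) (disjoint_left.1 hd (k2 hx₂))
    · exact key A₂ hi2 k1 k2

include hW in
theorem injOn_component {z : ℂ} (h0 : F.f 0 ∉ W) :
    InjOn F.f (closure (connectedComponentIn (F.U' ∩ F.f ⁻¹' interior W) z)) := by
  obtain ⟨A₁, A₂, h1, h2, hd, hA, hi1, hi2⟩ :=
    F.exists_split hW.isCompact hW.subset hW.full h0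
  rcases hW.closure_component_subset_or h1 h2 hd hA z with k | k
  · exact hi1.mono k
  · exact hi2.mono k

include hW in
-- A hole `Q` of the closed component stays in `U'`, which is full, and its image stays in `W`,
-- which is full. So `Q` contains a second component of the preimage. This component lies on the
-- other sheet, and the part of `Q` on that sheet is both compact and open, which is impossible.
theorem closedFull_component {z : ℂ} (hz : z ∈ F.U') (hfz : F.f z ∈ interior W) :
    ClosedFull (closure (connectedComponentIn (F.U' ∩ F.f ⁻¹' interior W) z)) := by
  intro Q hQ hb hd hfr
  set C := connectedComponentIn (F.U' ∩ F.f ⁻¹' interior W) z with hC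
  have hcl : closure C ⊆ F.U' ∩ F.f ⁻¹' W := closure_component_subset hW.isCompact hW.subset
  have hclQ : closure Q ⊆ Q ∪ closure C := by
    rw [closure_eq_self_union_frontier]
    exact union_subset_union_right _ hfr
  have hclQc : IsCompact (closure Q) := hb.isCompact_closure
  -- `Q` stays in the domain
  have hQU : closure Q ⊆ F.U' := by
    have h0 := F.disk_dom.openFull (closure Q \ F.U') (hclQc.diff F.isOpen_dom)
      disjoint_sdiff_left (by
        have : F.U' ∪ closure Q \ F.U' = F.U' ∪ Q := by
          ext x
          constructor
          · rintro (h | ⟨h, h'⟩)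
            · exact Or.inl h
            · exact (hclQ h).elim Or.inr fun h => absurd (hcl h).1 h'
          · rintro (h | h)
            · exact Or.inl h
            · by_cases h' : x ∈ F.U'
              · exact Or.inl h'
              · exact Or.inr ⟨subset_closure h, h'⟩
        rw [this]
        exact F.isOpen_dom.union hQ)
    exact sdiff_eq_empty.1 h0
  -- the image of `Q` stays in the piece
  have hfQo : IsOpen (F.f '' Q) := F.isOpen_image (subset_closure.trans hQU) hQ
  have hfclQ : IsCompact (F.f '' closure Q) :=
    hclQc.image_of_continuousOn (F.continuousOn.mono hQU)
  have hfQ : F.f '' Q ⊆ interior W := by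
    refine interior_maximal ?_ hfQo
    have hoQ : IsOpen (F.f '' Q \ W) := hfQo.sdiff hW.isCompact.isClosed
    have h0 := hW.full (F.f '' Q \ W) hoQ
      (hfclQ.isBounded.subset (sdiff_subset.trans (image_mono subset_closure)))
      disjoint_sdiff_left (by
        intro w hw
        rw [hoQ.frontier_eq] at hw
        by_contra hwW
        obtain ⟨x, hx, rfl⟩ := closure_minimal
          (sdiff_subset.trans (image_mono subset_closure)) hfclQ.isClosed hw.1
        rcases hclQ hx with h | h
        · exact hw.2 ⟨mem_image_of_mem _ h, hwW⟩
        · exact hwW (hcl h).2)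
    exact sdiff_eq_empty.1 h0
  have hfrQ : ∀ x ∈ frontier Q, F.f x ∉ interior W := by
    intro x hx hfx
    have hxC : x ∈ C := mem_component_of_mem_closure (hfr hx) (hcl (hfr hx)).1 hfx
    obtain ⟨y, hyC, hyQ⟩ := mem_closure_iff.1 (frontier_subset_closure hx) C isOpen_component hxC
    exact disjoint_left.1 hd hyQ (subset_closure hyC)
  by_contra hne
  obtain ⟨q, hq⟩ := nonempty_iff_ne_empty.2 hne
  have hqU : q ∈ F.U' := hQU (subset_closure hq)
  have hfq : F.f q ∈ interior W := hfQ (mem_image_of_mem _ hq)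
  set C' := connectedComponentIn (F.U' ∩ F.f ⁻¹' interior W) q with hC'
  have hC'Q : C' ⊆ Q := by
    refine (isPreconnected_connectedComponentIn.subset_interior_of_disjoint_frontier
      (t := Q) ⟨q, mem_connectedComponentIn (F := F.U' ∩ F.f ⁻¹' interior W) ⟨hqU, hfq⟩, hq⟩
      fun x hx hx' => ?_).trans interior_subset
    exact hfrQ x hx' (connectedComponentIn_subset _ _ hx).2
  have hCC' : C ≠ C' := fun h => by
    have : q ∈ C := h ▸ mem_connectedComponentIn ⟨hqU, hfq⟩
    exact disjoint_left.1 hd hq (subset_closure this)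
  rcases hW.critical_value with h0 | h0
  · exact hCC' ((connectedComponentIn_eq (hW.zero_mem_component hz hfz h0)).trans
      (connectedComponentIn_eq (hW.zero_mem_component hqU hfq h0)).symm)
  · -- the part of `Q` in the other sheet is compact and open
    obtain ⟨A₁, A₂, h1, h2, hdA, hA, hi1, hi2⟩ :=
      F.exists_split hW.isCompact hW.subset hW.full h0
    have key : ∀ A B : Set ℂ, IsClosed A → IsClosed B → Disjoint A B →
        A ∪ B = F.U' ∩ F.f ⁻¹' W → InjOn F.f A → closure C ⊆ A → False := by
      intro A B hAc hBc hAB hABW hAi hCA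
      have hqB : q ∈ B := by
        have : q ∈ A ∪ B := by rw [hABW]; exact ⟨hqU, (interior_subset hfq : F.f q ∈ W)⟩
        refine this.resolve_left fun hqA => ?_
        have hz' := hfq
        rw [← image_component hW.isCompact hW.subset hW.isConnected_interior hz hfz] at hz'
        obtain ⟨y, hy, hyq⟩ := hz'
        have hyq' := hAi (hCA (subset_closure hy)) hqA hyq
        rw [hyq'] at hy
        exact disjoint_left.1 hd hq (subset_closure hy)
      have hQB : Q ∩ B = Q \ A := by
        ext x
        constructor
        · rintro ⟨hx, hxB⟩
          exact ⟨hx, disjoint_right.1 hAB hxB⟩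
        · rintro ⟨hx, hxA⟩
          refine ⟨hx, (?_ : x ∈ A ∪ B).resolve_left hxA⟩
          rw [hABW]
          exact ⟨hQU (subset_closure hx),
            (interior_subset (hfQ (mem_image_of_mem _ hx)) : F.f x ∈ W)⟩
      have hQB' : Q ∩ B = closure Q ∩ B := by
        refine Subset.antisymm (inter_subset_inter_left _ subset_closure) ?_
        rintro x ⟨hx, hxB⟩
        refine ⟨(hclQ hx).resolve_right fun h => ?_, hxB⟩
        exact disjoint_left.1 hAB (hCA h) hxB
      have h3 := eq_empty_of_isCompact_of_isOpen (K := Q ∩ B)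
        (by rw [hQB']; exact hclQc.inter_right hBc) (by rw [hQB]; exact hQ.sdiff hAc)
      have : q ∈ Q ∩ B := ⟨hq, hqB⟩
      rw [h3] at this
      exact this
    rcases hW.closure_component_subset_or h1 h2 hdA hA z with k | k
    · exact key A₁ A₂ h1 h2 hdA hA hi1 k
    · exact key A₂ A₁ h2 h1 hdA.symm (by rw [union_comm, hA]) hi2 k

include hW in
/-- Pull-backs of good pieces are good. -/
theorem component {z : ℂ} (hz : z ∈ F.U') (hfz : F.f z ∈ interior W) (hUU : F.U' ⊆ F.U) :
    F.IsGoodPiece (closure (connectedComponentIn (F.U' ∩ F.f ⁻¹' interior W) z)) where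
  isCompact := (F.proper W hW.subset hW.isCompact).of_isClosed_subset isClosed_closure
    (closure_component_subset hW.isCompact hW.subset)
  subset := (closure_component_subset hW.isCompact hW.subset).trans (inter_subset_left.trans hUU)
  full := hW.closedFull_component hz hfz
  isConnected_interior := by
    rw [interior_closure_component hW.isCompact hW.subset]
    exact isConnected_connectedComponentIn_iff.2 ⟨hz, hfz⟩
  closure_interior := by rw [interior_closure_component hW.isCompact hW.subset]
  critical k hk := hW.critical (k + 1) (by
    rw [Function.iterate_succ_apply']
    exact map_mem_frontier hW.isCompact hW.subset hk)

end IsGoodPiece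

/-! ### Pull-backs along orbits -/

variable (F) in
/-- The orbit `z, …, f^l z` is defined and ends in the interior of `W`. -/
def Reaches (W : Set ℂ) (l : ℕ) (z : ℂ) : Prop :=
  (∀ k < l, F.f^[k] z ∈ F.U') ∧ F.f^[l] z ∈ interior W

theorem dom_subset_range : F.U' ⊆ F.U := subset_closure.trans F.closure_subset

theorem Reaches.mem_dom {W : Set ℂ} {l : ℕ} {z : ℂ} (h : F.Reaches W (l + 1) z) : z ∈ F.U' :=
  h.1 0 (Nat.succ_pos l)

theorem Reaches.map {W : Set ℂ} {l : ℕ} {z : ℂ} (h : F.Reaches W (l + 1) z) :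
    F.Reaches W l (F.f z) :=
  ⟨fun k hk => by
    rw [← Function.iterate_succ_apply]
    exact h.1 (k + 1) (by omega), by
    rw [← Function.iterate_succ_apply]
    exact h.2⟩

theorem Reaches.iterate {W : Set ℂ} {z : ℂ} {k l : ℕ} (h : F.Reaches W (k + l) z) :
    F.Reaches W l (F.f^[k] z) :=
  ⟨fun j hj => by
    rw [← Function.iterate_add_apply]
    exact h.1 _ (by omega), by
    rw [← Function.iterate_add_apply, add_comm]
    exact h.2⟩

section Pullback

variable {W : Set ℂ} (hW : F.IsGoodPiece W)

include hW in
theorem IsGoodPiece.pullback_and_mem : ∀ {l : ℕ} {z : ℂ}, F.Reaches W l z →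
    F.IsGoodPiece (F.pullback W l z) ∧ z ∈ interior (F.pullback W l z)
  | 0, z, h => ⟨hW, h.2⟩
  | l + 1, z, h => by
    obtain ⟨h1, h2⟩ := IsGoodPiece.pullback_and_mem h.map
    refine ⟨h1.component h.mem_dom h2 dom_subset_range, ?_⟩
    rw [QuadraticLike.pullback, interior_closure_component h1.isCompact h1.subset]
    exact mem_connectedComponentIn ⟨h.mem_dom, h2⟩

include hW in
theorem IsGoodPiece.pullback {l : ℕ} {z : ℂ} (h : F.Reaches W l z) :
    F.IsGoodPiece (F.pullback W l z) := (hW.pullback_and_mem h).1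

include hW in
theorem IsGoodPiece.mem_interior_pullback {l : ℕ} {z : ℂ} (h : F.Reaches W l z) :
    z ∈ interior (F.pullback W l z) := (hW.pullback_and_mem h).2

include hW in
theorem IsGoodPiece.pullback_succ_subset {l : ℕ} {z : ℂ} (h : F.Reaches W (l + 1) z) :
    F.pullback W (l + 1) z ⊆ F.U' ∩ F.f ⁻¹' F.pullback W l (F.f z) :=
  closure_component_subset (hW.pullback h.map).isCompact (hW.pullback h.map).subset

include hW in
theorem IsGoodPiece.interior_pullback_succ {l : ℕ} {z : ℂ} (h : F.Reaches W (l + 1) z) :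
    interior (F.pullback W (l + 1) z) =
      connectedComponentIn (F.U' ∩ F.f ⁻¹' interior (F.pullback W l (F.f z))) z :=
  interior_closure_component (hW.pullback h.map).isCompact (hW.pullback h.map).subset

include hW in
theorem IsGoodPiece.iterate_mem_pullback : ∀ {k l : ℕ} {z x : ℂ}, F.Reaches W (k + l) z →
    x ∈ F.pullback W (k + l) z → F.f^[k] x ∈ F.pullback W l (F.f^[k] z)
  | 0, l, z, x, _, hx => by simpa using hx
  | k + 1, l, z, x, h, hx => by
    rw [Nat.add_right_comm] at h hx
    rw [Function.iterate_succ_apply, Function.iterate_succ_apply]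
    exact IsGoodPiece.iterate_mem_pullback h.map (hW.pullback_succ_subset h hx).2

include hW in
theorem IsGoodPiece.iterate_mem_dom {l : ℕ} {z x : ℂ} (h : F.Reaches W l z)
    (hx : x ∈ F.pullback W l z) {k : ℕ} (hk : k < l) : F.f^[k] x ∈ F.U' := by
  obtain ⟨m, rfl⟩ := Nat.exists_eq_add_of_lt hk
  rw [add_assoc] at h hx
  exact (hW.pullback_succ_subset h.iterate (hW.iterate_mem_pullback h hx)).1

include hW in
theorem IsGoodPiece.iterate_mem {l : ℕ} {z x : ℂ} (h : F.Reaches W l z)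
    (hx : x ∈ F.pullback W l z) : F.f^[l] x ∈ W :=
  hW.iterate_mem_pullback (l := 0) h hx

include hW in
theorem IsGoodPiece.iterate_mem_interior : ∀ {l : ℕ} {z x : ℂ}, F.Reaches W l z →
    x ∈ interior (F.pullback W l z) → F.f^[l] x ∈ interior W
  | 0, _, _, _, hx => hx
  | l + 1, z, x, h, hx => by
    rw [hW.interior_pullback_succ h] at hx
    rw [Function.iterate_succ_apply]
    exact IsGoodPiece.iterate_mem_interior h.map (connectedComponentIn_subset _ _ hx).2

include hW in
theorem IsGoodPiece.iterate_mem_frontier : ∀ {l : ℕ} {z x : ℂ}, F.Reaches W l z →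
    x ∈ frontier (F.pullback W l z) → F.f^[l] x ∈ frontier W
  | 0, _, _, _, hx => hx
  | l + 1, z, x, h, hx => by
    have hg := hW.pullback h.map
    rw [Function.iterate_succ_apply]
    exact IsGoodPiece.iterate_mem_frontier h.map (map_mem_frontier hg.isCompact hg.subset hx)

include hW in
/-- Pull-backs of the same length are disjoint or equal. -/
theorem IsGoodPiece.pullback_eq_of_meet : ∀ {l : ℕ} {z₁ z₂ x : ℂ}, F.Reaches W l z₁ →
    F.Reaches W l z₂ → x ∈ F.pullback W l z₁ → x ∈ F.pullback W l z₂ →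
    F.pullback W l z₁ = F.pullback W l z₂
  | 0, _, _, _, _, _, _, _ => rfl
  | l + 1, z₁, z₂, x, h1, h2, hx1, hx2 => by
    have e := IsGoodPiece.pullback_eq_of_meet h1.map h2.map (hW.pullback_succ_subset h1 hx1).2
      (hW.pullback_succ_subset h2 hx2).2
    have m1 := hW.mem_interior_pullback h1.map
    have m2 := hW.mem_interior_pullback h2.map
    have hg := hW.pullback h1.map
    simp only [QuadraticLike.pullback] at hx1 hx2 ⊢
    rw [← e] at hx2 m2 ⊢
    rw [hg.component_eq_of_closure_meet h1.mem_dom m1 h2.mem_dom m2 hx1 hx2]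

include hW in
/-- A connected set whose images follow an orbit into the interior of `W` lies in the pull-back. -/
theorem IsGoodPiece.subset_interior_pullback : ∀ {l : ℕ} {a : ℂ} {S : Set ℂ}, IsPreconnected S →
    a ∈ S → (∀ x ∈ S, F.Reaches W l x) → S ⊆ interior (F.pullback W l a)
  | 0, _, _, _, _, h => fun x hx => (h x hx).2
  | l + 1, a, S, hS, ha, h => by
    have hSU : S ⊆ F.U' := fun x hx => (h x hx).mem_dom
    have hf := IsGoodPiece.subset_interior_pullback (l := l) (a := F.f a)
      (hS.image F.f (F.continuousOn.mono hSU)) (mem_image_of_mem _ ha) (by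
        rintro _ ⟨x, hx, rfl⟩
        exact (h x hx).map)
    rw [hW.interior_pullback_succ (h a ha)]
    exact hS.subset_connectedComponentIn ha fun x hx => ⟨hSU hx, hf (mem_image_of_mem _ hx)⟩

include hW in
/-- A pull-back that does not meet the critical point is univalent. -/
theorem IsGoodPiece.bijOn_interior_pullback : ∀ {l : ℕ} {z : ℂ}, F.Reaches W l z →
    (∀ k m : ℕ, k + (m + 1) = l → (0 : ℂ) ∉ interior (F.pullback W (m + 1) (F.f^[k] z))) →
    BijOn F.f^[l] (interior (F.pullback W l z)) (interior W)
  | 0, z, _, _ => bijOn_id _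
  | l + 1, z, h, h0 => by
    have hg := hW.pullback h.map
    have hm := hW.mem_interior_pullback h.map
    have ih := IsGoodPiece.bijOn_interior_pullback h.map fun k m hkm => by
      rw [← Function.iterate_succ_apply]
      exact h0 (k + 1) m (by omega)
    rw [Function.iterate_succ]
    refine ih.comp ?_
    -- Only pull-backs of positive length are required to miss `0`; the target `W` may contain it.
    -- Here this keeps the critical value out of the next piece, so that this step is injective.
    have h00 := h0 0 l (by omega)
    rw [Function.iterate_zero, id] at h00
    rw [hW.interior_pullback_succ h] at h00 ⊢
    have hv : F.f 0 ∉ F.pullback W l (F.f z) := by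
      refine hg.critical_value.resolve_left fun hv => h00 ?_
      exact hg.zero_mem_component h.mem_dom hm hv
    refine ⟨fun x hx => (connectedComponentIn_subset _ _ hx).2,
      (hg.injOn_component hv).mono subset_closure, ?_⟩
    exact (image_component hg.isCompact hg.subset hg.isConnected_interior h.mem_dom hm).ge

theorem differentiableOn_iterate {S : Set ℂ} (hS : IsOpen S) : ∀ {l : ℕ},
    (∀ x ∈ S, ∀ k < l, F.f^[k] x ∈ F.U') → DifferentiableOn ℂ F.f^[l] S
  | 0, _ => differentiableOn_id
  | l + 1, h => by
    rw [Function.iterate_succ']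
    exact F.differentiableOn.comp (differentiableOn_iterate hS fun x hx k hk => h x hx k (by omega))
      fun x hx => h x hx l (by omega)

end Pullback

end QuadraticLike

namespace QuadraticLike

variable {F : QuadraticLike}

/-! ### First returns to nice pieces -/

variable (F) in
/-- The orbit of a boundary point of `V` never comes back to `V`. -/
def NoReturn (V : Set ℂ) : Prop :=
  ∀ y ∈ frontier V, ∀ s, 0 < s → (∀ k < s, F.f^[k] y ∈ F.U') → F.f^[s] y ∉ V

theorem IsFirstReturn.reaches {V : Set ℂ} {z : ℂ} {l : ℕ} (h : F.IsFirstReturn V z l) :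
    F.Reaches V l z := ⟨h.2.2.1, h.2.2.2.1⟩

theorem IsFirstReturn.eq {V : Set ℂ} {z : ℂ} {l l' : ℕ} (h : F.IsFirstReturn V z l)
    (h' : F.IsFirstReturn V z l') : l = l' := by
  rcases lt_trichotomy l l' with hl | hl | hl
  · exact absurd h.2.2.2.1 (h'.2.2.2.2 l h.2.1 hl)
  · exact hl
  · exact absurd h'.2.2.2.1 (h.2.2.2.2 l' h'.2.1 hl)

namespace NoReturn

variable {V : Set ℂ} (hn : F.NoReturn V) (hV : F.IsGoodPiece V)

include hn hV in
/-- Pull-backs of `V` do not cross the boundary of `V`. -/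
theorem pullback_subset {l : ℕ} {z x : ℂ} (hl : 0 < l) (h : F.Reaches V l z)
    (hx : x ∈ F.pullback V l z) (hxV : x ∈ V) : F.pullback V l z ⊆ interior V :=
  (hV.pullback h).isConnected.isPreconnected.subset_interior_of_disjoint_frontier ⟨x, hx, hxV⟩
    fun y hy hyf => hn y hyf l hl (fun _ hk => hV.iterate_mem_dom h hy hk) (hV.iterate_mem h hy)

include hn hV in
theorem returnPiece_subset {l : ℕ} {z : ℂ} (h : F.IsFirstReturn V z l) :
    F.pullback V l z ⊆ interior V :=
  hn.pullback_subset hV h.2.1 h.reaches (interior_subset (hV.mem_interior_pullback h.reaches))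
    (interior_subset h.1)

include hn hV in
/-- The first return time is constant on a piece of the first return map. -/
theorem iterate_notMem {l k : ℕ} {z x : ℂ} (h : F.IsFirstReturn V z l)
    (hx : x ∈ F.pullback V l z) (hk : 0 < k) (hkl : k < l) : F.f^[k] x ∉ V := by
  obtain ⟨m, rfl⟩ := Nat.exists_eq_add_of_lt hkl
  -- If `f^k x` were in `V`, the pull-back of length `m + 1` around `f^k z` would meet `V` and so
  -- lie in its interior, which makes `k` an earlier return time of `z`.
  have hr : F.Reaches V (k + (m + 1)) z := h.reaches
  intro hxV
  have := hn.pullback_subset hV (Nat.succ_pos m) hr.iterate (hV.iterate_mem_pullback hr hx) hxV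
    (interior_subset (hV.mem_interior_pullback hr.iterate))
  exact h.2.2.2.2 k hk hkl this

include hn hV in
/-- Two pieces of the first return map that meet have the same return time and coincide. -/
theorem eq_of_meet {l₁ l₂ : ℕ} {P₁ P₂ : Set ℂ} {x : ℂ} (h1 : F.IsReturnPiece V P₁ l₁)
    (h2 : F.IsReturnPiece V P₂ l₂) (hx1 : x ∈ P₁) (hx2 : x ∈ P₂) : l₁ = l₂ ∧ P₁ = P₂ := by
  obtain ⟨z₁, hz1, rfl⟩ := h1
  obtain ⟨z₂, hz2, rfl⟩ := h2
  rcases lt_trichotomy l₁ l₂ with hl | rfl | hl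
  · exact absurd (hV.iterate_mem hz1.reaches hx1) (hn.iterate_notMem hV hz2 hx2 hz1.2.1 hl)
  · exact ⟨rfl, hV.pullback_eq_of_meet hz1.reaches hz2.reaches hx1 hx2⟩
  · exact absurd (hV.iterate_mem hz2.reaches hx2) (hn.iterate_notMem hV hz1 hx1 hz2.2.1 hl)

include hn hV in
theorem pairwise_disjoint : (F.returnPieces V).Pairwise Disjoint := by
  rintro P₁ ⟨l₁, h1⟩ P₂ ⟨l₂, h2⟩ hne
  rw [disjoint_left]
  intro x hx1 hx2
  exact hne (hn.eq_of_meet hV h1 h2 hx1 hx2).2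

include hn hV in
theorem isNondegenerateAnnulus {P : Set ℂ} (hP : P ∈ F.returnPieces V) :
    IsNondegenerateAnnulus V P := by
  obtain ⟨l, z, hz, rfl⟩ := hP
  have hg := hV.pullback hz.reaches
  have hsub := hn.returnPiece_subset hV hz
  refine ⟨by rwa [hg.isCompact.isClosed.closure_eq], ?_⟩
  exact isDoublyConnected_diff isOpen_interior (hV.isCompact.isBounded.subset interior_subset)
    hV.isConnected_interior (hV.full.openFull_interior hV.isCompact.isClosed) hg.isCompact
    hg.isConnected hg.full hsub

include hn hV in
/-- The central piece of the first return map is again nice. -/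
theorem pullback {l : ℕ} {z : ℂ} (h : F.IsFirstReturn V z l) :
    F.NoReturn (F.pullback V l z) := by
  intro y hy s hs hyU hys
  have hyP : y ∈ F.pullback V l z := (hV.pullback h.reaches).isCompact.isClosed.frontier_subset hy
  have hyl := hV.iterate_mem_frontier h.reaches hy
  have hysV := hn.returnPiece_subset hV h hys
  -- Before time `l` the orbit avoids `V`; at time `l` it is on the boundary of `V`; after that it
  -- is the orbit of a boundary point of `V`, which does not return.
  rcases lt_trichotomy s l with hsl | rfl | hsl
  · exact hn.iterate_notMem hV h hyP hs hsl (interior_subset hysV)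
  · exact hyl.2 hysV
  · obtain ⟨m, rfl⟩ := Nat.exists_eq_add_of_lt hsl
    refine hn _ hyl (m + 1) (Nat.succ_pos m) (fun k hk => ?_) ?_
    · rw [← Function.iterate_add_apply]
      exact hyU _ (by omega)
    · rw [← Function.iterate_add_apply]
      have : m + 1 + l = l + m + 1 := by omega
      rw [this]
      exact interior_subset hysV

include hn hV in
/-- On a piece of the first return map to the central piece `W = pullback V l₀ 0` of the first
return map to `V`, the map is the square map followed by a univalent map onto `int V`. -/
theorem exists_univalent (hF : F.IsSquareNormalized) {l₀ : ℕ} (h0 : F.IsFirstReturn V 0 l₀)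
    {P : Set ℂ} (hP : P ∈ F.returnPieces (F.pullback V l₀ 0)) :
    ∃ (h : ℂ → ℂ) (Ω : Set ℂ), IsUnivalentOnto h Ω (interior V) ∧
      (fun z : ℂ => z ^ 2) '' P ⊆ Ω ∧
      ∀ l : ℕ, F.IsReturnPiece (F.pullback V l₀ 0) P l → ∀ z ∈ P, F.f^[l] z = h (z ^ 2) := by
  set W := F.pullback V l₀ 0 with hWdef
  have hW : F.IsGoodPiece W := hV.pullback h0.reaches
  have hnW : F.NoReturn W := hn.pullback hV h0
  have hWV : W ⊆ interior V := hn.returnPiece_subset hV h0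
  obtain ⟨l, hPl⟩ := hP
  obtain ⟨z, hz, hPz⟩ := id hPl
  obtain ⟨m, rfl⟩ : ∃ m, l = m + 1 := ⟨l - 1, by have := hz.2.1; omega⟩
  -- From here on the larger piece `V`, not `W`, is pulled back along the orbit of `z`.
  have hzV : F.Reaches V (m + 1) z := ⟨hz.2.2.1, hWV (interior_subset hz.2.2.2.1)⟩
  have hzm := hzV.map
  set R := interior (F.pullback V m (F.f z)) with hR
  have hbij : BijOn F.f^[m] R (interior V) := by
    refine hV.bijOn_interior_pullback hzm fun k j hkj h0mem => ?_
    subst hkj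
    have hr : F.Reaches V (j + 1) (F.f^[k] (F.f z)) := hzm.iterate
    have hend := hV.iterate_mem_interior hr h0mem
    have hdom : ∀ x ∈ F.pullback V (j + 1) (F.f^[k] (F.f z)), ∀ i < j + 1, F.f^[i] x ∈ F.U' :=
      fun x hx i hi => hV.iterate_mem_dom hr hx hi
    -- Time `j + 1` brings `0` back to `interior V`, so it is at least the first return time.
    have hl₀ : l₀ ≤ j + 1 := by
      by_contra hlt
      exact h0.2.2.2.2 (j + 1) (Nat.succ_pos j) (by omega) hend
    obtain ⟨i, hi⟩ := Nat.exists_eq_add_of_le hl₀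
    rw [hi] at hr h0mem hend hdom
    -- After `l₀` steps the pull-back becomes one of length `i` that meets `V` at the image of `0`,
    -- so it is inside `V`. Hence the pull-back itself lies in `interior W`, and `z` visits
    -- `interior W` at time `k + 1`, before its first return.
    have hreach : ∀ x ∈ interior (F.pullback V (l₀ + i) (F.f^[k] (F.f z))), F.Reaches V l₀ x := by
      intro x hx
      refine ⟨fun i' hi' => hdom x (interior_subset hx) i' (by omega), ?_⟩
      rcases Nat.eq_zero_or_pos i with rfl | hipos
      · exact hV.iterate_mem_interior hr hx
      · exact hn.pullback_subset hV hipos hr.iterate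
          (hV.iterate_mem_pullback hr (interior_subset h0mem)) (interior_subset h0.2.2.2.1)
          (hV.iterate_mem_pullback hr (interior_subset hx))
    have hsub := hV.subset_interior_pullback (hV.pullback hr).isConnected_interior.isPreconnected
      h0mem hreach
    have := hsub (hV.mem_interior_pullback hr)
    rw [← Function.iterate_succ_apply] at this
    exact hz.2.2.2.2 (k + 1) (Nat.succ_pos k) (by omega) this
  obtain ⟨H, ⟨hHo, hHc, hHd, hHi, hHim⟩, hfH⟩ := hF
  have hRo : IsOpen R := isOpen_interior
  set Ω : Set ℂ := ((fun z : ℂ => z ^ 2) '' F.U') ∩ H ⁻¹' R with hΩ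
  have hΩo : IsOpen Ω := hHd.continuousOn.isOpen_inter_preimage hHo hRo
  have hRgood := hV.pullback hzm
  have hHΩ : H '' Ω = R := by
    refine Subset.antisymm (image_subset_iff.2 fun u hu => hu.2) fun w hw => ?_
    have : w ∈ F.U := hRgood.subset (interior_subset hw)
    rw [← hHim] at this
    obtain ⟨u, hu, rfl⟩ := this
    exact ⟨u, ⟨hu, hw⟩, rfl⟩
  have hRdom : ∀ x ∈ R, ∀ k < m, F.f^[k] x ∈ F.U' := fun x hx k hk =>
    hV.iterate_mem_dom hzm (interior_subset hx) hk
  have hHopen : ∀ s ⊆ Ω, IsOpen s → IsOpen (H '' s) := by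
    rcases (hHd.analyticOnNhd hHo).is_constant_or_isOpen hHc.isPreconnected with ⟨w, hw⟩ | h
    · exfalso
      obtain ⟨u, hu⟩ := hHc.nonempty
      have hinf := infinite_of_mem_nhds u (hHo.mem_nhds hu)
      refine hinf ((finite_singleton u).subset fun v hv => ?_)
      exact hHi hv hu ((hw v hv).trans (hw u hu).symm)
    · exact fun s hs ho => h s (hs.trans inter_subset_left) ho
  have hΩc : IsConnected Ω := by
    have hRc : IsConnected R := hRgood.isConnected_interior
    refine ⟨?_, ?_⟩
    · obtain ⟨w, hw⟩ := hRc.nonempty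
      rw [← hHΩ] at hw
      obtain ⟨u, hu, -⟩ := hw
      exact ⟨u, hu⟩
    · intro A B hA hB hAB hnA hnB
      have hAo := hHopen (Ω ∩ A) inter_subset_left (hΩo.inter hA)
      have hBo := hHopen (Ω ∩ B) inter_subset_left (hΩo.inter hB)
      obtain ⟨w, hw, ⟨u, hu, hu'⟩, v, hv, hv'⟩ := hRc.isPreconnected _ _ hAo hBo (by
          rw [← hHΩ]
          rintro _ ⟨u, hu, rfl⟩
          rcases hAB hu with h | h
          · exact Or.inl ⟨u, ⟨hu, h⟩, rfl⟩
          · exact Or.inr ⟨u, ⟨hu, h⟩, rfl⟩)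
        (by
          obtain ⟨u, hu⟩ := hnA
          exact ⟨H u, hu.1.2, u, hu, rfl⟩)
        (by
          obtain ⟨u, hu⟩ := hnB
          exact ⟨H u, hu.1.2, u, hu, rfl⟩)
      have huv : u = v := hHi hu.1.1 hv.1.1 (hu'.trans hv'.symm)
      exact ⟨u, hu.1, hu.2, huv ▸ hv.2⟩
  have hPgood : F.IsGoodPiece P := hPz ▸ hW.pullback hz.reaches
  have hPsub : P ⊆ F.U' ∩ F.f ⁻¹' F.pullback W m (F.f z) :=
    hPz ▸ hW.pullback_succ_subset hz.reaches
  -- The closed piece `P` ends in `W`, which lies in the interior of `V`; so even its boundary is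
  -- mapped into the open pull-back of `V`.
  have hfP : F.f '' P ⊆ R := by
    have hzP : z ∈ P := hPz ▸ interior_subset (hW.mem_interior_pullback hz.reaches)
    refine hV.subset_interior_pullback (hPgood.isConnected.isPreconnected.image F.f
      (F.continuousOn.mono fun x hx => (hPsub hx).1)) (mem_image_of_mem _ hzP) ?_
    rintro _ ⟨x, hx, rfl⟩
    refine ⟨fun k hk => hW.iterate_mem_dom hz.reaches.map (hPsub hx).2 hk, hWV ?_⟩
    exact hW.iterate_mem hz.reaches.map (hPsub hx).2
  refine ⟨F.f^[m] ∘ H, Ω, ⟨hΩo, hΩc, ?_, ?_, ?_⟩, ?_, ?_⟩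
  · exact (differentiableOn_iterate hRo hRdom).comp (hHd.mono inter_subset_left) fun u hu => hu.2
  · exact hbij.injOn.comp (hHi.mono inter_subset_left) fun u hu => hu.2
  · rw [image_comp, hHΩ, hbij.image_eq]
  · rintro _ ⟨x, hx, rfl⟩
    refine ⟨⟨x, (hPsub hx).1, rfl⟩, ?_⟩
    rw [mem_preimage, ← hfH x (hPsub hx).1]
    exact hfP (mem_image_of_mem _ hx)
  · intro l' hl' x hx
    obtain ⟨rfl, -⟩ := hnW.eq_of_meet hW hl' hPl hx hx
    rw [Function.iterate_succ_apply, hfH x (hPsub hx).1]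
    rfl

end NoReturn

/-! ### The principal nest -/

/-- If a boundary point of `V^0` returned to `V^0` after `s` steps, then applying `f^(tp)` to both
points would make a boundary point of `Z_i` return to `Z_i` after `s` steps. -/
theorem ExternalStructure.IsNestPiece.isGoodPiece_and_noReturn {X : F.ExternalStructure} {α : ℂ} (hconn : (0 : ℂ) ∈ F.filledJulia)
    (hX : ∀ Z ∈ X.zPieces α, F.IsGoodPiece Z ∧ F.NoReturn Z) {n : ℕ} {V : Set ℂ}
    (h : X.IsNestPiece α n V) : F.IsGoodPiece V ∧ F.NoReturn V := by
  induction h with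
  | zero t Z ht hZ h0 =>
    obtain ⟨hg, hn⟩ := hX Z hZ
    have hr : F.Reaches Z (t * X.rayNumber α) 0 := ⟨fun k _ => hconn k, h0⟩
    refine ⟨hg.pullback hr, fun y hy s hs hyU hys => ?_⟩
    have hyl := hg.iterate_mem_frontier hr hy
    refine hn _ hyl s hs (fun k hk => ?_) ?_
    · rw [← Function.iterate_add_apply]
      -- From time `s` on, the orbit is known to be defined because it starts again in `V^0`.
      by_cases hks : k + t * X.rayNumber α < s
      · exact hyU _ hks
      · obtain ⟨j, hj⟩ := Nat.exists_eq_add_of_le (not_lt.1 hks)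
        rw [hj, add_comm, Function.iterate_add_apply]
        exact hg.iterate_mem_dom hr hys (by omega)
    · rw [← Function.iterate_add_apply, add_comm, Function.iterate_add_apply]
      exact hg.iterate_mem hr hys
  | succ n V l hV hl ih => exact ⟨ih.1.pullback hl.reaches, ih.2.pullback ih.1 hl⟩

/-- Since `ncard` is `0` for infinite sets, this yields the finiteness of the set of landing angles
whenever the nest exists: with `p = 0` the escaping point would be `0` itself, which no `Z_i`
contains. -/
theorem ExternalStructure.IsNestPiece.rayNumber_ne_zero {X : F.ExternalStructure} {α : ℂ} {n : ℕ}
    {V : Set ℂ} (h : X.IsNestPiece α n V) : X.rayNumber α ≠ 0 := by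
  induction h with
  | zero t Z ht hZ h0 =>
    intro hp
    rw [hp, mul_zero] at h0
    exact hZ.2.1 (interior_subset h0)
  | succ n V l hV hl ih => exact ih

/-- The principal nest has only one piece of each level. -/
theorem ExternalStructure.IsNestPiece.eq {X : F.ExternalStructure} {α : ℂ}
    (hX : ∀ Z ∈ X.zPieces α, ∀ Z' ∈ X.zPieces α, ∀ x ∈ interior Z, x ∈ interior Z' → Z = Z')
    {n : ℕ} {V V' : Set ℂ} (h : X.IsNestPiece α n V) (h' : X.IsNestPiece α n V') : V = V' := by
  induction h generalizing V' with
  | zero t Z ht hZ h0 =>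
    cases h' with
    | zero t' Z' ht' hZ' h0' =>
      obtain rfl := ht.unique ht'
      rw [hX Z hZ Z' hZ' _ h0 h0']
  | succ n V l hV hl ih =>
    cases h' with
    | succ _ V' l' hV' hl' =>
      obtain rfl := ih hV'
      rw [hl.eq hl']

/-- If the pieces `Z_i` are good and do not return to themselves from the boundary, the first
return maps to the principal nest have the required properties. -/
theorem principalNest_of_zPieces {X : F.ExternalStructure} {α : ℂ}
    (hconn : (0 : ℂ) ∈ F.filledJulia)
    (hX : X.rayNumber α ≠ 0 → ∀ Z ∈ X.zPieces α, F.IsGoodPiece Z ∧ F.NoReturn Z)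
    (hX' : X.rayNumber α ≠ 0 → ∀ Z ∈ X.zPieces α, ∀ Z' ∈ X.zPieces α, ∀ x ∈ interior Z,
      x ∈ interior Z' → Z = Z') :
    (∀ n : ℕ, 1 ≤ n → ∀ V : Set ℂ, X.IsNestPiece α (n - 1) V →
      (F.returnPieces V).Pairwise Disjoint ∧
      ∀ P ∈ F.returnPieces V, IsNondegenerateAnnulus V P) ∧
    (F.IsSquareNormalized →
      ∀ n : ℕ, 2 ≤ n → ∀ V W : Set ℂ,
        X.IsNestPiece α (n - 2) V → X.IsNestPiece α (n - 1) W →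
        ∀ P ∈ F.returnPieces W, ∃ (h : ℂ → ℂ) (Ω : Set ℂ),
          IsUnivalentOnto h Ω (interior V) ∧ (fun z : ℂ => z ^ 2) '' P ⊆ Ω ∧
          ∀ l : ℕ, F.IsReturnPiece W P l → ∀ z ∈ P, F.f^[l] z = h (z ^ 2)) := by
  refine ⟨fun n _ V hV => ?_, fun hF n hn V W hV hW P hP => ?_⟩
  · obtain ⟨hg, hnr⟩ := hV.isGoodPiece_and_noReturn hconn (hX hV.rayNumber_ne_zero)
    exact ⟨hnr.pairwise_disjoint hg, fun P hP => hnr.isNondegenerateAnnulus hg hP⟩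
  · obtain ⟨m, rfl⟩ := Nat.exists_eq_add_of_le' hn
    have hp := hV.rayNumber_ne_zero
    obtain ⟨hg, hnr⟩ := hV.isGoodPiece_and_noReturn hconn (hX hp)
    rw [show m + 2 - 2 = m by omega] at hV
    rw [show m + 2 - 1 = m + 1 by omega] at hW
    cases hW with
    | succ _ V' l hV' hl =>
      obtain rfl := hV.eq (hX' hp) hV'
      exact hnr.exists_univalent hg hF hl hP

end QuadraticLike

namespace QuadraticLike

variable {F : QuadraticLike}

/-! ### Puzzle pieces of depth one -/

variable (F) in
/-- Coordinates on a neighbourhood of the filled Julia set `K`, outside of `K`: the point of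
external angle `t` (in radians) and potential `s` is `M (s + i t)`; `D` is bounded by the
equipotential of potential `L`, and `Γ` consists of the fixed point `α` and of the rays whose
angles are in `T`. -/
structure IsExternalCoordinate (α : ℂ) (D Γ : Set ℂ) (M : ℂ → ℂ) (L : ℝ) (T : Set ℝ) : Prop where
  pos : 0 < L
  -- The coordinate extends to potential `2 * L` because `f` doubles potentials and the points
  -- inside `E` must have images in its range.
  continuousOn : ContinuousOn M {ζ | 0 < ζ.re ∧ ζ.re < 2 * L}
  isOpen_image : ∀ N ⊆ {ζ : ℂ | 0 < ζ.re ∧ ζ.re < 2 * L}, IsOpen N → IsOpen (M '' N)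
  isCompact_julia : IsCompact F.filledJulia
  disk_eq : D = F.filledJulia ∪ M '' {ζ | 0 < ζ.re ∧ ζ.re < L}
  closure_disk : closure D = F.filledJulia ∪ M '' {ζ | 0 < ζ.re ∧ ζ.re ≤ L}
  isOpen_disk : IsOpen D
  isOpen_big : IsOpen (F.filledJulia ∪ M '' {ζ | 0 < ζ.re ∧ ζ.re < 2 * L})
  isBounded : Bornology.IsBounded D
  notMem_julia : ∀ ζ : ℂ, 0 < ζ.re → ζ.re < 2 * L → M ζ ∉ F.filledJulia
  re_eq : ∀ ζ ζ' : ℂ, 0 < ζ.re → ζ.re < 2 * L → 0 < ζ'.re → ζ'.re < 2 * L → M ζ = M ζ' →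
    ζ.re = ζ'.re ∧ (ζ.im ∈ T ↔ ζ'.im ∈ T)
  rays_eq : Γ = insert α (M '' {ζ | 0 < ζ.re ∧ ζ.re < L ∧ ζ.im ∈ T})
  map_eq : ∀ ζ : ℂ, 0 < ζ.re → ζ.re < L → F.f (M ζ) = M (2 * ζ)
  land : ∀ t ∈ T, Tendsto (fun s : ℝ => M (s + t * Complex.I)) (𝓝[>] 0) (𝓝 α)
  two_mul_mem : ∀ t ∈ T, 2 * t ∈ T
  discrete : ∀ t : ℝ, ∃ ε > 0, ∀ t' ∈ T, |t' - t| < ε → t' = t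
  finite : ∃ T₀ : Set ℝ, T₀.Finite ∧ T₀ ⊆ T ∧ ∀ t ∈ T, ∃ t₀ ∈ T₀, ∀ s : ℝ, 0 < s → s < 2 * L →
    M (s + t * Complex.I) = M (s + t₀ * Complex.I)
  nonempty : T.Nonempty
  closure_subset : closure D ⊆ F.U'
  preimage : ∀ x ∈ F.U', F.f x ∈ closure D → x ∈ D
  mem_julia : α ∈ F.filledJulia
  fixed : F.f α = α

namespace IsExternalCoordinate

variable {α : ℂ} {D Γ : Set ℂ} {M : ℂ → ℂ} {L : ℝ} {T : Set ℝ}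
  (H : F.IsExternalCoordinate α D Γ M L T)

theorem isOpen_strip : IsOpen {ζ : ℂ | 0 < ζ.re ∧ ζ.re < 2 * L} :=
  (isOpen_lt continuous_const Complex.continuous_re).inter
    (isOpen_lt Complex.continuous_re continuous_const)

include H

theorem continuousAt {ζ : ℂ} (h0 : 0 < ζ.re) (h1 : ζ.re < 2 * L) : ContinuousAt M ζ :=
  H.continuousOn.continuousAt (isOpen_strip.mem_nhds ⟨h0, h1⟩)

theorem mem_disk_iff {ζ : ℂ} (h0 : 0 < ζ.re) (h1 : ζ.re < 2 * L) : M ζ ∈ D ↔ ζ.re < L := by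
  have hL := H.pos
  rw [H.disk_eq]
  constructor
  · rintro (h | ⟨ζ', ⟨h0', h1'⟩, he⟩)
    · exact absurd h (H.notMem_julia ζ h0 h1)
    · rw [← (H.re_eq ζ' ζ h0' (by linarith) h0 h1 he).1]; exact h1'
  · exact fun h => Or.inr ⟨ζ, ⟨h0, h⟩, rfl⟩

theorem mem_closure_disk_iff {ζ : ℂ} (h0 : 0 < ζ.re) (h1 : ζ.re < 2 * L) :
    M ζ ∈ closure D ↔ ζ.re ≤ L := by
  have hL := H.pos
  rw [H.closure_disk]
  constructor
  · rintro (h | ⟨ζ', ⟨h0', h1'⟩, he⟩)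
    · exact absurd h (H.notMem_julia ζ h0 h1)
    · rw [← (H.re_eq ζ' ζ h0' (by linarith) h0 h1 he).1]; exact h1'
  · exact fun h => Or.inr ⟨ζ, ⟨h0, h⟩, rfl⟩

theorem mem_rays_iff {ζ : ℂ} (h0 : 0 < ζ.re) (h1 : ζ.re < 2 * L) :
    M ζ ∈ Γ ↔ ζ.re < L ∧ ζ.im ∈ T := by
  have hL := H.pos
  rw [H.rays_eq]
  constructor
  · rintro (h | ⟨ζ', ⟨h0', h1', h2'⟩, he⟩)
    · exact absurd (h ▸ H.mem_julia) (H.notMem_julia ζ h0 h1)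
    · have := H.re_eq ζ' ζ h0' (by linarith) h0 h1 he
      rw [← this.1, ← this.2]; exact ⟨h1', h2'⟩
  · exact fun h => Or.inr ⟨ζ, ⟨h0, h.1, h.2⟩, rfl⟩

theorem julia_subset : F.filledJulia ⊆ D := by rw [H.disk_eq]; exact subset_union_left

theorem alpha_mem_rays : α ∈ Γ := by rw [H.rays_eq]; exact mem_insert _ _

theorem eq_alpha_of_mem_julia {x : ℂ} (hx : x ∈ Γ) (hxK : x ∈ F.filledJulia) : x = α := by
  have hL := H.pos
  rw [H.rays_eq] at hx
  rcases hx with h | ⟨ζ, ⟨h0, h1, -⟩, rfl⟩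
  · exact h
  · exact absurd hxK (H.notMem_julia ζ h0 (by linarith))

/-- A closed ray inside `E`, with its landing point, is compact. -/
theorem isCompact_ray {t : ℝ} (ht : t ∈ T) :
    IsCompact (insert α ((fun s : ℝ => M (s + t * Complex.I)) '' Ioc 0 L)) := by
  have hL := H.pos
  -- Landing says that the ray extends continuously to potential `0` by the value `α`.
  set g : ℝ → ℂ := fun s => if s = 0 then α else M (s + t * Complex.I) with hg
  have hgc : ContinuousOn g (Icc 0 L) := by
    intro s hs
    by_cases h : s = 0
    · subst h
      have h1 : Tendsto g (𝓝[>] 0) (𝓝 (g 0)) := by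
        have : g 0 = α := by simp [hg]
        rw [this]
        refine (H.land t ht).congr' ?_
        filter_upwards [self_mem_nhdsWithin] with s hs
        have : s ≠ 0 := ne_of_gt hs
        simp [hg, this]
      have h2 : ContinuousWithinAt g (insert 0 (Ioi 0)) 0 := continuousWithinAt_insert_self.2 h1
      rw [insert_eq, singleton_union, Ioi_insert] at h2
      exact h2.mono Icc_subset_Ici_self
    · have hs0 : 0 < s := lt_of_le_of_ne hs.1 (Ne.symm h)
      have h1 : ContinuousAt (fun s : ℝ => M (s + t * Complex.I)) s := by
        refine ContinuousAt.comp (g := M) (f := fun s : ℝ => (s : ℂ) + t * Complex.I)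
          (H.continuousAt (by simpa using hs0) ?_) (Continuous.continuousAt (by fun_prop))
        simp
        linarith [hs.2]
      refine (h1.congr_of_eventuallyEq ?_).continuousWithinAt
      filter_upwards [isOpen_ne.mem_nhds h] with s' hs'
      have : s' ≠ 0 := hs'
      simp [hg, this]
  have himg : g '' Icc 0 L = insert α ((fun s : ℝ => M (s + t * Complex.I)) '' Ioc 0 L) := by
    ext x
    constructor
    · rintro ⟨s, hs, rfl⟩
      by_cases h : s = 0
      · left; simp [hg, h]
      · right
        exact ⟨s, ⟨lt_of_le_of_ne hs.1 (Ne.symm h), hs.2⟩, by simp [hg, h]⟩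
    · rintro (rfl | ⟨s, hs, rfl⟩)
      · exact ⟨0, ⟨le_rfl, hL.le⟩, by simp [hg]⟩
      · exact ⟨s, ⟨hs.1.le, hs.2⟩, by simp [hg, hs.1.ne']⟩
  rw [← himg]
  exact isCompact_Icc.image_of_continuousOn hgc

/-- The set `Γ` is cut off at `E` and need not be closed, but inside `D` it coincides with a finite
union of compact rays that include their ends on `E`. -/
theorem isOpen_diff : IsOpen (D \ Γ) := by
  have hL := H.pos
  obtain ⟨T₀, hfin, hsub, hT₀⟩ := H.finite
  have : D \ Γ = D \ ⋃ t ∈ T₀, insert α ((fun s : ℝ => M (s + t * Complex.I)) '' Ioc 0 L) := by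
    ext x
    constructor
    · rintro ⟨hxD, hxΓ⟩
      refine ⟨hxD, fun h => ?_⟩
      simp only [mem_iUnion] at h
      obtain ⟨t, ht, rfl | ⟨s, hs, rfl⟩⟩ := h
      · exact hxΓ H.alpha_mem_rays
      · have h0 : 0 < ((s : ℂ) + t * Complex.I).re := by simpa using hs.1
        have h1 : ((s : ℂ) + t * Complex.I).re < 2 * L := by simp; linarith [hs.2]
        exact hxΓ ((H.mem_rays_iff h0 h1).2 ⟨(H.mem_disk_iff h0 h1).1 hxD, by simpa using hsub ht⟩)
    · rintro ⟨hxD, hx⟩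
      refine ⟨hxD, fun hxΓ => hx ?_⟩
      rw [H.rays_eq] at hxΓ
      simp only [mem_iUnion]
      rcases hxΓ with rfl | ⟨ζ, ⟨h0, h1, h2⟩, rfl⟩
      · obtain ⟨t, ht⟩ := H.nonempty
        obtain ⟨t₀, ht₀, -⟩ := hT₀ t ht
        exact ⟨t₀, ht₀, mem_insert _ _⟩
      · obtain ⟨t₀, ht₀, he⟩ := hT₀ _ h2
        refine ⟨t₀, ht₀, Or.inr ⟨ζ.re, ⟨h0, h1.le⟩, ?_⟩⟩
        have := he ζ.re h0 (by linarith)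
        rw [Complex.re_add_im] at this
        exact this.symm
  rw [this]
  refine H.isOpen_disk.sdiff ?_
  exact (hfin.isCompact_biUnion fun t ht => H.isCompact_ray (hsub ht)).isClosed

end IsExternalCoordinate

end QuadraticLike

/-! ### Geometry of the pieces of depth zero, and niceness of the pieces at `α'`. -/

namespace QuadraticLike

variable {F : QuadraticLike}

namespace IsExternalCoordinate

variable {α : ℂ} {D Γ : Set ℂ} {M : ℂ → ℂ} {L : ℝ} {T : Set ℝ}
  (H : F.IsExternalCoordinate α D Γ M L T)

theorem closure_cell_subset {z : ℂ} : closure (connectedComponentIn (D \ Γ) z) ⊆ closure D :=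
  closure_mono ((connectedComponentIn_subset _ _).trans sdiff_subset)

include H

theorem isCompact_closure : IsCompact (closure D) := H.isBounded.isCompact_closure

theorem isOpen_cell {z : ℂ} : IsOpen (connectedComponentIn (D \ Γ) z) := H.isOpen_diff.connectedComponentIn

/-- The boundary of a component of `D ∖ Γ` misses `D ∖ Γ`. -/
theorem mem_cell_of_mem_closure {x z : ℂ} (hx : x ∈ closure (connectedComponentIn (D \ Γ) z))
    (hxD : x ∈ D \ Γ) : x ∈ connectedComponentIn (D \ Γ) z := by
  obtain ⟨y, hy, hy'⟩ := mem_closure_iff.1 hx _ (H.isOpen_cell (z := x))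
    (mem_connectedComponentIn hxD)
  rw [connectedComponentIn_eq hy', ← connectedComponentIn_eq hy]
  exact mem_connectedComponentIn hxD

/-- The open sector of the angles between `a` and `b`. -/
theorem sector_subset {a b : ℝ} (hab : ∀ t ∈ T, ¬ (a < t ∧ t < b)) {z ζ : ℂ} (h0 : 0 < ζ.re)
    (h1 : ζ.re < L) (ha : a < ζ.im) (hb : ζ.im < b) (hz : M ζ ∈ connectedComponentIn (D \ Γ) z) :
    ∀ ξ : ℂ, 0 < ξ.re → ξ.re < L → a < ξ.im → ξ.im < b →
      M ξ ∈ connectedComponentIn (D \ Γ) z := by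
  have hL := H.pos
  have hconv : Convex ℝ {ξ : ℂ | (0 < ξ.re ∧ ξ.re < L) ∧ (a < ξ.im ∧ ξ.im < b)} := by
    have h1 : Convex ℝ {ξ : ℂ | 0 < ξ.re ∧ ξ.re < L} :=
      (convex_halfSpace_re_gt 0).inter (convex_halfSpace_re_lt L)
    exact h1.inter ((convex_halfSpace_im_gt a).inter (convex_halfSpace_im_lt b))
  have hcon := hconv.isPreconnected.image M (H.continuousOn.mono
    fun ξ hξ => ⟨hξ.1.1, by linarith [hξ.1.2]⟩)
  have hsub : M '' {ξ : ℂ | (0 < ξ.re ∧ ξ.re < L) ∧ (a < ξ.im ∧ ξ.im < b)} ⊆ D \ Γ := by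
    rintro _ ⟨ξ, ⟨⟨h0, h1⟩, h2⟩, rfl⟩
    have h1' : ξ.re < 2 * L := by linarith
    exact ⟨(H.mem_disk_iff h0 h1').2 h1, fun h => hab _ ((H.mem_rays_iff h0 h1').1 h).2 h2⟩
  rw [connectedComponentIn_eq hz]
  intro ξ hξ0 hξ1 hξa hξb
  exact hcon.subset_connectedComponentIn ⟨ζ, ⟨⟨h0, h1⟩, ha, hb⟩, rfl⟩ hsub
    ⟨ξ, ⟨⟨hξ0, hξ1⟩, hξa, hξb⟩, rfl⟩

/-- Every component of `D ∖ Γ` contains points outside of the filled Julia set. -/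
theorem exists_coordinate_mem_cell {z : ℂ} (hz : z ∈ D \ Γ) :
    ∃ ζ : ℂ, 0 < ζ.re ∧ ζ.re < L ∧ ζ.im ∉ T ∧ M ζ ∈ connectedComponentIn (D \ Γ) z := by
  have hL := H.pos
  set C := connectedComponentIn (D \ Γ) z with hC
  have hCs : C ⊆ D \ Γ := connectedComponentIn_subset _ _
  by_contra! hno
  have hCK : C ⊆ F.filledJulia := by
    intro x hx
    have hxD := (hCs hx).1
    rw [H.disk_eq] at hxD
    rcases hxD with h | ⟨ζ, ⟨h0, h1⟩, rfl⟩
    · exact h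
    · have hT : ζ.im ∉ T := fun h =>
        (hCs hx).2 ((H.mem_rays_iff h0 (by linarith)).2 ⟨h1, h⟩)
      exact absurd hx (hno ζ h0 h1 hT)
  have hCo : IsOpen C := H.isOpen_cell
  -- A component contained in the filled Julia set would have its boundary there and in `Γ`, that
  -- is, in the single point `α`.
  have h0 := closedFull_singleton α C hCo (H.isBounded.subset (hCs.trans sdiff_subset))
    (disjoint_singleton_right.2 fun h => (hCs h).2 H.alpha_mem_rays) (by
      intro x hx
      rw [hCo.frontier_eq] at hx
      have hxK : x ∈ F.filledJulia := closure_minimal hCK H.isCompact_julia.isClosed hx.1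
      have hxΓ : x ∈ Γ := by
        by_contra h
        exact hx.2 (H.mem_cell_of_mem_closure hx.1 ⟨H.julia_subset hxK, h⟩)
      exact H.eq_alpha_of_mem_julia hxΓ hxK)
  have : z ∈ C := mem_connectedComponentIn hz
  rw [h0] at this
  exact this

/-- The collar just outside `E` is connected. A hole that misses it has empty boundary; a hole that
meets it contains it, and then the hole together with `closure D` is compact and open. -/
theorem closedFull_closure_disk : ClosedFull (closure D) := by
  have hL := H.pos
  intro Q hQ hb hd hfr
  by_contra hne
  set A : Set ℂ := M '' {ζ | L < ζ.re ∧ ζ.re < 2 * L} with hA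
  set B : Set ℂ := F.filledJulia ∪ M '' {ζ | 0 < ζ.re ∧ ζ.re < 2 * L} with hB
  have hAD : ∀ x ∈ A, x ∉ closure D := by
    rintro _ ⟨ζ, ⟨h0, h1⟩, rfl⟩ h
    exact absurd ((H.mem_closure_disk_iff (hL.trans h0) h1).1 h) (not_le.2 h0)
  have hBDA : B = closure D ∪ A := by
    rw [H.closure_disk, hB, union_assoc, hA, ← image_union]
    congr 2
    ext ζ
    simp only [mem_ofPred_eq, mem_union]
    constructor
    · rintro ⟨h0, h1⟩
      rcases le_or_gt ζ.re L with h | h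
      · exact Or.inl ⟨h0, h⟩
      · exact Or.inr ⟨h, h1⟩
    · rintro (⟨h0, h1⟩ | ⟨h0, h1⟩)
      · exact ⟨h0, by linarith⟩
      · exact ⟨by linarith, h1⟩
  have hAc : IsPreconnected A := by
    have hconv : Convex ℝ {ζ : ℂ | L < ζ.re ∧ ζ.re < 2 * L} :=
      (convex_halfSpace_re_gt L).inter (convex_halfSpace_re_lt (2 * L))
    exact hconv.isPreconnected.image M (H.continuousOn.mono fun ζ hζ => ⟨hL.trans hζ.1, hζ.2⟩)
  have hmeet : (A ∩ Q).Nonempty := by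
    by_contra hAQ
    have hBQ : Disjoint B Q := by
      rw [hBDA, disjoint_union_left]
      exact ⟨hd.symm, disjoint_iff_inter_eq_empty.2 (not_nonempty_iff_eq_empty.1 hAQ)⟩
    have hfe : frontier Q = ∅ := by
      rw [eq_empty_iff_forall_notMem]
      intro x hx
      have hxB : x ∈ B := by rw [hBDA]; exact Or.inl (hfr hx)
      obtain ⟨y, hyB, hyQ⟩ := mem_closure_iff.1 (frontier_subset_closure hx) B H.isOpen_big hxB
      exact disjoint_left.1 hBQ hyB hyQ
    have hQc : closure Q = Q := by rw [closure_eq_self_union_frontier, hfe, union_empty]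
    exact hne (eq_empty_of_isCompact_of_isOpen (hQc ▸ hb.isCompact_closure) hQ)
  have hAQ : A ⊆ Q := (hAc.subset_interior_of_disjoint_frontier hmeet
    fun x hx hxf => hAD x hx (hfr hxf)).trans interior_subset
  have hU : Q ∪ closure D = Q ∪ B := by
    rw [hBDA, union_comm (closure D), ← union_assoc, union_eq_self_of_subset_right hAQ]
  have hU' : Q ∪ closure D = closure Q ∪ closure D := by
    refine Subset.antisymm (union_subset_union_left _ subset_closure) ?_
    rw [closure_eq_self_union_frontier, union_assoc]
    exact union_subset_union_right _ (union_subset hfr Subset.rfl)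
  have := eq_empty_of_isCompact_of_isOpen (K := Q ∪ closure D)
    (hU' ▸ hb.isCompact_closure.union H.isCompact_closure) (hU ▸ hQ.union H.isOpen_big)
  exact hne (union_empty_iff.1 this).1

/-- The rays have empty interior: a point on a ray can be moved to a nearby angle outside the
discrete set `T`, and `α` is a limit of ray points. -/
theorem nonempty_inter_diff {Q : Set ℂ} (hQ : IsOpen Q) (hQD : (Q ∩ D).Nonempty) :
    (Q ∩ (D \ Γ)).Nonempty := by
  have hL := H.pos
  have key : ∀ ζ : ℂ, 0 < ζ.re → ζ.re < L → M ζ ∈ Q → (Q ∩ (D \ Γ)).Nonempty := by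
    intro ζ h0 h1 hζ
    obtain ⟨ε, hε, hT⟩ := H.discrete ζ.im
    have h2 : Tendsto (fun δ : ℝ => M (ζ + δ * Complex.I)) (𝓝[>] 0) (𝓝 (M ζ)) := by
      refine (H.continuousAt h0 (by linarith)).tendsto.comp ?_
      have : Continuous fun δ : ℝ => ζ + δ * Complex.I := by fun_prop
      have h3 := this.tendsto 0
      simp only [Complex.ofReal_zero, zero_mul, add_zero] at h3
      exact h3.mono_left nhdsWithin_le_nhds
    obtain ⟨δ, hδQ, hδ0, hδε⟩ := ((h2.eventually (hQ.mem_nhds hζ)).and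
      (Ioo_mem_nhdsGT hε)).exists
    have hre : (ζ + δ * Complex.I).re = ζ.re := by simp
    have him : (ζ + δ * Complex.I).im = ζ.im + δ := by simp
    refine ⟨_, hδQ, (H.mem_disk_iff (by rw [hre]; exact h0) (by rw [hre]; linarith)).2
      (by rw [hre]; exact h1), fun h => ?_⟩
    have h4 := ((H.mem_rays_iff (by rw [hre]; exact h0) (by rw [hre]; linarith)).1 h).2
    rw [him] at h4
    have h5 := hT _ h4 (by rw [add_sub_cancel_left, abs_of_pos hδ0]; exact hδε)
    linarith
  obtain ⟨x, hxQ, hxD⟩ := hQD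
  by_cases hxΓ : x ∈ Γ
  · rw [H.rays_eq] at hxΓ
    rcases hxΓ with rfl | ⟨ζ, ⟨h0, h1, -⟩, rfl⟩
    · obtain ⟨t, ht⟩ := H.nonempty
      obtain ⟨s, hsQ, hs0, hsL⟩ := (((H.land t ht).eventually (hQ.mem_nhds hxQ)).and
        (Ioo_mem_nhdsGT hL)).exists
      exact key _ (by simpa using hs0) (by simpa using hsL) hsQ
    · exact key ζ h0 h1 hxQ
  · exact ⟨x, hxQ, hxD, hxΓ⟩

/-- The closed puzzle pieces of depth zero do not separate the plane. -/
theorem closedFull_closure_cell (z : ℂ) : ClosedFull (closure (connectedComponentIn (D \ Γ) z)) := by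
  have hL := H.pos
  intro Q hQ hb hd hfr
  by_contra hne
  set C := connectedComponentIn (D \ Γ) z with hC
  have hCs : C ⊆ D \ Γ := connectedComponentIn_subset _ _
  have hCD : closure C ⊆ closure D := closure_cell_subset
  have hQD : Q ⊆ closure D := by
    have hQ1 : IsOpen (Q \ closure D) := hQ.sdiff isClosed_closure
    have h0 := H.closedFull_closure_disk (Q \ closure D) hQ1 (hb.subset sdiff_subset)
      disjoint_sdiff_left (by
        intro x hx
        rw [hQ1.frontier_eq] at hx
        by_contra hxD
        by_cases hxQ : x ∈ Q
        · exact hx.2 ⟨hxQ, hxD⟩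
        · refine hxD (hCD (hfr ?_))
          rw [hQ.frontier_eq]
          exact ⟨closure_mono sdiff_subset hx.1, hxQ⟩)
    exact sdiff_eq_empty.1 h0
  have hQD' : (Q ∩ D).Nonempty := by
    obtain ⟨q, hq⟩ := nonempty_iff_ne_empty.2 hne
    exact mem_closure_iff.1 (hQD hq) Q hQ hq
  obtain ⟨y, hyQ, hyD⟩ := H.nonempty_inter_diff hQ hQD'
  set C₂ := connectedComponentIn (D \ Γ) y with hC₂
  have hCC₂ : Disjoint C₂ C := by
    rw [disjoint_left]
    intro x hx2 hx
    have : y ∈ C := by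
      rw [hC, connectedComponentIn_eq hx, ← connectedComponentIn_eq hx2]
      exact mem_connectedComponentIn hyD
    exact disjoint_left.1 hd hyQ (subset_closure this)
  have hCC₂' : Disjoint C₂ (closure C) := hCC₂.closure_right H.isOpen_cell
  have hC₂Q : C₂ ⊆ Q :=
    (isPreconnected_connectedComponentIn.subset_interior_of_disjoint_frontier (t := Q)
      ⟨y, mem_connectedComponentIn hyD, hyQ⟩
      fun x hx hxf => disjoint_left.1 hCC₂' hx (hfr hxf)).trans interior_subset
  -- The hole contains another cell `C₂`. Following an angle of `C₂` outside `T` out to `E` gives an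
  -- end point away from `closure C`, hence inside the open hole, which therefore extends beyond
  -- `E`, contrary to `Q ⊆ closure D`.
  obtain ⟨ζ, h0, h1, hζT, hζ⟩ := H.exists_coordinate_mem_cell hyD
  obtain ⟨ε, hε, hT⟩ := H.discrete ζ.im
  have hgap : ∀ t ∈ T, ¬ (ζ.im - ε < t ∧ t < ζ.im + ε) := fun t ht h =>
    hζT (hT t ht (abs_lt.2 ⟨by linarith [h.1], by linarith [h.2]⟩) ▸ ht)
  have hsec := H.sector_subset hgap h0 h1 (by linarith) (by linarith) hζ
  -- the end of the ray
  set e : ℝ → ℂ := fun δ => ((L + δ : ℝ) : ℂ) + ζ.im * Complex.I with he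
  have hec : Continuous e := by fun_prop
  have here : ∀ δ, (e δ).re = L + δ := fun δ => by simp [he]
  have heim : ∀ δ, (e δ).im = ζ.im := fun δ => by simp [he]
  have hMe : ContinuousAt (fun δ => M (e δ)) 0 :=
    ContinuousAt.comp (g := M) (f := e)
      (H.continuousAt (by rw [here]; linarith) (by rw [here]; linarith)) hec.continuousAt
  have hecl : M (e 0) ∈ closure Q := by
    refine mem_closure_of_tendsto (hMe.tendsto.mono_left (nhdsWithin_le_nhds (s := Iio 0))) ?_
    filter_upwards [Ioo_mem_nhdsLT (show -L < 0 by linarith)] with δ hδ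
    exact hC₂Q (hsec _ (by rw [here]; linarith [hδ.1]) (by rw [here]; linarith [hδ.2])
      (by rw [heim]; linarith) (by rw [heim]; linarith))
  have henC : M (e 0) ∉ closure C := by
    intro h
    set N : Set ℂ := {ξ | (0 < ξ.re ∧ ξ.re < 2 * L) ∧ (ζ.im - ε < ξ.im ∧ ξ.im < ζ.im + ε)} with hN
    have hNo : IsOpen N := isOpen_strip.inter
      ((isOpen_lt continuous_const Complex.continuous_im).inter
        (isOpen_lt Complex.continuous_im continuous_const))
    obtain ⟨-, ⟨ξ, hξ, rfl⟩, hξC⟩ := mem_closure_iff.1 h (M '' N)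
      (H.isOpen_image N (fun ξ hξ => hξ.1) hNo)
      ⟨e 0, ⟨⟨by rw [here]; linarith, by rw [here]; linarith⟩, by rw [heim]; linarith,
        by rw [heim]; linarith⟩, rfl⟩
    have hξL := (H.mem_disk_iff hξ.1.1 hξ.1.2).1 (hCs hξC).1
    exact disjoint_left.1 hCC₂ (hsec ξ hξ.1.1 hξL hξ.2.1 hξ.2.2) hξC
  have heQ : M (e 0) ∈ Q := by
    rw [closure_eq_self_union_frontier] at hecl
    exact hecl.resolve_right fun h => henC (hfr h)
  obtain ⟨δ, hδQ, hδ0, hδL⟩ := (((hMe.tendsto.mono_left (nhdsWithin_le_nhds (s := Ioi 0))).eventually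
    (hQ.mem_nhds heQ)).and (Ioo_mem_nhdsGT hL)).exists
  have := (H.mem_closure_disk_iff (by rw [here]; linarith) (by rw [here]; linarith)).1 (hQD hδQ)
  rw [here] at this
  linarith

/-- A piece of depth zero that contains a point of a ray in `Γ` contains the whole ray. -/
theorem ray_subset_closure_cell {z : ℂ} {s t : ℝ} (ht : t ∈ T) (hs0 : 0 < s) (hsL : s ≤ L)
    (hs : M (s + t * Complex.I) ∈ closure (connectedComponentIn (D \ Γ) z)) {r : ℝ} (hr0 : 0 < r)
    (hrL : r ≤ L) : M (r + t * Complex.I) ∈ closure (connectedComponentIn (D \ Γ) z) := by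
  have hL := H.pos
  set C := connectedComponentIn (D \ Γ) z with hC
  have hCs : C ⊆ D \ Γ := connectedComponentIn_subset _ _
  obtain ⟨ε, hε, hT⟩ := H.discrete t
  set N : Set ℂ := {ξ | (0 < ξ.re ∧ ξ.re < 2 * L) ∧ (t - ε < ξ.im ∧ ξ.im < t + ε)} with hN
  have hNo : IsOpen N := isOpen_strip.inter
    ((isOpen_lt continuous_const Complex.continuous_im).inter
      (isOpen_lt Complex.continuous_im continuous_const))
  obtain ⟨-, ⟨ξ, hξ, rfl⟩, hξC⟩ := mem_closure_iff.1 hs (M '' N)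
    (H.isOpen_image N (fun ξ hξ => hξ.1) hNo)
    ⟨_, ⟨⟨by simpa using hs0, by simp; linarith⟩, by simpa using hε, by simpa using hε⟩, rfl⟩
  have hξL := (H.mem_disk_iff hξ.1.1 hξ.1.2).1 (hCs hξC).1
  have hξT : ξ.im ∉ T := fun h => (hCs hξC).2 ((H.mem_rays_iff hξ.1.1 hξ.1.2).2 ⟨hξL, h⟩)
  -- approach the ray from the sector containing `ξ`
  have approach : ∀ σ : ℝ, |σ| = 1 →
      (∀ δ ∈ Ioo 0 (min r ε), M (((r - δ : ℝ) : ℂ) + (t + σ * δ : ℝ) * Complex.I) ∈ C) →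
      M (r + t * Complex.I) ∈ closure C := by
    intro σ _ h
    -- The approach also lowers the potential, so that it stays inside `E` when `r = L`.
    set e : ℝ → ℂ := fun δ => ((r - δ : ℝ) : ℂ) + (t + σ * δ : ℝ) * Complex.I with he
    have hec : Continuous e := by fun_prop
    have he0 : e 0 = r + t * Complex.I := by simp [he]
    have hMe : ContinuousAt (fun δ => M (e δ)) 0 := by
      refine ContinuousAt.comp (g := M) (f := e) (H.continuousAt ?_ ?_) hec.continuousAt
      · rw [he0]; simpa using hr0
      · rw [he0]; simp; linarith
    have := hMe.tendsto
    rw [he0] at this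
    refine mem_closure_of_tendsto (this.mono_left (nhdsWithin_le_nhds (s := Ioi 0))) ?_
    filter_upwards [Ioo_mem_nhdsGT (lt_min hr0 hε)] with δ hδ using h δ hδ
  rcases lt_trichotomy ξ.im t with hlt | heq | hgt
  · have hgap : ∀ t' ∈ T, ¬ (t - ε < t' ∧ t' < t) := fun t' ht' h => by
      have := hT t' ht' (abs_lt.2 ⟨by linarith [h.1], by linarith [h.2]⟩)
      linarith [h.2]
    have hsec := H.sector_subset hgap hξ.1.1 hξL hξ.2.1 hlt hξC
    refine approach (-1) (by simp) fun δ hδ => hsec _ ?_ ?_ ?_ ?_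
    · simpa using hδ.2.trans_le (min_le_left _ _)
    · simp; linarith [hδ.1]
    · simp; linarith [hδ.2.trans_le (min_le_right r ε)]
    · simp; linarith [hδ.1]
  · exact absurd (heq ▸ ht) hξT
  · have hgap : ∀ t' ∈ T, ¬ (t < t' ∧ t' < t + ε) := fun t' ht' h => by
      have := hT t' ht' (abs_lt.2 ⟨by linarith [h.1], by linarith [h.2]⟩)
      linarith [h.1]
    have hsec := H.sector_subset hgap hξ.1.1 hξL hgt hξ.2.2 hξC
    refine approach 1 (by simp) fun δ hδ => hsec _ ?_ ?_ ?_ ?_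
    · simpa using hδ.2.trans_le (min_le_left _ _)
    · simp; linarith [hδ.1]
    · simp; linarith [hδ.1]
    · simp; linarith [hδ.2.trans_le (min_le_right r ε)]

theorem mem_rays_of_mem_frontier {x z : ℂ}
    (hx : x ∈ frontier (closure (connectedComponentIn (D \ Γ) z))) (hxD : x ∈ D) : x ∈ Γ := by
  by_contra h
  have hx' := frontier_closure_subset hx
  rw [H.isOpen_cell.frontier_eq] at hx'
  exact hx'.2 (H.mem_cell_of_mem_closure hx'.1 ⟨hxD, h⟩)

/-- The critical orbit lies in the filled Julia set, which meets the boundary of the cell at most in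
`α`, a point the orbit avoids. -/
theorem isGoodPiece_closure_cell (hconn : (0 : ℂ) ∈ F.filledJulia)
    (hland : ∀ k : ℕ, F.f^[k] 0 ≠ α) {z : ℂ} (hz : z ∈ D \ Γ) :
    F.IsGoodPiece (closure (connectedComponentIn (D \ Γ) z)) := by
  have hsub : connectedComponentIn (D \ Γ) z ⊆
      interior (closure (connectedComponentIn (D \ Γ) z)) :=
    interior_maximal subset_closure H.isOpen_cell
  have hcon : IsConnected (connectedComponentIn (D \ Γ) z) :=
    isConnected_connectedComponentIn_iff.2 hz
  refine ⟨H.isCompact_closure.of_isClosed_subset isClosed_closure closure_cell_subset,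
    closure_cell_subset.trans (H.closure_subset.trans dom_subset_range),
    H.closedFull_closure_cell z, hcon.subset_closure hsub interior_subset,
    Subset.antisymm (closure_minimal interior_subset isClosed_closure) (closure_mono hsub), ?_⟩
  intro k hk
  have hK : F.f^[k] 0 ∈ F.filledJulia := fun n => by
    rw [← Function.iterate_add_apply]; exact hconn _
  exact hland k (H.eq_alpha_of_mem_julia (H.mem_rays_of_mem_frontier hk (H.julia_subset hK)) hK)

/-- A piece of depth one that contains the other preimage of `α` but not the critical point does
not meet the rays landing at `α`. -/
theorem disjoint_rays {z z' α' : ℂ} (hconn : (0 : ℂ) ∈ F.filledJulia)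
    (hland : ∀ k : ℕ, F.f^[k] 0 ≠ α) (hz : z ∈ D \ Γ) (hz' : z' ∈ F.U')
    (hfz' : F.f z' ∈ interior (closure (connectedComponentIn (D \ Γ) z)))
    (h0 : (0 : ℂ) ∉ closure (connectedComponentIn
      (F.U' ∩ F.f ⁻¹' interior (closure (connectedComponentIn (D \ Γ) z))) z'))
    (hα' : α' ∈ closure (connectedComponentIn
      (F.U' ∩ F.f ⁻¹' interior (closure (connectedComponentIn (D \ Γ) z))) z'))
    (hfα' : F.f α' = α) (hne : α' ≠ α) :
    ∀ x ∈ Γ, x ∉ closure (connectedComponentIn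
      (F.U' ∩ F.f ⁻¹' interior (closure (connectedComponentIn (D \ Γ) z))) z') := by
  have hL := H.pos
  have hg := H.isGoodPiece_closure_cell hconn hland hz
  set Y := closure (connectedComponentIn (D \ Γ) z) with hY
  have hf0 : F.f 0 ∉ Y := hg.critical_value.resolve_left fun h =>
    h0 (subset_closure (hg.zero_mem_component hz' hfz' h))
  obtain ⟨A₁, A₂, h1, h2, hd, hA, hi1, hi2⟩ := F.exists_split hg.isCompact hg.subset hg.full hf0
  have key : ∀ A B : Set ℂ, IsClosed A → IsClosed B → Disjoint A B → A ∪ B = F.U' ∩ F.f ⁻¹' Y →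
      InjOn F.f A → closure (connectedComponentIn (F.U' ∩ F.f ⁻¹' interior Y) z') ⊆ A →
      ∀ x ∈ Γ, x ∉ closure (connectedComponentIn (F.U' ∩ F.f ⁻¹' interior Y) z') := by
    intro A B hAc hBc hAB hABY hAi hCA x hx hxC
    have hα'A := hCA hα'
    -- `α` and `α'` have the same image, so they cannot share a sheet.
    have hαA : α ∉ A := fun h => hne (hAi hα'A h (hfα'.trans H.fixed.symm))
    have hxA := hCA hxC
    rw [H.rays_eq] at hx
    rcases hx with rfl | ⟨ζ, ⟨hζ0, hζ1, hζT⟩, rfl⟩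
    · exact hαA hxA
    -- The image of the ray point is in `Y`, so `Y` contains the doubled ray up to `E`, and `α`. The
    -- ray segment from the point down to `α` is then a connected set lying over `Y`, hence in one
    -- sheet.
    · have hfx : M (2 * ζ) ∈ Y := by
        rw [← H.map_eq ζ hζ0 hζ1]
        exact (closure_component_subset hg.isCompact hg.subset hxC).2
      have h2re : (2 * ζ).re = 2 * ζ.re := by simp
      have h2im : (2 * ζ).im = 2 * ζ.im := by simp
      have h2L : 2 * ζ.re ≤ L := by
        rw [← h2re]
        exact (H.mem_closure_disk_iff (by rw [h2re]; linarith) (by rw [h2re]; linarith)).1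
          (closure_cell_subset hfx)
      have h2T := H.two_mul_mem _ hζT
      have hray : ∀ r : ℝ, 0 < r → r ≤ L → M (r + (2 * ζ.im : ℝ) * Complex.I) ∈ Y := by
        intro r hr0 hrL
        refine H.ray_subset_closure_cell h2T (s := 2 * ζ.re) (by linarith) h2L ?_ hr0 hrL
        have : ((2 * ζ.re : ℝ) : ℂ) + (2 * ζ.im : ℝ) * Complex.I = 2 * ζ := by
          rw [← h2re, ← h2im, Complex.re_add_im]
        rwa [this]
      have hαY : α ∈ Y := by
        refine isClosed_closure.mem_of_tendsto (H.land _ h2T) ?_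
        filter_upwards [Ioo_mem_nhdsGT hL] with s hs using hray s hs.1 hs.2.le
      set R : Set ℂ := (fun s : ℝ => M (s + ζ.im * Complex.I)) '' Ioc 0 ζ.re with hR
      have hRc : IsPreconnected R := by
        refine isPreconnected_Ioc.image _ fun s hs => ContinuousAt.continuousWithinAt ?_
        refine ContinuousAt.comp (g := M) (f := fun s : ℝ => (s : ℂ) + ζ.im * Complex.I)
          (H.continuousAt (by simpa using hs.1) ?_) (Continuous.continuousAt (by fun_prop))
        simp; linarith [hs.2]
      have hαR : α ∈ closure R := by
        refine mem_closure_of_tendsto (H.land _ hζT) ?_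
        filter_upwards [Ioo_mem_nhdsGT hζ0] with s hs
        exact ⟨s, ⟨hs.1, hs.2.le⟩, rfl⟩
      have hRc' : IsPreconnected (insert α R) :=
        hRc.subset_closure (subset_insert _ _) (insert_subset hαR subset_closure)
      have hRsub : insert α R ⊆ A ∪ B := by
        rw [hABY]
        rintro y (rfl | ⟨s, hs, rfl⟩)
        · exact ⟨H.closure_subset (subset_closure (H.julia_subset H.mem_julia)),
            by rw [mem_preimage, H.fixed]; exact hαY⟩
        · have hs1 : 0 < ((s : ℂ) + ζ.im * Complex.I).re := by simpa using hs.1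
          have hs2 : ((s : ℂ) + ζ.im * Complex.I).re < L := by simp; linarith [hs.2]
          refine ⟨H.closure_subset (subset_closure ((H.mem_disk_iff hs1 (by linarith)).2 hs2)), ?_⟩
          simp only [mem_preimage]
          rw [H.map_eq _ hs1 hs2]
          have : (2 : ℂ) * (s + ζ.im * Complex.I) =
              ((2 * s : ℝ) : ℂ) + (2 * ζ.im : ℝ) * Complex.I := by push_cast; ring
          rw [this]
          exact hray _ (by linarith [hs.1]) (by linarith [hs.2])
      have hMR : M ζ ∈ insert α R := Or.inr ⟨ζ.re, ⟨hζ0, le_rfl⟩, by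
        simp only [Complex.re_add_im]⟩
      rcases isPreconnected_iff_subset_of_disjoint_closed.1 hRc' A B hAc hBc hRsub
        (by rw [hAB.inter_eq, inter_empty]) with h | h
      · exact hαA (h (mem_insert _ _))
      · exact disjoint_left.1 hAB hxA (h hMR)
  rcases hg.closure_component_subset_or h1 h2 hd hA z' with k | k
  · exact key A₁ A₂ h1 h2 hd hA hi1 k
  · exact key A₂ A₁ h2 h1 hd.symm (by rw [union_comm, hA]) hi2 k

/-- The condition on the image is needed because `Γ` stops at `E`, while the outer part of a ray is
mapped across `E`. -/
theorem map_mem_rays {x : ℂ} (hx : x ∈ Γ) (hfx : F.f x ∈ D) : F.f x ∈ Γ := by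
  have hL := H.pos
  rw [H.rays_eq] at hx
  rcases hx with rfl | ⟨ζ, ⟨h0, h1, h2⟩, rfl⟩
  · rw [H.fixed]; exact H.alpha_mem_rays
  · rw [H.map_eq ζ h0 h1] at hfx ⊢
    have h2re : (2 * ζ).re = 2 * ζ.re := by simp
    have h2im : (2 * ζ).im = 2 * ζ.im := by simp
    have h3 : 0 < (2 * ζ).re := by rw [h2re]; linarith
    have h4 : (2 * ζ).re < 2 * L := by rw [h2re]; linarith
    exact (H.mem_rays_iff h3 h4).2 ⟨(H.mem_disk_iff h3 h4).1 hfx, h2im ▸ H.two_mul_mem _ h2⟩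

theorem iterate_mem_disk : ∀ {s : ℕ} {x : ℂ}, (∀ k < s, F.f^[k] x ∈ F.U') → F.f^[s] x ∈ D → x ∈ D
  | 0, _, _, h => h
  | s + 1, x, hU, h => H.preimage x (hU 0 (Nat.succ_pos s)) (subset_closure
      (iterate_mem_disk (s := s) (fun k hk => by
        rw [← Function.iterate_succ_apply]; exact hU (k + 1) (by omega)) h))

theorem iterate_mem_rays : ∀ {s : ℕ} {x : ℂ}, x ∈ Γ → (∀ k < s, F.f^[k] x ∈ F.U') →
    F.f^[s] x ∈ D → F.f^[s] x ∈ Γ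
  | 0, _, hx, _, _ => hx
  | s + 1, x, hx, hU, h => by
    have hU' : ∀ k < s, F.f^[k] (F.f x) ∈ F.U' := fun k hk => by
      rw [← Function.iterate_succ_apply]; exact hU (k + 1) (by omega)
    exact iterate_mem_rays (s := s) (H.map_mem_rays hx (H.iterate_mem_disk hU' h)) hU' h

/-- Boundary points of a piece of depth one that misses the rays landing at `α` never return to
this piece. -/
theorem noReturn {z z' : ℂ} (hg : F.IsGoodPiece (closure (connectedComponentIn (D \ Γ) z)))
    (hdis : ∀ x ∈ Γ, x ∉ closure (connectedComponentIn
      (F.U' ∩ F.f ⁻¹' interior (closure (connectedComponentIn (D \ Γ) z))) z')) :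
    F.NoReturn (closure (connectedComponentIn
      (F.U' ∩ F.f ⁻¹' interior (closure (connectedComponentIn (D \ Γ) z))) z')) := by
  intro u hu s hs hU hus
  have hZD : closure (connectedComponentIn
      (F.U' ∩ F.f ⁻¹' interior (closure (connectedComponentIn (D \ Γ) z))) z') ⊆ D := fun x hx => by
    have := closure_component_subset hg.isCompact hg.subset hx
    exact H.preimage x this.1 (closure_cell_subset this.2)
  obtain ⟨s, rfl⟩ : ∃ m, s = m + 1 := ⟨s - 1, by omega⟩
  have hfu := map_mem_frontier hg.isCompact hg.subset hu
  have hU' : ∀ k < s, F.f^[k] (F.f u) ∈ F.U' := fun k hk => by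
    rw [← Function.iterate_succ_apply]; exact hU (k + 1) (by omega)
  rw [Function.iterate_succ_apply] at hus
  -- A return forces `f u` to be strictly inside `E`, by backward invariance of `D`. A boundary
  -- point of a piece of depth zero inside `E` lies on `Γ`, and its later images in `D` stay on `Γ`.
  have hfuD := H.iterate_mem_disk hU' (hZD hus)
  have hfuΓ := H.mem_rays_of_mem_frontier hfu hfuD
  exact hdis _ (H.iterate_mem_rays hfuΓ hU' (hZD hus)) hus

theorem cell_eq_of_meet {z₁ z₂ x : ℂ}
    (h1 : x ∈ interior (closure (connectedComponentIn (D \ Γ) z₁)))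
    (h2 : x ∈ interior (closure (connectedComponentIn (D \ Γ) z₂))) :
    connectedComponentIn (D \ Γ) z₁ = connectedComponentIn (D \ Γ) z₂ := by
  obtain ⟨y, hy, hy1⟩ := mem_closure_iff.1 (interior_subset h1) _
    (isOpen_interior.inter isOpen_interior) ⟨h1, h2⟩
  obtain ⟨w, hw1, hw2⟩ := mem_closure_iff.1 (interior_subset hy.2) _
    (H.isOpen_cell (z := z₁)) hy1
  rw [connectedComponentIn_eq hw1, connectedComponentIn_eq hw2]

end IsExternalCoordinate

end QuadraticLike

/-! ### The basin of infinity of a quadratic polynomial -/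

theorem isOpen_image_of_injOn {g : ℂ → ℂ} {S : Set ℂ} (hS : IsOpen S)
    (hg : DifferentiableOn ℂ g S) (hi : InjOn g S) {N : Set ℂ} (hN : IsOpen N) (hNS : N ⊆ S) :
    IsOpen (g '' N) := by
  rw [isOpen_iff_mem_nhds]
  rintro _ ⟨z, hz, rfl⟩
  have hzS := hS.mem_nhds (hNS hz)
  rcases (hg.analyticAt hzS).eventually_constant_or_nhds_le_map_nhds with h | h
  · exfalso
    have hinf := infinite_of_mem_nhds z (inter_mem h hzS)
    exact hinf ((finite_singleton z).subset fun w hw => hi hw.2 (hNS hz) hw.1)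
  · exact h (image_mem_map (hN.mem_nhds hz))

section Quadratic

variable {c : ℂ}

theorem norm_quad_ge {z : ℂ} (hz : 2 + ‖c‖ ≤ ‖z‖) : 2 * ‖z‖ ≤ ‖z ^ 2 + c‖ := by
  have h1 : ‖z ^ 2‖ ≤ ‖z ^ 2 + c‖ + ‖c‖ := by
    have := norm_sub_le (z ^ 2 + c) c
    rwa [add_sub_cancel_right] at this
  rw [norm_pow] at h1
  nlinarith [norm_nonneg c, norm_nonneg z]

theorem norm_iterate_quad_ge {z : ℂ} (hz : 2 + ‖c‖ ≤ ‖z‖) (n : ℕ) :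
    2 ^ n * ‖z‖ ≤ ‖(fun w : ℂ => w ^ 2 + c)^[n] z‖ := by
  induction n with
  | zero => simp
  | succ n ih =>
    rw [Function.iterate_succ_apply']
    have h1 : (1 : ℝ) ≤ 2 ^ n := one_le_pow₀ (by norm_num)
    have h2 : ‖z‖ ≤ 2 ^ n * ‖z‖ := le_mul_of_one_le_left (norm_nonneg z) h1
    have h3 := norm_quad_ge (c := c) (hz.trans (h2.trans ih))
    calc (2 : ℝ) ^ (n + 1) * ‖z‖ = 2 * (2 ^ n * ‖z‖) := by ring
      _ ≤ 2 * ‖(fun w : ℂ => w ^ 2 + c)^[n] z‖ := by linarith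
      _ ≤ _ := h3

theorem notMem_quadFilledJulia_of_le {z : ℂ} (hz : 2 + ‖c‖ ≤ ‖z‖) : z ∉ quadFilledJulia c := by
  rw [quadFilledJulia, mem_ofPred_eq, not_not, ← tendsto_norm_atTop_iff_cobounded]
  refine tendsto_atTop_mono (norm_iterate_quad_ge hz) ?_
  refine (tendsto_pow_atTop_atTop_of_one_lt one_lt_two).atTop_mul_const ?_
  linarith [norm_nonneg c]

theorem quad_mem_quadFilledJulia_iff {z : ℂ} :
    z ^ 2 + c ∈ quadFilledJulia c ↔ z ∈ quadFilledJulia c := by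
  simp only [quadFilledJulia, mem_ofPred_eq]
  rw [not_iff_not, ← tendsto_add_atTop_iff_nat (f := fun n : ℕ =>
    (fun w : ℂ => w ^ 2 + c)^[n] z) 1]
  simp only [Function.iterate_succ_apply]

theorem iterate_mem_quadFilledJulia_iff {z : ℂ} (n : ℕ) :
    (fun w : ℂ => w ^ 2 + c)^[n] z ∈ quadFilledJulia c ↔ z ∈ quadFilledJulia c := by
  induction n with
  | zero => rfl
  | succ n ih => rw [Function.iterate_succ_apply', quad_mem_quadFilledJulia_iff, ih]

theorem neg_mem_quadFilledJulia_iff {z : ℂ} : -z ∈ quadFilledJulia c ↔ z ∈ quadFilledJulia c := by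
  rw [← quad_mem_quadFilledJulia_iff, neg_sq, quad_mem_quadFilledJulia_iff]

theorem exists_lt_norm_iterate {z : ℂ} (hz : z ∉ quadFilledJulia c) (R : ℝ) :
    ∃ n : ℕ, R < ‖(fun w : ℂ => w ^ 2 + c)^[n] z‖ := by
  rw [quadFilledJulia, mem_ofPred_eq, not_not, ← tendsto_norm_atTop_iff_cobounded] at hz
  exact (hz.eventually_gt_atTop R).exists

theorem continuous_iterate_quad (n : ℕ) : Continuous (fun w : ℂ => w ^ 2 + c)^[n] :=
  Continuous.iterate (by fun_prop) n

theorem isOpen_compl_quadFilledJulia : IsOpen (quadFilledJulia c)ᶜ := by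
  rw [isOpen_iff_mem_nhds]
  intro z hz
  obtain ⟨n, hn⟩ := exists_lt_norm_iterate hz (2 + ‖c‖)
  filter_upwards [(isOpen_lt continuous_const (continuous_iterate_quad n).norm).mem_nhds hn]
    with w hw
  rw [mem_compl_iff, ← iterate_mem_quadFilledJulia_iff n]
  exact notMem_quadFilledJulia_of_le (le_of_lt hw)

theorem isBounded_quadFilledJulia : Bornology.IsBounded (quadFilledJulia c) := by
  refine (Metric.isBounded_ball (x := (0 : ℂ)) (r := 2 + ‖c‖)).subset fun z hz => ?_
  rw [mem_ball_zero_iff]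
  by_contra h
  exact notMem_quadFilledJulia_of_le (not_lt.1 h) hz

theorem isCompact_quadFilledJulia : IsCompact (quadFilledJulia c) :=
  Metric.isCompact_of_isClosed_isBounded (isOpen_compl_iff.1 isOpen_compl_quadFilledJulia)
    isBounded_quadFilledJulia

end Quadratic

/-! ### The Böttcher function, its inverse and its equipotential disks. -/

namespace IsBoettcher

variable {c : ℂ} {B : ℂ → ℂ} (hB : IsBoettcher c B)

include hB

theorem one_lt_norm {z : ℂ} (hz : z ∉ quadFilledJulia c) : 1 < ‖B z‖ := hB.bijOn.mapsTo hz

theorem iterate {z : ℂ} (hz : z ∉ quadFilledJulia c) (n : ℕ) :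
    B ((fun w : ℂ => w ^ 2 + c)^[n] z) = B z ^ 2 ^ n := by
  induction n with
  | zero => simp
  | succ n ih =>
    rw [Function.iterate_succ_apply',
      hB.map_sq _ (mt (iterate_mem_quadFilledJulia_iff n).1 hz), ih, ← pow_mul, pow_succ]

theorem isOpen_image {N : Set ℂ} (hN : IsOpen N) (hNK : N ⊆ (quadFilledJulia c)ᶜ) :
    IsOpen (B '' N) :=
  isOpen_image_of_injOn isOpen_compl_quadFilledJulia hB.differentiableOn hB.bijOn.injOn hN hNK

end IsBoettcher

/-- The inverse of a Böttcher function. -/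
noncomputable def boettcherInv (c : ℂ) (B : ℂ → ℂ) : ℂ → ℂ :=
  Function.invFunOn B (quadFilledJulia c)ᶜ

namespace IsBoettcher

variable {c : ℂ} {B : ℂ → ℂ} (hB : IsBoettcher c B)

include hB

theorem inv_notMem {w : ℂ} (hw : 1 < ‖w‖) : boettcherInv c B w ∉ quadFilledJulia c :=
  Function.invFunOn_mem (hB.bijOn.surjOn hw)

theorem apply_inv {w : ℂ} (hw : 1 < ‖w‖) : B (boettcherInv c B w) = w :=
  Function.invFunOn_eq (hB.bijOn.surjOn hw)

theorem inv_apply {z : ℂ} (hz : z ∉ quadFilledJulia c) : boettcherInv c B (B z) = z :=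
  hB.bijOn.injOn (hB.inv_notMem (hB.one_lt_norm hz)) hz (hB.apply_inv (hB.one_lt_norm hz))

theorem inv_sq {w : ℂ} (hw : 1 < ‖w‖) :
    boettcherInv c B (w ^ 2) = boettcherInv c B w ^ 2 + c := by
  have h := hB.inv_notMem hw
  rw [← hB.inv_apply (mt quad_mem_quadFilledJulia_iff.1 h), hB.map_sq _ h, hB.apply_inv hw]

theorem continuousOn_inv : ContinuousOn (boettcherInv c B) {w | 1 < ‖w‖} := by
  intro w hw
  refine ContinuousAt.continuousWithinAt fun N hN => ?_
  obtain ⟨N', hN'N, hN'o, hwN'⟩ := mem_nhds_iff.1 hN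
  have ho := hB.isOpen_image (hN'o.inter isOpen_compl_quadFilledJulia) inter_subset_right
  have hmem : w ∈ B '' (N' ∩ (quadFilledJulia c)ᶜ) :=
    ⟨_, ⟨hwN', hB.inv_notMem hw⟩, hB.apply_inv hw⟩
  rw [mem_map]
  refine mem_of_superset (ho.mem_nhds hmem) ?_
  rintro _ ⟨z, ⟨hz, hzK⟩, rfl⟩
  rw [mem_preimage, hB.inv_apply hzK]
  exact hN'N hz

theorem image_inv {N : Set ℂ} (hN : N ⊆ {w | 1 < ‖w‖}) :
    boettcherInv c B '' N = (quadFilledJulia c)ᶜ ∩ B ⁻¹' N := by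
  ext z
  constructor
  · rintro ⟨w, hw, rfl⟩
    exact ⟨hB.inv_notMem (hN hw), by rwa [mem_preimage, hB.apply_inv (hN hw)]⟩
  · rintro ⟨hz, hzN⟩
    exact ⟨B z, hzN, hB.inv_apply hz⟩

theorem isOpen_image_inv {N : Set ℂ} (hNo : IsOpen N) (hN : N ⊆ {w | 1 < ‖w‖}) :
    IsOpen (boettcherInv c B '' N) := by
  rw [hB.image_inv hN]
  exact hB.differentiableOn.continuousOn.isOpen_inter_preimage isOpen_compl_quadFilledJulia hNo

/-- The basin is the image of the right half-plane under the exponential followed by the inverse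
Böttcher function. -/
theorem isPreconnected_basin : IsPreconnected (quadFilledJulia c)ᶜ := by
  have h1 : boettcherInv c B '' (Complex.exp '' {ζ | 0 < ζ.re}) = (quadFilledJulia c)ᶜ := by
    have h2 : Complex.exp '' {ζ | 0 < ζ.re} = {w | 1 < ‖w‖} := by
      ext w
      constructor
      · rintro ⟨ζ, hζ, rfl⟩
        rw [mem_ofPred_eq, Complex.norm_exp]
        exact Real.one_lt_exp_iff.2 hζ
      · intro hw
        have hw0 : w ≠ 0 := by rintro rfl; simp at hw; linarith
        refine ⟨Complex.log w, ?_, Complex.exp_log hw0⟩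
        rw [mem_ofPred_eq, Complex.log_re]
        exact Real.log_pos hw
    rw [h2, hB.image_inv Subset.rfl]
    exact inter_eq_left.2 fun z hz => hB.one_lt_norm hz
  rw [← h1]
  have h3 : IsPreconnected {ζ : ℂ | 0 < ζ.re} := (convex_halfSpace_re_gt 0).isPreconnected
  refine (h3.image _ Complex.continuous_exp.continuousOn).image _ (hB.continuousOn_inv.mono ?_)
  rintro _ ⟨ζ, hζ, rfl⟩
  rw [mem_ofPred_eq, Complex.norm_exp]
  exact Real.one_lt_exp_iff.2 hζ

/-- The Böttcher function is unique. -/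
theorem eq_of_isBoettcher {B' : ℂ → ℂ} (hB' : IsBoettcher c B') {z : ℂ}
    (hz : z ∉ quadFilledJulia c) : B' z = B z := by
  have hne : ∀ z ∈ (quadFilledJulia c)ᶜ, B z ≠ 0 := fun z hz h => by
    have := hB.one_lt_norm hz
    rw [h, norm_zero] at this
    linarith
  -- Along an orbit `q` is squared at each step and tends to `1`, so `|q| = 1`. By the maximum
  -- principle `q` is constant on the connected basin, with value `1` by its limit at infinity.
  set q : ℂ → ℂ := fun z => B' z / B z with hq
  have hqinf : Tendsto q (Bornology.cobounded ℂ) (𝓝 1) := by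
    have h1 := hB'.tangent.div hB.tangent one_ne_zero
    rw [div_one] at h1
    refine h1.congr' ?_
    filter_upwards [Bornology.isBounded_def.1 (Bornology.isBounded_singleton (x := (0 : ℂ)))]
      with z hz
    have hz0 : z ≠ 0 := hz
    exact div_div_div_cancel_right₀ hz0 _ _
  have hnorm : ∀ z ∈ (quadFilledJulia c)ᶜ, ‖q z‖ = 1 := by
    intro z hz
    have h1 : Tendsto (fun n : ℕ => (fun w : ℂ => w ^ 2 + c)^[n] z) atTop
        (Bornology.cobounded ℂ) := by
      by_contra h
      exact hz h
    have h2 : Tendsto (fun n : ℕ => ‖q z‖ ^ 2 ^ n) atTop (𝓝 1) := by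
      have h3 := (hqinf.comp h1).norm
      rw [norm_one] at h3
      refine h3.congr fun n => ?_
      simp only [hq, Function.comp_apply]
      rw [hB'.iterate hz, hB.iterate hz, ← div_pow, norm_pow]
    have h4 : Tendsto (fun n : ℕ => 2 ^ n) atTop atTop :=
      tendsto_pow_atTop_atTop_of_one_lt (one_lt_two (α := ℕ))
    rcases lt_trichotomy ‖q z‖ 1 with h | h | h
    · have := (tendsto_pow_atTop_nhds_zero_of_lt_one (norm_nonneg _) h).comp h4
      exact absurd (tendsto_nhds_unique this h2) zero_ne_one
    · exact h
    · have := (tendsto_pow_atTop_atTop_of_one_lt h).comp h4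
      exact absurd h2 (not_tendsto_nhds_of_tendsto_atTop this 1)
  have hqd : DifferentiableOn ℂ q (quadFilledJulia c)ᶜ :=
    hB'.differentiableOn.div hB.differentiableOn hne
  have hconst : EqOn q (fun _ => q z) (quadFilledJulia c)ᶜ :=
    Complex.eqOn_of_isPreconnected_of_isMaxOn_norm hB.isPreconnected_basin
      isOpen_compl_quadFilledJulia hqd hz fun w hw => by
        simp only [mem_ofPred_eq, Function.comp_apply]
        rw [hnorm w hw, hnorm z hz]
  have h5 : Tendsto q (Bornology.cobounded ℂ) (𝓝 (q z)) := by
    refine tendsto_const_nhds.congr' ?_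
    filter_upwards [Bornology.isBounded_def.1 (isBounded_quadFilledJulia (c := c))] with w hw
    exact (hconst hw).symm
  have h6 := tendsto_nhds_unique h5 hqinf
  exact (div_eq_one_iff_eq (hne z hz)).1 h6

/-- The Böttcher function is bounded on bounded sets. -/
theorem exists_norm_le (R : ℝ) : ∃ m : ℝ, ∀ z ∉ quadFilledJulia c, ‖z‖ ≤ R → ‖B z‖ ≤ m := by
  set R' := max R (2 + ‖c‖)
  have hQ : IsCompact {z : ℂ | R' ≤ ‖z‖ ∧ ‖z‖ ≤ R' ^ 2 + ‖c‖} := by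
    refine Metric.isCompact_of_isClosed_isBounded
      ((isClosed_le continuous_const continuous_norm).inter
        (isClosed_le continuous_norm continuous_const)) ?_
    exact (Metric.isBounded_closedBall (x := (0 : ℂ)) (r := R' ^ 2 + ‖c‖)).subset fun z hz => by
      rw [mem_closedBall_zero_iff]; exact hz.2
  have hQK : {z : ℂ | R' ≤ ‖z‖ ∧ ‖z‖ ≤ R' ^ 2 + ‖c‖} ⊆ (quadFilledJulia c)ᶜ := fun z hz =>
    notMem_quadFilledJulia_of_le ((le_max_right _ _).trans hz.1)
  obtain ⟨m, hm⟩ := hQ.exists_bound_of_continuousOn (hB.differentiableOn.continuousOn.mono hQK)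
  refine ⟨m, fun z hz hzR => ?_⟩
  classical
  have hex := exists_lt_norm_iterate hz R'
  -- The first iterate outside the disk of radius `R'` lies in a compact annulus of the basin, where
  -- `B` is bounded; and `|B z| ≤ |B z| ^ 2 ^ k` since `|B z| > 1`.
  set k := Nat.find hex with hk
  have hk1 : R' < ‖(fun w : ℂ => w ^ 2 + c)^[k] z‖ := Nat.find_spec hex
  have hk0 : k ≠ 0 := fun h => by
    rw [h, Function.iterate_zero, id] at hk1
    exact absurd (hzR.trans (le_max_left _ _)) (not_le.2 hk1)
  obtain ⟨j, hj⟩ := Nat.exists_eq_succ_of_ne_zero hk0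
  have hj1 : ‖(fun w : ℂ => w ^ 2 + c)^[j] z‖ ≤ R' := by
    have := Nat.find_min hex (m := j) (by omega)
    exact not_lt.1 this
  have hk2 : ‖(fun w : ℂ => w ^ 2 + c)^[k] z‖ ≤ R' ^ 2 + ‖c‖ := by
    rw [hj, Function.iterate_succ_apply']
    refine (norm_add_le _ _).trans ?_
    rw [norm_pow]
    have := norm_nonneg ((fun w : ℂ => w ^ 2 + c)^[j] z)
    nlinarith
  have h1 := hm _ ⟨hk1.le, hk2⟩
  rw [hB.iterate hz, norm_pow] at h1
  have h2 := hB.one_lt_norm hz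
  exact (le_self_pow₀ h2.le (by positivity)).trans h1

theorem mem_equipotentialDisk_iff {r : ℝ} {z : ℂ} : z ∈ equipotentialDisk c r ↔
    z ∈ quadFilledJulia c ∨ z ∉ quadFilledJulia c ∧ ‖B z‖ < r := by
  constructor
  · rintro (h | ⟨h, B', hB', h'⟩)
    · exact Or.inl h
    · exact Or.inr ⟨h, by rwa [← hB.eq_of_isBoettcher hB' h]⟩
  · rintro (h | ⟨h, h'⟩)
    · exact Or.inl h
    · exact Or.inr ⟨h, B, hB, h'⟩

/-- Only points of the filled Julia set need care. Near such a point, the points with `‖B‖ ≥ r` lie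
in the image of a compact annulus under the inverse of `B`, a compact set inside the basin. -/
theorem isOpen_equipotentialDisk {r : ℝ} (hr : 1 < r) : IsOpen (equipotentialDisk c r) := by
  rw [isOpen_iff_mem_nhds]
  intro z hz
  by_cases hzK : z ∈ quadFilledJulia c
  · obtain ⟨m, hm⟩ := hB.exists_norm_le (‖z‖ + 1)
    have hA : IsCompact {w : ℂ | r ≤ ‖w‖ ∧ ‖w‖ ≤ m} := by
      refine Metric.isCompact_of_isClosed_isBounded
        ((isClosed_le continuous_const continuous_norm).inter
          (isClosed_le continuous_norm continuous_const)) ?_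
      exact (Metric.isBounded_closedBall (x := (0 : ℂ)) (r := m)).subset fun z hz => by
        rw [mem_closedBall_zero_iff]; exact hz.2
    have hA1 : {w : ℂ | r ≤ ‖w‖ ∧ ‖w‖ ≤ m} ⊆ {w | 1 < ‖w‖} := fun w hw => hr.trans_le hw.1
    have hφA := hA.image_of_continuousOn (hB.continuousOn_inv.mono hA1)
    have hzA : z ∉ boettcherInv c B '' {w : ℂ | r ≤ ‖w‖ ∧ ‖w‖ ≤ m} := by
      rintro ⟨w, hw, rfl⟩
      exact hB.inv_notMem (hA1 hw) hzK
    filter_upwards [hφA.isClosed.isOpen_compl.mem_nhds hzA, Metric.ball_mem_nhds z one_pos]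
      with y hy hy1
    rw [hB.mem_equipotentialDisk_iff]
    by_cases hyK : y ∈ quadFilledJulia c
    · exact Or.inl hyK
    · refine Or.inr ⟨hyK, ?_⟩
      by_contra h
      refine hy ⟨B y, ⟨not_lt.1 h, hm y hyK ?_⟩, hB.inv_apply hyK⟩
      have h1 : ‖y - z‖ < 1 := by simpa [dist_eq_norm] using hy1
      have := norm_add_le (y - z) z
      rw [sub_add_cancel] at this
      linarith
  · have hzr := ((hB.mem_equipotentialDisk_iff.1 hz).resolve_left hzK).2
    have hzn := isOpen_compl_quadFilledJulia.mem_nhds hzK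
    filter_upwards [hzn, (hB.differentiableOn.continuousOn.continuousAt hzn).norm.eventually_lt_const
      hzr] with y hy hyr
    exact hB.mem_equipotentialDisk_iff.2 (Or.inr ⟨hy, hyr⟩)

theorem isClosed_closedEquipotentialDisk {r : ℝ} :
    IsClosed (quadFilledJulia c ∪ {z | z ∉ quadFilledJulia c ∧ ‖B z‖ ≤ r}) := by
  rw [← isOpen_compl_iff]
  have : (quadFilledJulia c ∪ {z | z ∉ quadFilledJulia c ∧ ‖B z‖ ≤ r})ᶜ =
      (quadFilledJulia c)ᶜ ∩ B ⁻¹' {w | r < ‖w‖} := by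
    ext z
    simp only [mem_compl_iff, mem_union, mem_ofPred_eq, not_or, not_and, not_le, mem_inter_iff,
      mem_preimage]
    exact ⟨fun h => ⟨h.1, h.2 h.1⟩, fun h => ⟨h.1, fun _ => h.2⟩⟩
  rw [this]
  exact hB.differentiableOn.continuousOn.isOpen_inter_preimage isOpen_compl_quadFilledJulia
    (isOpen_lt continuous_const continuous_norm)

theorem isBounded_closedEquipotentialDisk {r : ℝ} :
    Bornology.IsBounded (quadFilledJulia c ∪ {z | z ∉ quadFilledJulia c ∧ ‖B z‖ ≤ r}) := by
  refine isBounded_quadFilledJulia.union ?_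
  have h1 : ∀ᶠ z in Bornology.cobounded ℂ, ‖B z / z - 1‖ < 1 / 2 := by
    have := (hB.tangent.sub_const 1).norm
    rw [sub_self, norm_zero] at this
    exact this.eventually_lt_const (by norm_num)
  have h2 : ∀ᶠ z in Bornology.cobounded ℂ, 2 * r < ‖z‖ ∧ 0 < ‖z‖ :=
    (tendsto_norm_cobounded_atTop.eventually_gt_atTop (2 * r)).and
      (tendsto_norm_cobounded_atTop.eventually_gt_atTop 0)
  rw [Bornology.isBounded_def]
  filter_upwards [h1, h2] with z hz1 hz2 hz
  have h3 : (1 : ℝ) / 2 ≤ ‖B z / z‖ := by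
    have := norm_sub_norm_le (1 : ℂ) (1 - B z / z)
    rw [norm_one, sub_sub_cancel, norm_sub_rev] at this
    linarith
  rw [norm_div, le_div_iff₀ hz2.2] at h3
  linarith [hz.2, hz2.1]

theorem isCompact_closedEquipotentialDisk {r : ℝ} :
    IsCompact (quadFilledJulia c ∪ {z | z ∉ quadFilledJulia c ∧ ‖B z‖ ≤ r}) :=
  Metric.isCompact_of_isClosed_isBounded hB.isClosed_closedEquipotentialDisk
    hB.isBounded_closedEquipotentialDisk

theorem closure_equipotentialDisk {r : ℝ} (hr : 1 < r) : closure (equipotentialDisk c r) =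
    quadFilledJulia c ∪ {z | z ∉ quadFilledJulia c ∧ ‖B z‖ ≤ r} := by
  refine Subset.antisymm (closure_minimal (fun z hz => ?_) hB.isClosed_closedEquipotentialDisk) ?_
  · exact (hB.mem_equipotentialDisk_iff.1 hz).imp_right fun h => ⟨h.1, h.2.le⟩
  · rintro z (hz | ⟨hz, hzr⟩)
    · exact subset_closure (Or.inl hz)
    · have h1 := hB.one_lt_norm hz
      have hcont : ContinuousAt (fun s : ℝ => boettcherInv c B (s * B z)) 1 := by
        refine ContinuousAt.comp (g := boettcherInv c B) (f := fun s : ℝ => (s : ℂ) * B z)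
          (hB.continuousOn_inv.continuousAt ((isOpen_lt continuous_const continuous_norm).mem_nhds
            ?_)) (Continuous.continuousAt (by fun_prop))
        simpa using h1
      have h2 := hcont.tendsto
      simp only [Complex.ofReal_one, one_mul, hB.inv_apply hz] at h2
      refine mem_closure_of_tendsto (h2.mono_left (nhdsWithin_le_nhds (s := Iio 1))) ?_
      have h3 : ‖B z‖⁻¹ < 1 := inv_lt_one_of_one_lt₀ h1
      filter_upwards [Ioo_mem_nhdsLT h3] with s hs
      have hs0 : 0 < s := (inv_pos.2 (by linarith)).trans hs.1
      have hn : ‖(s : ℂ) * B z‖ = s * ‖B z‖ := by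
        rw [norm_mul, Complex.norm_real, Real.norm_of_nonneg hs0.le]
      have hs1 : 1 < ‖(s : ℂ) * B z‖ := by
        rw [hn]
        have := hs.1
        rwa [inv_lt_iff_one_lt_mul₀ (by linarith)] at this
      refine hB.mem_equipotentialDisk_iff.2 (Or.inr ⟨hB.inv_notMem hs1, ?_⟩)
      rw [hB.apply_inv hs1, hn]
      nlinarith [hs.2]

end IsBoettcher

/-! ### Logarithmic coordinates: potential plus `i` times angle. -/

theorem norm_polarPoint {r : ℝ} (hr : 0 < r) (θ : ℝ) : ‖polarPoint r θ‖ = r := by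
  have h : (2 * Real.pi * θ * Complex.I : ℂ) = ((2 * Real.pi * θ : ℝ) : ℂ) * Complex.I := by
    push_cast; ring
  rw [polarPoint, h, norm_mul, Complex.norm_exp_ofReal_mul_I, mul_one, Complex.norm_real,
    Real.norm_of_nonneg hr.le]

/-- The exponential in polar coordinates; the angle may be reduced modulo one turn. -/
theorem exp_eq_polarPoint (s t : ℝ) :
    Complex.exp (s + t * Complex.I) = polarPoint (Real.exp s) (Int.fract (t / (2 * Real.pi))) := by
  have hpi : (Real.pi : ℂ) ≠ 0 := by exact_mod_cast Real.pi_ne_zero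
  have h := Int.floor_add_fract (t / (2 * Real.pi))
  have h1 : (t : ℂ) = 2 * Real.pi * (⌊t / (2 * Real.pi)⌋ : ℂ) +
      2 * Real.pi * (Int.fract (t / (2 * Real.pi)) : ℝ) := by
    have h2 : t = 2 * Real.pi * (⌊t / (2 * Real.pi)⌋ + Int.fract (t / (2 * Real.pi))) := by
      rw [h]
      have := Real.pi_ne_zero
      field_simp
    conv_lhs => rw [h2]
    push_cast
    ring
  rw [polarPoint, Complex.exp_add, Complex.ofReal_exp]
  congr 1
  rw [Complex.exp_eq_exp_iff_exists_int]
  refine ⟨⌊t / (2 * Real.pi)⌋, ?_⟩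
  conv_lhs => rw [h1]
  ring

theorem one_lt_norm_exp {ζ : ℂ} (h : 0 < ζ.re) : 1 < ‖Complex.exp ζ‖ := by
  rw [Complex.norm_exp]; exact Real.one_lt_exp_iff.2 h

theorem fract_eq_of_exp_eq {ζ ζ' : ℂ} (h : Complex.exp ζ = Complex.exp ζ') :
    ζ.re = ζ'.re ∧ Int.fract (ζ.im / (2 * Real.pi)) = Int.fract (ζ'.im / (2 * Real.pi)) := by
  obtain ⟨n, hn⟩ := Complex.exp_eq_exp_iff_exists_int.1 h
  have hre := congrArg Complex.re hn
  have him := congrArg Complex.im hn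
  simp at hre him
  refine ⟨hre, ?_⟩
  have : ζ.im / (2 * Real.pi) = ζ'.im / (2 * Real.pi) + n := by
    rw [him]
    have := Real.pi_ne_zero
    field_simp
  rw [this, Int.fract_add_intCast]

namespace IsBoettcher

variable {c : ℂ} {B : ℂ → ℂ} (hB : IsBoettcher c B)

include hB

theorem exists_exp {z : ℂ} (hz : z ∉ quadFilledJulia c) :
    ∃ ζ : ℂ, 0 < ζ.re ∧ ζ.re = Real.log ‖B z‖ ∧ Complex.exp ζ = B z ∧
      boettcherInv c B (Complex.exp ζ) = z := by
  have h1 := hB.one_lt_norm hz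
  have h0 : B z ≠ 0 := fun h => by rw [h, norm_zero] at h1; linarith
  refine ⟨Complex.log (B z), ?_, Complex.log_re _, Complex.exp_log h0, ?_⟩
  · rw [Complex.log_re]; exact Real.log_pos h1
  · rw [Complex.exp_log h0, hB.inv_apply hz]

theorem equipotentialDisk_eq {r : ℝ} (hr : 0 < r) : equipotentialDisk c r = quadFilledJulia c ∪
    (fun ζ => boettcherInv c B (Complex.exp ζ)) '' {ζ | 0 < ζ.re ∧ ζ.re < Real.log r} := by
  ext z
  rw [hB.mem_equipotentialDisk_iff]
  constructor
  · rintro (h | ⟨h, hr'⟩)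
    · exact Or.inl h
    · obtain ⟨ζ, h0, h1, -, h3⟩ := hB.exists_exp h
      refine Or.inr ⟨ζ, ⟨h0, ?_⟩, h3⟩
      rw [h1]
      exact Real.log_lt_log (by linarith [hB.one_lt_norm h]) hr'
  · rintro (h | ⟨ζ, ⟨h0, h1⟩, rfl⟩)
    · exact Or.inl h
    · refine Or.inr ⟨hB.inv_notMem (one_lt_norm_exp h0), ?_⟩
      rw [hB.apply_inv (one_lt_norm_exp h0), Complex.norm_exp]
      exact (Real.lt_log_iff_exp_lt hr).1 h1

theorem closure_equipotentialDisk_eq {r : ℝ} (hr : 1 < r) : closure (equipotentialDisk c r) =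
    quadFilledJulia c ∪
    (fun ζ => boettcherInv c B (Complex.exp ζ)) '' {ζ | 0 < ζ.re ∧ ζ.re ≤ Real.log r} := by
  rw [hB.closure_equipotentialDisk hr]
  ext z
  constructor
  · rintro (h | ⟨h, hr'⟩)
    · exact Or.inl h
    · obtain ⟨ζ, h0, h1, -, h3⟩ := hB.exists_exp h
      refine Or.inr ⟨ζ, ⟨h0, ?_⟩, h3⟩
      rw [h1]
      exact Real.log_le_log (by linarith [hB.one_lt_norm h]) hr'
  · rintro (h | ⟨ζ, ⟨h0, h1⟩, rfl⟩)
    · exact Or.inl h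
    · refine Or.inr ⟨hB.inv_notMem (one_lt_norm_exp h0), ?_⟩
      rw [hB.apply_inv (one_lt_norm_exp h0), Complex.norm_exp]
      exact (Real.le_log_iff_exp_le (by linarith)).1 h1

/-- Landing of rays, in logarithmic coordinates. -/
theorem rayLandsAt_iff {t : ℝ} {a : ℂ} : RayLandsAt c (Int.fract (t / (2 * Real.pi))) a ↔
    Tendsto (fun s : ℝ => boettcherInv c B (Complex.exp (s + t * Complex.I))) (𝓝[>] 0) (𝓝 a) := by
  constructor
  · rintro ⟨B', hB', γ, hγ, hlim⟩
    have h1 : Tendsto Real.exp (𝓝[>] 0) (𝓝[>] 1) := by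
      refine tendsto_nhdsWithin_of_tendsto_nhds_of_eventually_within _ ?_ ?_
      · have := Real.continuous_exp.tendsto 0
        rw [Real.exp_zero] at this
        exact this.mono_left nhdsWithin_le_nhds
      · filter_upwards [self_mem_nhdsWithin] with s hs
        exact Real.one_lt_exp_iff.2 hs
    refine (hlim.comp h1).congr' ?_
    filter_upwards [self_mem_nhdsWithin] with s hs
    obtain ⟨h2, h3⟩ := hγ (Real.exp s) (Real.one_lt_exp_iff.2 hs)
    rw [hB.eq_of_isBoettcher hB' h2] at h3
    rw [Function.comp_apply, exp_eq_polarPoint, ← h3, hB.inv_apply h2]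
  · intro h
    have key : ∀ r : ℝ, 1 < r → polarPoint r (Int.fract (t / (2 * Real.pi))) =
        Complex.exp ((Real.log r : ℝ) + t * Complex.I) := fun r hr => by
      rw [exp_eq_polarPoint, Real.exp_log (by linarith)]
    refine ⟨B, hB, fun r => boettcherInv c B (polarPoint r (Int.fract (t / (2 * Real.pi)))), ?_, ?_⟩
    · intro r hr
      have h1 : 1 < ‖polarPoint r (Int.fract (t / (2 * Real.pi)))‖ := by
        rwa [norm_polarPoint (by linarith)]
      exact ⟨hB.inv_notMem h1, hB.apply_inv h1⟩
    · have h1 : Tendsto Real.log (𝓝[>] 1) (𝓝[>] 0) := by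
        refine tendsto_nhdsWithin_of_tendsto_nhds_of_eventually_within _ ?_ ?_
        · have := (Real.continuousAt_log one_ne_zero).tendsto
          rw [Real.log_one] at this
          exact this.mono_left nhdsWithin_le_nhds
        · filter_upwards [self_mem_nhdsWithin] with s hs
          exact Real.log_pos hs
      refine (h.comp h1).congr' ?_
      filter_upwards [self_mem_nhdsWithin] with r hr
      rw [Function.comp_apply, key r hr]

end IsBoettcher

/-- The angles (in radians) that are congruent to an angle of a finite set are isolated. -/
theorem exists_isolating {A : Set ℝ} (hA : A.Finite) (t : ℝ) :
    ∃ ε > 0, ∀ t' ∈ {t : ℝ | Int.fract (t / (2 * Real.pi)) ∈ A}, |t' - t| < ε → t' = t := by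
  have hpi := Real.pi_pos
  set k := ⌊t / (2 * Real.pi)⌋
  -- An angle at distance less than `1` from `t` differs from it by less than one turn, so its
  -- integer part is within `2` of `k`, which leaves finitely many candidates.
  set S : Set ℝ := (fun p : ℤ × ℝ => 2 * Real.pi * (p.1 + p.2)) '' (Icc (k - 2) (k + 2) ×ˢ A)
  have hS : S.Finite := ((finite_Icc _ _).prod hA).image _
  have hcl : IsOpen (S \ {t})ᶜ := (hS.subset sdiff_subset).isClosed.isOpen_compl
  obtain ⟨ε, hε, hball⟩ := Metric.isOpen_iff.1 hcl t (by simp)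
  refine ⟨min ε 1, lt_min hε one_pos, fun t' ht' hd => ?_⟩
  by_contra hne
  refine hball (a := t') ?_ ⟨⟨(⌊t' / (2 * Real.pi)⌋, Int.fract (t' / (2 * Real.pi))), ⟨?_, ht'⟩, ?_⟩,
    hne⟩
  · rw [Metric.mem_ball, Real.dist_eq]; exact hd.trans_le (min_le_left _ _)
  · have h1 : |t' / (2 * Real.pi) - t / (2 * Real.pi)| < 1 := by
      rw [← sub_div, abs_div, abs_of_pos (by positivity : (0 : ℝ) < 2 * Real.pi),
        div_lt_one (by positivity)]
      have := hd.trans_le (min_le_right ε 1)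
      linarith [Real.pi_gt_three]
    have h2 := abs_lt.1 h1
    have h3 := Int.floor_le (t / (2 * Real.pi))
    have h4 := Int.lt_floor_add_one (t / (2 * Real.pi))
    have h5 := Int.floor_le (t' / (2 * Real.pi))
    have h6 := Int.lt_floor_add_one (t' / (2 * Real.pi))
    constructor
    · have : ((k - 2 : ℤ) : ℝ) < ⌊t' / (2 * Real.pi)⌋ := by push_cast; linarith
      exact (Int.cast_lt.1 this).le
    · have : (⌊t' / (2 * Real.pi)⌋ : ℝ) < ((k + 2 : ℤ) : ℝ) := by push_cast; linarith
      exact (Int.cast_lt.1 this).le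
  · simp only [Int.floor_add_fract]
    field_simp

/-! ### Transport of the Böttcher coordinates to the quadratic-like map. -/

namespace QuadraticLike

namespace ExternalStructure

variable {F : QuadraticLike} (X : F.ExternalStructure)

theorem subset_closure_disk : quadFilledJulia X.c ⊆ closure (equipotentialDisk X.c X.level) :=
  subset_union_left.trans subset_closure

theorem equipotentialDisk_mono {c : ℂ} {r r' : ℝ} (h : r ≤ r') :
    equipotentialDisk c r ⊆ equipotentialDisk c r' :=
  union_subset_union_right _ fun _ ⟨h1, B, hB, h2⟩ => ⟨h1, B, hB, h2.trans_le h⟩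

theorem level_le_sq : X.level ≤ X.level ^ 2 := by nlinarith [X.one_lt_level]

theorem closure_disk_subset_target : closure (equipotentialDisk X.c X.level) ⊆ X.chart.target :=
  (closure_mono (equipotentialDisk_mono X.level_le_sq)).trans X.closure_subset_target

theorem filledJulia_eq : F.filledJulia = X.chart.symm '' quadFilledJulia X.c := by
  rw [← X.image_filledJulia, ← image_comp]
  ext z
  constructor
  · intro hz
    exact ⟨z, hz, X.chart.left_inv (X.subset_source hz)⟩
  · rintro ⟨y, hy, rfl⟩
    rwa [Function.comp_apply, X.chart.left_inv (X.subset_source hy)]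

theorem map_symm {w : ℂ} (hw : w ∈ closure (equipotentialDisk X.c X.level)) :
    F.f (X.chart.symm w) = X.chart.symm (w ^ 2 + X.c) := by
  obtain ⟨h1, h2⟩ := X.mem_dom w hw
  have hwt := X.closure_disk_subset_target hw
  have := X.conj _ h1 (X.chart.map_target hwt) h2
  rw [X.chart.right_inv hwt] at this
  rw [← this, X.chart.left_inv h2]

/-- The points `chart 0` and `-chart 0` have the same image under the polynomial, so they correspond
to points of the fibre of `f 0`, which is `{0}`. -/
theorem chart_zero (hconn : (0 : ℂ) ∈ F.filledJulia) : X.chart 0 = 0 := by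
  have h0 : X.chart 0 ∈ quadFilledJulia X.c := by
    rw [← X.image_filledJulia]; exact mem_image_of_mem _ hconn
  have hn : -X.chart 0 ∈ quadFilledJulia X.c := neg_mem_quadFilledJulia_iff.2 h0
  have e1 := X.map_symm (X.subset_closure_disk h0)
  have e2 := X.map_symm (X.subset_closure_disk hn)
  rw [X.chart.left_inv (X.subset_source hconn)] at e1
  rw [neg_sq, ← e1] at e2
  have h3 := F.eq_zero_of_map_eq (X.mem_dom _ (X.subset_closure_disk hn)).1 e2
  have h4 := X.chart.right_inv (X.subset_target hn)
  rw [h3] at h4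
  exact self_eq_neg.1 h4

/-- The domain inside `E` is backward invariant. -/
theorem mem_disk_of_map_mem (hconn : (0 : ℂ) ∈ F.filledJulia) {B : ℂ → ℂ}
    (hB : IsBoettcher X.c B) {x w : ℂ} (hx : x ∈ F.U')
    (hw : w ∈ closure (equipotentialDisk X.c X.level)) (hfx : F.f x = X.chart.symm w) :
    x ∈ X.disk := by
  have h0D : (0 : ℂ) ∈ X.disk := by
    rw [X.filledJulia_eq] at hconn
    exact image_mono subset_union_left hconn
  -- The preimages `u` and `-u` of `w` give two points of the fibre inside the disk; a preimage
  -- outside it would be a third one. If `u = 0`, the fibre is the critical one.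
  obtain ⟨u, hu⟩ := IsAlgClosed.exists_pow_nat_eq (w - X.c) two_pos
  have hroot : ∀ v : ℂ, v ^ 2 + X.c = w → v ∈ equipotentialDisk X.c X.level := by
    intro v hv
    rw [hB.closure_equipotentialDisk X.one_lt_level] at hw
    rw [hB.mem_equipotentialDisk_iff]
    rcases hw with h | ⟨h, h'⟩
    · left
      rwa [← quad_mem_quadFilledJulia_iff, hv]
    · right
      have hvK : v ∉ quadFilledJulia X.c := by rwa [← quad_mem_quadFilledJulia_iff, hv]
      refine ⟨hvK, ?_⟩
      have h1 := hB.map_sq v hvK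
      rw [hv] at h1
      rw [h1, norm_pow] at h'
      nlinarith [X.one_lt_level, norm_nonneg (B v)]
  have hu1 : u ^ 2 + X.c = w := by rw [hu]; ring
  have hu2 : (-u) ^ 2 + X.c = w := by rw [neg_sq, hu1]
  have m1 := hroot u hu1
  have m2 := hroot (-u) hu2
  have e1 := X.map_symm (subset_closure m1)
  have e2 := X.map_symm (subset_closure m2)
  rw [hu1, ← hfx] at e1
  rw [hu2, ← hfx] at e2
  have d1 := (X.mem_dom _ (subset_closure m1)).1
  have d2 := (X.mem_dom _ (subset_closure m2)).1
  by_cases hu0 : u = 0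
  · have h1 : X.chart.symm u = 0 := by
      have := X.chart.left_inv (X.subset_source hconn)
      rw [hu0]; rwa [X.chart_zero hconn] at this
    rw [h1] at e1
    rw [F.eq_zero_of_map_eq hx e1.symm]
    exact h0D
  · by_contra hxD
    refine F.not_three hx d1 d2 (fun h => hxD (h ▸ mem_image_of_mem _ m1))
      (fun h => hxD (h ▸ mem_image_of_mem _ m2)) (fun h => hu0 ?_) e1 e2
    have := X.chart.symm.injOn (X.closure_disk_subset_target (subset_closure m1))
      (X.closure_disk_subset_target (subset_closure m2)) h
    exact self_eq_neg.1 this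

/-- Böttcher coordinates near the filled Julia set of a quadratic-like map. -/
theorem exists_isExternalCoordinate (hconn : (0 : ℂ) ∈ F.filledJulia) {α : ℂ}
    (hα : X.IsDividingFixedPoint α) (hp : X.rayNumber α ≠ 0) :
    ∃ M L T, F.IsExternalCoordinate α X.disk (X.rays α) M L T := by
  obtain ⟨hαU, hfα, hnt⟩ := hα
  have hfin : (X.angles α).Finite := finite_of_ncard_ne_zero hp
  obtain ⟨θ₀, hθ₀⟩ := hnt.nonempty
  obtain ⟨B, hB, -⟩ := id hθ₀.2
  have hlev := X.one_lt_level
  have hL : 0 < Real.log X.level := Real.log_pos hlev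
  have hL2 : Real.log (X.level ^ 2) = 2 * Real.log X.level := by
    rw [Real.log_pow]; push_cast; rfl
  have hlev2 : 1 < X.level ^ 2 := one_lt_pow₀ hlev two_ne_zero
  have hpi := Real.pi_pos
  set φ : ℂ → ℂ := fun ζ => boettcherInv X.c B (Complex.exp ζ) with hφ
  set M : ℂ → ℂ := fun ζ => X.chart.symm (φ ζ) with hM
  set T : Set ℝ := {t | Int.fract (t / (2 * Real.pi)) ∈ X.angles α} with hT
  have hαJ : α ∈ F.filledJulia := fun n => by
    rw [Function.iterate_fixed hfα]; exact hαU
  have hαs : α ∈ X.chart.source := X.subset_source hαJ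
  have hφB : ∀ ζ : ℂ, 0 < ζ.re → B (φ ζ) = Complex.exp ζ := fun ζ h =>
    hB.apply_inv (one_lt_norm_exp h)
  have hφK : ∀ ζ : ℂ, 0 < ζ.re → φ ζ ∉ quadFilledJulia X.c := fun ζ h =>
    hB.inv_notMem (one_lt_norm_exp h)
  have hφt : ∀ ζ : ℂ, 0 < ζ.re → ζ.re ≤ 2 * Real.log X.level → φ ζ ∈ X.chart.target := by
    intro ζ h0 h1
    apply X.closure_subset_target
    rw [hB.closure_equipotentialDisk_eq hlev2]
    exact Or.inr ⟨ζ, ⟨h0, by rw [hL2]; exact h1⟩, rfl⟩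
  have hφc : ContinuousOn φ {ζ : ℂ | 0 < ζ.re} :=
    hB.continuousOn_inv.comp Complex.continuous_exp.continuousOn fun ζ h => one_lt_norm_exp h
  have himage : ∀ N : Set ℂ, M '' N = X.chart.symm '' (φ '' N) := fun N => image_comp _ _ _
  have hJK := X.filledJulia_eq
  have hcld : closure X.disk = X.chart.symm '' closure (equipotentialDisk X.c X.level) := by
    have hcont := X.chart.symm.continuousOn.mono X.closure_disk_subset_target
    refine Subset.antisymm (closure_minimal (image_mono subset_closure) ?_) hcont.image_closure
    have hcomp : IsCompact (closure (equipotentialDisk X.c X.level)) := by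
      rw [hB.closure_equipotentialDisk hlev]; exact hB.isCompact_closedEquipotentialDisk
    exact (hcomp.image_of_continuousOn hcont).isClosed
  have hlands : ∀ t : ℝ, t ∈ T ↔
      Tendsto (fun s : ℝ => φ (s + t * Complex.I)) (𝓝[>] 0) (𝓝 (X.chart α)) := by
    intro t
    have h1 : t ∈ T ↔ RayLandsAt X.c (Int.fract (t / (2 * Real.pi))) (X.chart α) :=
      ⟨fun h => h.2, fun h => ⟨⟨Int.fract_nonneg _, Int.fract_lt_one _⟩, h⟩⟩
    rw [h1, hB.rayLandsAt_iff]
  have hperiod : ∀ s t : ℝ, φ (s + t * Complex.I) =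
      φ (s + (2 * Real.pi * Int.fract (t / (2 * Real.pi)) : ℝ) * Complex.I) := by
    intro s t
    simp only [hφ]
    rw [exp_eq_polarPoint, exp_eq_polarPoint, mul_div_cancel_left₀ _ (by positivity),
      Int.fract_fract]
  have hfix : X.chart α ^ 2 + X.c = X.chart α := by
    have h1 := X.conj α hαU hαs (by rw [hfα]; exact hαs)
    rw [← h1, hfα]
  have hsq : ∀ ζ : ℂ, 0 < ζ.re → φ (2 * ζ) = φ ζ ^ 2 + X.c := fun ζ h => by
    simp only [hφ]
    rw [← hB.inv_sq (one_lt_norm_exp h), ← Complex.exp_nat_mul]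
    norm_num
  refine ⟨M, Real.log X.level, T, ?_⟩
  refine
    { pos := hL
      continuousOn := ?_
      isOpen_image := ?_
      isCompact_julia := ?_
      disk_eq := ?_
      closure_disk := ?_
      isOpen_disk := ?_
      isOpen_big := ?_
      isBounded := ?_
      notMem_julia := ?_
      re_eq := ?_
      rays_eq := ?_
      map_eq := ?_
      land := ?_
      two_mul_mem := ?_
      discrete := exists_isolating hfin
      finite := ?_
      nonempty := ?_
      closure_subset := ?_
      preimage := ?_
      mem_julia := hαJ
      fixed := hfα }
  · exact X.chart.symm.continuousOn.comp (hφc.mono fun ζ h => h.1) fun ζ h => hφt ζ h.1 h.2.le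
  · intro N hN hNo
    rw [himage]
    refine X.chart.symm.isOpen_image_of_subset_source ?_ ?_
    · have : φ '' N = boettcherInv X.c B '' (Complex.exp '' N) := image_comp _ _ _
      rw [this]
      refine hB.isOpen_image_inv (Complex.isOpenMap_exp N hNo) ?_
      rintro _ ⟨ζ, hζ, rfl⟩
      exact one_lt_norm_exp (hN hζ).1
    · rintro _ ⟨ζ, hζ, rfl⟩
      exact hφt ζ (hN hζ).1 (hN hζ).2.le
  · rw [hJK]
    exact isCompact_quadFilledJulia.image_of_continuousOn
      (X.chart.symm.continuousOn.mono X.subset_target)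
  · rw [disk, hB.equipotentialDisk_eq (by linarith), image_union, hJK, himage]
  · rw [hcld, hB.closure_equipotentialDisk_eq hlev, image_union, hJK, himage]
  · exact X.chart.symm.isOpen_image_of_subset_source (hB.isOpen_equipotentialDisk hlev)
      (subset_closure.trans X.closure_disk_subset_target)
  · rw [hJK, himage, ← hL2, ← image_union, ← hB.equipotentialDisk_eq (by linarith)]
    exact X.chart.symm.isOpen_image_of_subset_source (hB.isOpen_equipotentialDisk hlev2)
      (subset_closure.trans X.closure_subset_target)
  · refine F.isBounded_dom.subset ?_
    rintro _ ⟨w, hw, rfl⟩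
    exact (X.mem_dom w (subset_closure hw)).1
  · intro ζ h0 h1 h
    rw [hJK] at h
    obtain ⟨w, hw, he⟩ := h
    have := X.chart.symm.injOn (X.subset_target hw) (hφt ζ h0 h1.le) he
    exact hφK ζ h0 (this ▸ hw)
  · intro ζ ζ' h0 h1 h0' h1' he
    have h2 := X.chart.symm.injOn (hφt ζ h0 h1.le) (hφt ζ' h0' h1'.le) he
    have h3 : Complex.exp ζ = Complex.exp ζ' := by rw [← hφB ζ h0, h2, hφB ζ' h0']
    obtain ⟨h4, h5⟩ := fract_eq_of_exp_eq h3
    refine ⟨h4, ?_⟩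
    rw [hT, mem_ofPred_eq, mem_ofPred_eq, h5]
  · rw [rays, himage]
    congr 2
    ext z
    constructor
    · rintro ⟨hz, hzr⟩
      simp only [mem_iUnion] at hzr
      obtain ⟨θ, hθ, hzK, B', hB', r, hr, hzr⟩ := hzr
      rw [hB.eq_of_isBoettcher hB' hzK] at hzr
      have hzl := ((hB.mem_equipotentialDisk_iff.1 hz).resolve_left hzK).2
      rw [hzr, norm_polarPoint (by linarith)] at hzl
      have hθ1 : Int.fract (2 * Real.pi * θ / (2 * Real.pi)) = θ := by
        rw [mul_div_cancel_left₀ _ (by positivity)]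
        exact Int.fract_eq_self.2 hθ.1
      refine ⟨(Real.log r : ℝ) + (2 * Real.pi * θ : ℝ) * Complex.I, ⟨?_, ?_, ?_⟩, ?_⟩
      · simpa using Real.log_pos hr
      · simpa using Real.log_lt_log (by linarith) hzl
      · have : ((Real.log r : ℝ) + (2 * Real.pi * θ : ℝ) * Complex.I : ℂ).im = 2 * Real.pi * θ := by
          simp
        rw [this, hT, mem_ofPred_eq, hθ1]
        exact hθ
      · simp only [hφ]
        rw [exp_eq_polarPoint, hθ1, Real.exp_log (by linarith), ← hzr, hB.inv_apply hzK]
    · rintro ⟨ζ, ⟨h0, h1, h2⟩, rfl⟩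
      refine ⟨?_, ?_⟩
      · rw [hB.equipotentialDisk_eq (by linarith)]
        exact Or.inr ⟨ζ, ⟨h0, h1⟩, rfl⟩
      · simp only [mem_iUnion]
        refine ⟨_, h2, hφK ζ h0, B, hB, Real.exp ζ.re, Real.one_lt_exp_iff.2 h0, ?_⟩
        rw [hφB ζ h0, ← exp_eq_polarPoint, Complex.re_add_im]
  · intro ζ h0 h1
    have hmem : φ ζ ∈ closure (equipotentialDisk X.c X.level) := by
      rw [hB.closure_equipotentialDisk_eq hlev]
      exact Or.inr ⟨ζ, ⟨h0, h1.le⟩, rfl⟩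
    simp only [hM]
    rw [X.map_symm hmem, hsq ζ h0]
  · intro t ht
    have h1 := (X.chart.symm.continuousAt (x := X.chart α) (X.chart.map_source hαs)).tendsto
    rw [X.chart.left_inv hαs] at h1
    exact h1.comp ((hlands t).1 ht)
  -- The point of angle `2 t` and potential `s` is the image of the point of angle `t` and potential
  -- `s / 2`, so the doubled ray lands at the image of the fixed point.
  · intro t ht
    rw [hlands] at ht ⊢
    have h1 : Tendsto (fun s : ℝ => s / 2) (𝓝[>] 0) (𝓝[>] 0) := by
      refine tendsto_nhdsWithin_of_tendsto_nhds_of_eventually_within _ ?_ ?_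
      · have : Continuous fun s : ℝ => s / 2 := by fun_prop
        have h := this.tendsto 0
        rw [zero_div] at h
        exact h.mono_left nhdsWithin_le_nhds
      · filter_upwards [self_mem_nhdsWithin] with s hs
        exact half_pos (show (0 : ℝ) < s from hs)
    have h2 := ((ht.comp h1).pow 2).add_const X.c
    rw [hfix] at h2
    refine h2.congr' ?_
    filter_upwards [self_mem_nhdsWithin] with s hs
    have h3 : 0 < (((s / 2 : ℝ) : ℂ) + t * Complex.I).re := by simpa using hs
    simp only [Function.comp_apply]
    rw [← hsq _ h3]
    congr 1
    push_cast
    ring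
  · refine ⟨(fun θ => 2 * Real.pi * θ) '' X.angles α, hfin.image _, ?_, ?_⟩
    · rintro _ ⟨θ, hθ, rfl⟩
      rw [hT, mem_ofPred_eq, mul_div_cancel_left₀ _ (by positivity), Int.fract_eq_self.2 hθ.1]
      exact hθ
    · intro t ht
      refine ⟨_, mem_image_of_mem _ ht, fun s _ _ => ?_⟩
      simp only [hM]
      rw [hperiod s t]
  · refine ⟨2 * Real.pi * θ₀, ?_⟩
    rw [hT, mem_ofPred_eq, mul_div_cancel_left₀ _ (by positivity), Int.fract_eq_self.2 hθ₀.1]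
    exact hθ₀
  · rw [hcld]
    rintro _ ⟨w, hw, rfl⟩
    exact (X.mem_dom w hw).1
  · intro x hx hfx
    rw [hcld] at hfx
    obtain ⟨w, hw, he⟩ := hfx
    exact X.mem_disk_of_map_mem hconn hB hx hw he.symm

end ExternalStructure

end QuadraticLike

/-! ### Verification of the hypotheses on the pieces `Z_i`. -/

theorem corollary3p6 (F : QuadraticLike)
    (hconn : (0 : ℂ) ∈ F.filledJulia)
    (hrep : ∀ a ∈ F.U', F.f a = a → 1 < ‖deriv F.f a‖)
    (X : F.ExternalStructure) (α : ℂ) (hα : X.IsDividingFixedPoint α)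
    (hland : ∀ k : ℕ, F.f^[k] 0 ≠ α) :
    -- here `V` is `V^{n-1}` and `P` runs over the pieces `V^n_i`
    (∀ n : ℕ, 1 ≤ n → ∀ V : Set ℂ, X.IsNestPiece α (n - 1) V →
      (F.returnPieces V).Pairwise Disjoint ∧
      ∀ P ∈ F.returnPieces V, IsNondegenerateAnnulus V P) ∧
    -- here `V` is `V^{n-2}`, `W` is `V^{n-1}`, `P` is `V^n_i`, and `g_n = f^l` on `P`
    (F.IsSquareNormalized →
      ∀ n : ℕ, 2 ≤ n → ∀ V W : Set ℂ,
        X.IsNestPiece α (n - 2) V → X.IsNestPiece α (n - 1) W →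
        ∀ P ∈ F.returnPieces W, ∃ (h : ℂ → ℂ) (Ω : Set ℂ),
          IsUnivalentOnto h Ω (interior V) ∧ (fun z : ℂ => z ^ 2) '' P ⊆ Ω ∧
          ∀ l : ℕ, F.IsReturnPiece W P l → ∀ z ∈ P, F.f^[l] z = h (z ^ 2)) := by
  refine QuadraticLike.principalNest_of_zPieces hconn ?_ ?_
  · rintro hp _ ⟨⟨_, ⟨z, hz, rfl⟩, z', ⟨hz'U, hfz'⟩, rfl⟩, h0, α', -, hfα', hne, hα'⟩
    obtain ⟨M, L, T, H⟩ := X.exists_isExternalCoordinate hconn hα hp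
    have hg := H.isGoodPiece_closure_cell hconn hland hz
    exact ⟨hg.component hz'U hfz' QuadraticLike.dom_subset_range,
      H.noReturn hg (H.disjoint_rays hconn hland hz hz'U hfz' h0 hα' hfα' hne)⟩
  · rintro hp _ ⟨⟨_, ⟨z₁, hz₁, rfl⟩, z₁', -, rfl⟩, -⟩ _
      ⟨⟨_, ⟨z₂, hz₂, rfl⟩, z₂', -, rfl⟩, -⟩ x hx1 hx2
    obtain ⟨M, L, T, H⟩ := X.exists_isExternalCoordinate hconn hα hp
    have hg1 := H.isGoodPiece_closure_cell hconn hland hz₁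
    have hg2 := H.isGoodPiece_closure_cell hconn hland hz₂
    rw [QuadraticLike.interior_closure_component hg1.isCompact hg1.subset] at hx1
    rw [QuadraticLike.interior_closure_component hg2.isCompact hg2.subset] at hx2
    -- The image of `x` is in the interiors of two pieces of depth zero, which must coincide; then
    -- both pieces of depth one are closures of the component of `x`.
    have e := H.cell_eq_of_meet (connectedComponentIn_subset _ _ hx1).2
      (connectedComponentIn_subset _ _ hx2).2
    rw [e] at hx1
    rw [e, connectedComponentIn_eq hx1, connectedComponentIn_eq hx2]
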